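/- Let $M$ be a smooth compact oriented $n$-dimensional manifold without boundary, let $\mu$ be a (smooth, positive) volume form on $M$, and let $s>n/2$. Write $\mu$ also for the associated measure. Let $\mathcal{M}_\mu^s$ be the set of Riemannian metrics of Sobolev class $H^s$ on $M$ (hence continuous) whose volume form is $\mu$, and let $\mathcal{D}_\mu^{s+1}$ be the set of diffeomorphisms $\phi$ of $M$ of Sobolev class $H^{s+1}$ (hence $C^1$) with $\phi^*\mu=\mu$. For $(0,2)$-tensor fields $g,h$ with $g$ nondegenerate, $g^{-1}h$ is the endomorphism field with $g((g^{-1}h)u,v)=h(u,v)$; if $g,h$ are symmetric and positive definite, $g^{-1}h$ is diagonalizable with positive eigenvalues and $\log(g^{-1}h)$ is its real logarithm. Let $X$ be the set of $\mu$-measurable $(0,2)$-tensor fields $g$ on $M$ that are a.e. symmetric and positive definite, have volume form $\mu$ a.e., and satisfy $$\int_M \mathrm{tr}\big((\log(g^{-1}h))^2\big)\,d\mu<\infty\qquad\text{for all } h\in\mathcal{M}_\mu^s ,$$ where tensor fields that agree a.e. are identified. Then $$\delta(g,h)=\Big(\int_M \mathrm{tr}\big((\log(g^{-1}h))^2\big)\,d\mu\Big)^{1/2}$$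 is finite for all $g,h\in X$ and is a metric on $X$, and $(X,\delta)$ is a complete global Alexandrov NPC space. That is, $(X,\delta)$ is complete; any two points $p,r$ are joined by a geodesic, meaning a curve $\gamma:[0,1]\to X$ of length $l(\gamma)=\delta(p,r)$, parametrized proportionally to arc length; and every geodesic $\gamma$, every $q\in X$ and every $t\in[0,1]$ satisfy $$\delta(q,\gamma(t))^2\le(1-t)\,\delta(q,\gamma(0))^2+t\,\delta(q,\gamma(1))^2-t(1-t)\,l(\gamma)^2 .$$ The geodesics of $(X,\delta)$ are given by $g(t)=g\exp(t\,g^{-1}A)$, where $g\in X$ and $A$ is a measurable symmetric $(0,2)$-tensor field with $\int_M|A|_g^2\,d\mu<\infty$, $|A|_g^2=\mathrm{tr}(g^{-1}Ag^{-1}A)$, and $\mathrm{tr}_gA=\mathrm{tr}(g^{-1}A)=0$ a.e.: for all such $g,A$ the field $g(t)$ is in $X$ for every $t\in\mathbb{R}$ and, for all $a\le b$, the curve $t\mapsto g(a+t(b-a))$, $t\in[0,1]$, is a geodesic; and every geodesic $\gamma:[0,1]\to X$ is of the form $\gamma(t)=g\exp(t\,g^{-1}A)$ with such $g,A$. Moreover,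 $\mathcal{D}_\mu^{s+1}$ acts on $(X,\delta)$ by pullback isometrically: for $\phi\in\mathcal{D}_\mu^{s+1}$ the map $g\mapsto\phi^*g$ is a well-defined isometry of $X$ onto itself, the identity of $M$ lies in $\mathcal{D}_\mu^{s+1}$ and acts as the identity, and $\psi^*(\phi^*g)=(\phi\circ\psi)^*g$ in $X$ for $\phi,\psi\in\mathcal{D}_\mu^{s+1}$, $g\in X$. -/

import Mathlib

open MeasureTheory Set
open scoped Manifold ContDiff ENNReal

noncomputable section

/-! ### Linear algebra on one tangent space -/

section LinearAlgebra

variable {V : Type*} [AddCommGroup V] [Module ℝ V] [TopologicalSpace V]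
  [IsTopologicalAddGroup V] [ContinuousSMul ℝ V]

/-- The endomorphism `g⁻¹ h` of `V`, for bilinear forms `g`, `h` read as maps `V → V*`. -/
def raiseIndex (g h : V →L[ℝ] V →L[ℝ] ℝ) : V →L[ℝ] V :=
  g.inverse.comp h

/-- The trace of an endomorphism. -/
def opTrace (T : V →L[ℝ] V) : ℝ :=
  LinearMap.trace ℝ V T.toLinearMap

/-- The real logarithm of a diagonalizable endomorphism `T` with positive eigenvalues: `p(T)` for
the polynomial `p` that interpolates `Real.log` at the eigenvalues of `T` (the roots of its minimal
polynomial), so that `opLog T` is multiplication by `Real.log c` on the `c`-eigenspace of `T`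
(`opLog_apply_of_eigenvector`). -/
def opLog (T : V →L[ℝ] V) : V →L[ℝ] V :=
  Polynomial.aeval T
    (Lagrange.interpolate (minpoly ℝ T).roots.toFinset id Real.log)

theorem opLog_apply_of_eigenvector [FiniteDimensional ℝ V] (T : V →L[ℝ] V) {c : ℝ}
    {v : V} (hv : v ≠ 0) (h : T v = c • v) : opLog T v = Real.log c • v := by
  have key : ∀ p : Polynomial ℝ, Polynomial.aeval T p v = p.eval c • v := by
    intro p
    induction p using Polynomial.induction_on' with
    | add p q hp hq => simp [hp, hq, add_smul]
    | monomial k a =>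
      have hk : ∀ k : ℕ, (T ^ k) v = c ^ k • v := by
        intro k
        induction k with
        | zero => simp
        | succ k ih => rw [pow_succ', mul_apply_eq_comp, ih, map_smul, h, smul_smul,
            pow_succ]
      simp [Polynomial.aeval_monomial, hk, Algebra.algebraMap_eq_smul_one, smul_smul]
  have hint : IsIntegral ℝ T := by
    let F : (V →L[ℝ] V) →ₐ[ℝ] Module.End ℝ V :=
      { toFun := fun L => L.toLinearMap
        map_one' := rfl
        map_mul' := fun _ _ => rfl
        map_zero' := rfl
        map_add' := fun _ _ => rfl
        commutes' := fun _ => rfl }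
    have hF : Function.Injective F := fun L L' hL => ContinuousLinearMap.coe_injective hL
    exact (isIntegral_algHom_iff F hF).mp (Algebra.IsIntegral.isIntegral (F T))
  have hroot : c ∈ (minpoly ℝ T).roots.toFinset := by
    rw [Multiset.mem_toFinset, Polynomial.mem_roots (minpoly.ne_zero hint), Polynomial.IsRoot.def]
    have h1 := key (minpoly ℝ T)
    rw [minpoly.aeval, zero_apply] at h1
    exact (smul_eq_zero.mp h1.symm).resolve_right hv
  rw [opLog, key, show c = id c from rfl,
    Lagrange.eval_interpolate_at_node _ Function.injective_id.injOn hroot]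
  rfl

/-- `tr ((log (g⁻¹ h))²)`. -/
def trLogSq (g h : V →L[ℝ] V →L[ℝ] ℝ) : ℝ :=
  opTrace ((opLog (raiseIndex g h)).comp (opLog (raiseIndex g h)))

/-- `|A|_g² = tr (g⁻¹ A g⁻¹ A)`. -/
def normSqAt (g A : V →L[ℝ] V →L[ℝ] ℝ) : ℝ :=
  opTrace ((raiseIndex g A).comp (raiseIndex g A))

/-- The bilinear form `g` is symmetric. -/
def IsSymmForm (g : V →L[ℝ] V →L[ℝ] ℝ) : Prop :=
  ∀ u v, g u v = g v u

/-- The bilinear form `g` is positive definite. -/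
def IsPosForm (g : V →L[ℝ] V →L[ℝ] ℝ) : Prop :=
  ∀ v, v ≠ 0 → 0 < g v v

/-- The volume form of the inner product `g` is `μ`, in the orientation defined by `μ`: the
absolute value of `μ (v₁, …, vₙ)` is the square root of the Gram determinant of `v₁, …, vₙ`. -/
def HasVolumeForm {n : ℕ} (g : V →L[ℝ] V →L[ℝ] ℝ) (μ : V [⋀^Fin n]→ₗ[ℝ] ℝ) : Prop :=
  ∀ v : Fin n → V, |μ v| = √(Matrix.of fun i j => g (v i) (v j)).det

end LinearAlgebra

/-- The bilinear form `g exp (t g⁻¹ A)`. -/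
def expPath {V : Type*} [NormedAddCommGroup V] [NormedSpace ℝ V] (g A : V →L[ℝ] V →L[ℝ] ℝ)
    (t : ℝ) : V →L[ℝ] V →L[ℝ] ℝ :=
  g.comp (NormedSpace.exp (t • raiseIndex g A))

/-! ### Geodesics and global Alexandrov nonpositive curvature -/

section NPC

variable {N : Type*} [MetricSpace N]

/-- The length of the curve `γ` on `[0, 1]`. -/
def curveLength (γ : ℝ → N) : ℝ :=
  (eVariationOn γ (Icc 0 1)).toReal

/-- `γ` restricted to `[0, 1]` is a geodesic: a rectifiable curve whose length is the distance of
its endpoints, parametrized proportionally to arc length. -/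
def IsGeodesic (γ : ℝ → N) : Prop :=
  ContinuousOn γ (Icc 0 1) ∧
    ∀ t ∈ Icc (0 : ℝ) 1, eVariationOn γ (Icc 0 t) = ENNReal.ofReal (t * dist (γ 0) (γ 1))

variable (N) in
/-- A geodesic length space in which every geodesic satisfies the Alexandrov NPC inequality. -/
def IsGlobalNPC : Prop :=
  (∀ p q : N, ∃ γ : ℝ → N, IsGeodesic γ ∧ γ 0 = p ∧ γ 1 = q) ∧
    ∀ γ : ℝ → N, IsGeodesic γ → ∀ q : N, ∀ t ∈ Icc (0 : ℝ) 1,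
      dist q (γ t) ^ 2 ≤ (1 - t) * dist q (γ 0) ^ 2 + t * dist q (γ 1) ^ 2
        - t * (1 - t) * curveLength γ ^ 2

end NPC

/-! ### Local Sobolev spaces -/

/-- The real function `f` is of class `H^r_loc` (`r ≥ 0`) on the open set `U`: its product with
every smooth cut-off function compactly supported in `U` is in the `L²` Bessel potential space
`H^r(ℝⁿ)`. -/
def MemHsLoc {n : ℕ} (r : ℝ) (U : Set (EuclideanSpace ℝ (Fin n)))
    (f : EuclideanSpace ℝ (Fin n) → ℝ) : Prop :=
  ∀ χ : EuclideanSpace ℝ (Fin n) → ℝ, ContDiff ℝ ∞ χ → HasCompactSupport χ → tsupport χ ⊆ U →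
    ∃ u : Lp ℂ 2 (volume : Measure (EuclideanSpace ℝ (Fin n))),
      (⇑u =ᵐ[volume] fun y => ((χ y * f y : ℝ) : ℂ)) ∧
        TemperedDistribution.MemSobolev r 2 (Lp.toTemperedDistribution u)

/-! ### Tensor fields and volume forms -/

section Manifold

variable {n : ℕ} {M : Type*} [TopologicalSpace M] [ChartedSpace (EuclideanSpace ℝ (Fin n)) M]

variable (n M) in
/-- `(0,2)`-tensor fields on `M`, without any regularity. -/
abbrev TensorField : Type _ :=
  ∀ x : M, TangentSpace (𝓡 n) x →L[ℝ] TangentSpace (𝓡 n) x →L[ℝ] ℝ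

/-- The `i`-th coordinate vector field of the chart at `x₀`, at the point with coordinates `y`. -/
def coordVector (x₀ : M) (y : EuclideanSpace ℝ (Fin n)) (i : Fin n) :
    TangentSpace (𝓡 n) ((chartAt (EuclideanSpace ℝ (Fin n)) x₀).symm y) :=
  mfderiv (𝓡 n) (𝓡 n) (chartAt (EuclideanSpace ℝ (Fin n)) x₀).symm y
    (EuclideanSpace.single i (1 : ℝ) : EuclideanSpace ℝ (Fin n))

/-- The component `g_ij` of a tensor field in the chart at `x₀`, as a function of the coordinates
(meaningful on the target of the chart). -/
def TensorField.component (g : TensorField n M) (x₀ : M) (i j : Fin n)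
    (y : EuclideanSpace ℝ (Fin n)) : ℝ :=
  g ((chartAt (EuclideanSpace ℝ (Fin n)) x₀).symm y) (coordVector x₀ y i) (coordVector x₀ y j)

variable (n M) in
/-- A volume form: a smooth nowhere vanishing `n`-form. It orients `M`. -/
structure VolumeForm where
  form : ∀ x : M, TangentSpace (𝓡 n) x [⋀^Fin n]→ₗ[ℝ] ℝ
  smooth : ∀ x₀ : M, ContDiffOn ℝ ∞
    (fun y => form ((chartAt (EuclideanSpace ℝ (Fin n)) x₀).symm y) (coordVector x₀ y))
    (chartAt (EuclideanSpace ℝ (Fin n)) x₀).target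
  ne_zero : ∀ x : M, form x ≠ 0

/-- The measure that the volume form defines on the domain of the chart at `x₀` (extended by zero):
Lebesgue measure in coordinates, with density `|μ(∂₁, …, ∂ₙ)|`. -/
def VolumeForm.localMeasure [MeasurableSpace M] (μ : VolumeForm n M) (x₀ : M) : Measure M :=
  (((volume : Measure (EuclideanSpace ℝ (Fin n))).restrict
      (chartAt (EuclideanSpace ℝ (Fin n)) x₀).target).withDensity fun y =>
        ENNReal.ofReal |μ.form ((chartAt (EuclideanSpace ℝ (Fin n)) x₀).symm y)
          (coordVector x₀ y)|).map
    (chartAt (EuclideanSpace ℝ (Fin n)) x₀).symm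

/-- The measure of the volume form. The local measures agree on overlaps of charts, and their
supremum is the measure glued from them. -/
def VolumeForm.measure [MeasurableSpace M] (μ : VolumeForm n M) : Measure M :=
  ⨆ x₀ : M, μ.localMeasure x₀

/-- Measurability of a tensor field: its components in charts are Lebesgue measurable. -/
def TensorField.IsMeasurable (g : TensorField n M) : Prop :=
  ∀ (x₀ : M) (i j : Fin n), AEMeasurable (g.component x₀ i j)
    (volume.restrict (chartAt (EuclideanSpace ℝ (Fin n)) x₀).target)

/-- The set `𝓜_μ^s` of Riemannian metrics of Sobolev class `H^s` whose volume form is `μ`.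
Metrics are taken pointwise, so for `s > n / 2` an `H^s` section means its continuous
representative. -/
structure IsSobolevMetric (μ : VolumeForm n M) (s : ℝ) (h : TensorField n M) : Prop where
  symm : ∀ x, IsSymmForm (h x)
  pos : ∀ x, IsPosForm (h x)
  volumeForm : ∀ x, HasVolumeForm (h x) (μ.form x)
  continuous : ∀ (x₀ : M) (i j : Fin n),
    ContinuousOn (h.component x₀ i j) (chartAt (EuclideanSpace ℝ (Fin n)) x₀).target
  sobolev : ∀ (x₀ : M) (i j : Fin n),
    MemHsLoc s (chartAt (EuclideanSpace ℝ (Fin n)) x₀).target (h.component x₀ i j)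

/-- The tensor fields that represent the elements of `X`. -/
structure IsXField [MeasurableSpace M] (μ : VolumeForm n M) (s : ℝ) (g : TensorField n M) : Prop where
  measurable : g.IsMeasurable
  symm : ∀ᵐ x ∂μ.measure, IsSymmForm (g x)
  pos : ∀ᵐ x ∂μ.measure, IsPosForm (g x)
  volumeForm : ∀ᵐ x ∂μ.measure, HasVolumeForm (g x) (μ.form x)
  integrable : ∀ h : TensorField n M, IsSobolevMetric μ s h →
    Integrable (fun x => trLogSq (g x) (h x)) μ.measure

/-- Equality almost everywhere of tensor fields representing elements of `X`. -/
def xSetoid [MeasurableSpace M] (μ : VolumeForm n M) (s : ℝ) : Setoid {g : TensorField n M // IsXField μ s g} where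
  r g h := ∀ᵐ x ∂μ.measure, g.1 x = h.1 x
  iseqv := by
    refine ⟨fun g => Filter.Eventually.of_forall fun _ => rfl, fun h => ?_, fun h h' => ?_⟩
    · filter_upwards [h] with x hx using hx.symm
    · filter_upwards [h, h'] with x hx hx' using hx.trans hx'

/-- The set `X`, with tensor fields that agree almost everywhere identified. -/
def XSpace [MeasurableSpace M] (μ : VolumeForm n M) (s : ℝ) : Type _ :=
  Quotient (xSetoid μ s)

/-- The element of `X` represented by a tensor field. -/
def XSpace.mk [MeasurableSpace M] {μ : VolumeForm n M} {s : ℝ} (g : TensorField n M) (hg : IsXField μ s g) :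
    XSpace μ s :=
  Quotient.mk (xSetoid μ s) ⟨g, hg⟩

/-- `δ(g, h) = (∫_M tr ((log (g⁻¹ h))²) dμ)^{1/2}` for tensor fields. -/
def fieldDelta [MeasurableSpace M] (μ : VolumeForm n M) (g h : TensorField n M) : ℝ :=
  √(∫ x, trLogSq (g x) (h x) ∂μ.measure)

/-- The function `δ` on `X`. -/
def XSpace.delta [MeasurableSpace M] {μ : VolumeForm n M} {s : ℝ} (p q : XSpace μ s) : ℝ :=
  Quotient.liftOn₂ p q (fun g h => fieldDelta μ g.1 h.1) (by
    intro a b a' b' ha hb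
    have ha' : ∀ᵐ x ∂μ.measure, a.1 x = a'.1 x := ha
    have hb' : ∀ᵐ x ∂μ.measure, b.1 x = b'.1 x := hb
    unfold fieldDelta
    congr 1
    apply integral_congr_ae
    filter_upwards [ha', hb'] with x hx hx'
    rw [hx, hx'])

/-- The measurable, a.e. symmetric `(0,2)`-tensor fields `A` with `∫_M |A|_g² dμ < ∞` and
`tr_g A = 0` a.e. -/
structure IsL2Traceless [MeasurableSpace M] (μ : VolumeForm n M) (g A : TensorField n M) : Prop where
  measurable : A.IsMeasurable
  symm : ∀ᵐ x ∂μ.measure, IsSymmForm (A x)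
  integrable : Integrable (fun x => normSqAt (g x) (A x)) μ.measure
  traceless : ∀ᵐ x ∂μ.measure, opTrace (raiseIndex (g x) (A x)) = 0

/-- The tensor field `g exp (t g⁻¹ A)`. -/
def geodesicField (g A : TensorField n M) (t : ℝ) : TensorField n M :=
  fun x => expPath (V := EuclideanSpace ℝ (Fin n)) (g x) (A x) t

/-- The pullback `φ^* g`. -/
def TensorField.pullback (φ : M → M) (g : TensorField n M) : TensorField n M := fun x =>
  (ContinuousLinearMap.precomp ℝ (mfderiv (𝓡 n) (𝓡 n) φ x)).comp
    ((g (φ x)).comp (mfderiv (𝓡 n) (𝓡 n) φ x))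

theorem TensorField.pullback_apply (φ : M → M) (g : TensorField n M) (x : M)
    (u v : TangentSpace (𝓡 n) x) :
    g.pullback φ x u v =
      g (φ x) (mfderiv (𝓡 n) (𝓡 n) φ x u) (mfderiv (𝓡 n) (𝓡 n) φ x v) :=
  rfl

/-- The diffeomorphism `φ` is a volumorphism of Sobolev class `H^r` (used for `r > n / 2 + 1`, when
`H^r` maps are `C^1`): its components in charts are in `H^r_loc`, and `φ^* μ = μ`. -/
structure IsSobolevVolumorphism (μ : VolumeForm n M) (r : ℝ)
    (φ : M ≃ₘ^1⟮𝓡 n, 𝓡 n⟯ M) : Prop where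
  sobolev : ∀ (x₀ x₁ : M) (i : Fin n),
    MemHsLoc r
      ((chartAt (EuclideanSpace ℝ (Fin n)) x₀).target ∩
        (chartAt (EuclideanSpace ℝ (Fin n)) x₀).symm ⁻¹'
          (φ ⁻¹' (chartAt (EuclideanSpace ℝ (Fin n)) x₁).source))
      (fun y => chartAt (EuclideanSpace ℝ (Fin n)) x₁
        (φ ((chartAt (EuclideanSpace ℝ (Fin n)) x₀).symm y)) i)
  preserves : ∀ (x : M) (v : Fin n → TangentSpace (𝓡 n) x),
    μ.form (φ x) (fun i => mfderiv (𝓡 n) (𝓡 n) φ x (v i)) = μ.form x v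

end Manifold

end

/-!
The inner products on one tangent space form a complete space of nonpositive curvature with the
distance `√(tr (log (g⁻¹ h))²)`, and `X` is an `L²` space of maps into it; everything is proved on
the fibres and integrated.

On a fibre, two inner products have a common orthogonal basis (`exists_diagForm`), which turns every
quantity at hand into a sum over eigenvalues. The main point is the exponential metric increasing
property `normSqAt_logForm_sub_le`: `|log (p⁻¹ q) - log (p⁻¹ r)|_p² ≤ tr (log (q⁻¹ r))²`. It is
first shown with the larger right-hand side `tr (q⁻¹ r) + tr (r⁻¹ q) - 2 n`, where both sides are
sums with the same weights over pairs of eigenvectors and the inequality is `x² ≤ 4 sinh² (x / 2)`;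
the excess is of higher order, so that it disappears when the geodesic from `q` to `r` is subdivided.
Hence the logarithm at `p` does not increase distances and preserves those to `p`. This gives the
triangle inequality (`sqrt_trLogSq_triangle`), the curvature inequality with `p` on the geodesic
(`trLogSq_expPath_le`), and completeness (`exists_tendsto_of_sqrt_trLogSq_le_geometric`).

For fields, the triangle inequality follows by Minkowski's inequality (`IsInnerField.triangle`), and
finiteness on `X` by comparison with one smooth metric whose volume form is `μ`
(`exists_isSobolevMetric`). The curvature inequality is integrated. Applied to a point of an arbitrary
geodesic, it shows that the curve `g exp (t g⁻¹ A)` with `A = g log (g⁻¹ h)` is the only geodesic from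
`g` to `h` (`IsGeodesic.eq_of_npc`). A Cauchy sequence that converges fast enough converges almost
everywhere, and Fatou's lemma gives convergence in `X` (`exists_limit_field`).

A volumorphism `φ` preserves the measure of `μ` by the change of variables formula
(`measurePreserving_of_preserves`), and `tr (log (g⁻¹ h))²` is natural, so that pullback is isometric.
That `φ^* g` is in `X` again holds because `φ^* h` and `h` are continuous metrics on a compact manifold
for each Sobolev metric `h` (`IsXField.pullback`).

Measurability of pointwise constructions is proved in a frame given by a measurable choice of charts
(`TensorField.inFrame`), where a tensor field is a function with values in a fixed vector space; for
the logarithm it comes from the Lusin-Souslin theorem (`exists_measurable_logForm`).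
-/

noncomputable section

set_option linter.unusedSectionVars false

/-! ### Simultaneous diagonalization of bilinear forms -/

section Diagonalization

variable {V : Type*} [NormedAddCommGroup V] [NormedSpace ℝ V] [FiniteDimensional ℝ V]
  {ι : Type*} [Fintype ι] [DecidableEq ι]

/-- In the basis `b` the bilinear form `h` is diagonal with diagonal entries `c`. For `c = 1` this
says that `b` is `h`-orthonormal. -/
def DiagForm (b : Module.Basis ι ℝ V) (h : V →L[ℝ] V →L[ℝ] ℝ) (c : ι → ℝ) : Prop :=
  ∀ i j, h (b i) (b j) = if i = j then c i else 0

/-- The two conditions on an inner product: symmetry and positivity. -/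
structure IsInnerForm (g : V →L[ℝ] V →L[ℝ] ℝ) : Prop where
  symm : IsSymmForm g
  pos : IsPosForm g

theorem form_apply_eq_sum (b : Module.Basis ι ℝ V) (h : V →L[ℝ] V →L[ℝ] ℝ) (u v : V) :
    h u v = ∑ i, ∑ j, b.repr u i * b.repr v j * h (b i) (b j) := by
  conv_lhs => rw [← b.sum_repr u, ← b.sum_repr v]
  simp only [map_sum, map_smul, sum_apply, smul_apply,
    smul_eq_mul, Finset.mul_sum]
  rw [Finset.sum_comm]
  exact Finset.sum_congr rfl fun i _ => Finset.sum_congr rfl fun j _ => by ring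

theorem form_ext_basis (b : Module.Basis ι ℝ V) {g h : V →L[ℝ] V →L[ℝ] ℝ}
    (H : ∀ i j, g (b i) (b j) = h (b i) (b j)) : g = h := by
  classical
  ext u v
  rw [form_apply_eq_sum b g, form_apply_eq_sum b h]
  simp only [H]

theorem DiagForm.apply {b : Module.Basis ι ℝ V} {h : V →L[ℝ] V →L[ℝ] ℝ} {c : ι → ℝ}
    (H : DiagForm b h c) (u v : V) : h u v = ∑ i, c i * (b.repr u i * b.repr v i) := by
  rw [form_apply_eq_sum b]
  refine Finset.sum_congr rfl fun i _ => ?_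
  simp only [H i, mul_ite, mul_zero, Finset.sum_ite_eq, Finset.mem_univ, if_true]
  ring

theorem DiagForm.isSymmForm {b : Module.Basis ι ℝ V} {h : V →L[ℝ] V →L[ℝ] ℝ} {c : ι → ℝ}
    (H : DiagForm b h c) : IsSymmForm h := by
  intro u v
  rw [H.apply, H.apply]
  exact Finset.sum_congr rfl fun i _ => by ring

theorem DiagForm.isInnerForm {b : Module.Basis ι ℝ V} {h : V →L[ℝ] V →L[ℝ] ℝ} {c : ι → ℝ}
    (H : DiagForm b h c) (hc : ∀ i, 0 < c i) : IsInnerForm h := by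
  refine ⟨H.isSymmForm, fun v hv => ?_⟩
  rw [H.apply]
  obtain ⟨i, hi⟩ : ∃ i, b.repr v i ≠ 0 := by
    by_contra! h0
    exact hv (b.ext_elem fun i => by simp [h0 i])
  refine Finset.sum_pos' (fun j _ => mul_nonneg (hc j).le (mul_self_nonneg _))
    ⟨i, Finset.mem_univ i, mul_pos (hc i) (mul_self_pos.mpr hi)⟩

theorem IsPosForm.isInvertible {g : V →L[ℝ] V →L[ℝ] ℝ} (hg : IsPosForm g) :
    g.IsInvertible := by
  have hinj : Function.Injective g.toLinearMap := by
    rw [← LinearMap.ker_eq_bot, LinearMap.ker_eq_bot']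
    intro v hv
    by_contra h0
    have h1 := hg v h0
    have h2 : g v = 0 := hv
    rw [h2] at h1
    simp at h1
  have hdim : Module.finrank ℝ V = Module.finrank ℝ (V →L[ℝ] ℝ) := by
    rw [← (LinearMap.toContinuousLinearMap (𝕜 := ℝ) (E := V) (F' := ℝ)).finrank_eq]
    exact (Subspace.dual_finrank_eq).symm
  refine ⟨(LinearEquiv.ofInjectiveOfFinrankEq g.toLinearMap hinj hdim).toContinuousLinearEquiv, ?_⟩
  ext u v
  rfl

theorem apply_raiseIndex {g : V →L[ℝ] V →L[ℝ] ℝ} (hg : IsPosForm g) (h : V →L[ℝ] V →L[ℝ] ℝ)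
    (v : V) : g (raiseIndex g h v) = h v := by
  simp only [raiseIndex, ContinuousLinearMap.comp_apply]
  exact hg.isInvertible.self_apply_inverse _

theorem raiseIndex_eq_iff {g : V →L[ℝ] V →L[ℝ] ℝ} (hg : IsPosForm g)
    {h : V →L[ℝ] V →L[ℝ] ℝ} {v w : V} : raiseIndex g h v = w ↔ g w = h v := by
  constructor
  · rintro rfl
    exact apply_raiseIndex hg h v
  · intro hw
    rw [raiseIndex, ContinuousLinearMap.comp_apply, ← hw]
    exact hg.isInvertible.inverse_apply_self _

/-- Simultaneous diagonalization: an inner product `g` and a symmetric form `h` have a common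
orthogonal basis, which may be taken `g`-orthonormal. -/
theorem exists_diagForm {g h : V →L[ℝ] V →L[ℝ] ℝ} (hg : IsInnerForm g) (hh : IsSymmForm h) :
    ∃ (b : Module.Basis (Fin (Module.finrank ℝ V)) ℝ V) (c : Fin (Module.finrank ℝ V) → ℝ),
      DiagForm b g 1 ∧ DiagForm b h c := by
  let G : V →ₗ[ℝ] V →ₗ[ℝ] ℝ := ContinuousLinearMap.coeLM ℝ ∘ₗ g.toLinearMap
  let T : V →ₗ[ℝ] V := (raiseIndex g h).toLinearMap
  have hT : ∀ u v, g (T u) v = h u v := fun u v => by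
    change g (raiseIndex g h u) v = h u v
    rw [apply_raiseIndex hg.pos]
  -- `V` carries a norm already, so the inner product given by `g` is put on a bare vector space `W`.
  have key : ∀ (W : Type _) [AddCommGroup W] [Module ℝ W] [FiniteDimensional ℝ W]
      (G H : W →ₗ[ℝ] W →ₗ[ℝ] ℝ) (T : W →ₗ[ℝ] W), (∀ u v, G u v = G v u) →
      (∀ v, v ≠ 0 → 0 < G v v) → (∀ u v, H u v = H v u) → (∀ u v, G (T u) v = H u v) →
      ∃ (b : Module.Basis (Fin (Module.finrank ℝ W)) ℝ W) (c : Fin (Module.finrank ℝ W) → ℝ),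
        (∀ i j, G (b i) (b j) = if i = j then 1 else 0) ∧
        ∀ i j, H (b i) (b j) = if i = j then c i else 0 := by
    intro W _ _ _ G H T hG hpos hH hT
    let core : InnerProductSpace.Core ℝ W :=
      { inner := fun u v => G u v
        conj_inner_symm := fun u v => by simpa using hG v u
        re_inner_nonneg := fun u => by
          by_cases hu : u = 0
          · simp [hu]
          · simpa using (hpos u hu).le
        add_left := fun u v w => by simp
        smul_left := fun u v r => by simp
        definite := fun u hu => by
          by_contra h0
          exact (hpos u h0).ne' hu }
    let _ : NormedAddCommGroup W := core.toNormedAddCommGroup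
    let _ : InnerProductSpace ℝ W := InnerProductSpace.ofCore core.toCore
    have hin : ∀ u v : W, inner ℝ u v = G u v := fun u v => rfl
    have hs : T.IsSymmetric := by
      intro u v
      rw [hin, hin, hT, hG u (T v), hT, hH]
    let e := hs.eigenvectorBasis rfl
    refine ⟨e.toBasis, hs.eigenvalues rfl, fun i j => ?_, fun i j => ?_⟩
    · rw [← hin]
      simp only [OrthonormalBasis.coe_toBasis]
      exact orthonormal_iff_ite.mp e.orthonormal i j
    · rw [← hT, ← hin]
      simp only [OrthonormalBasis.coe_toBasis]
      rw [show T (e i) = (hs.eigenvalues rfl i : ℝ) • e i from hs.apply_eigenvectorBasis rfl i,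
        real_inner_smul_left, orthonormal_iff_ite.mp e.orthonormal i j]
      simp
  obtain ⟨b, c, h1, h2⟩ := key V G (ContinuousLinearMap.coeLM ℝ ∘ₗ h.toLinearMap) T
    hg.symm hg.pos hh hT
  exact ⟨b, c, h1, h2⟩

/-- Simultaneous diagonalization of two inner products, with the eigenvalues of `g⁻¹ h` written as
exponentials. -/
theorem exists_diagForm_exp {g h : V →L[ℝ] V →L[ℝ] ℝ} (hg : IsInnerForm g) (hh : IsInnerForm h) :
    ∃ (b : Module.Basis (Fin (Module.finrank ℝ V)) ℝ V) (c : Fin (Module.finrank ℝ V) → ℝ),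
      DiagForm b g 1 ∧ DiagForm b h (fun i => Real.exp (c i)) := by
  obtain ⟨b, c, h1, h2⟩ := exists_diagForm hg hh.symm
  refine ⟨b, fun i => Real.log (c i), h1, fun i j => ?_⟩
  have : 0 < c i := by
    have := hh.pos (b i) (b.ne_zero i)
    rwa [h2 i i, if_pos rfl] at this
  simp only [h2 i j, Real.exp_log this]

theorem DiagForm.isInnerForm_one {b : Module.Basis ι ℝ V} {g : V →L[ℝ] V →L[ℝ] ℝ}
    (H : DiagForm b g 1) : IsInnerForm g :=
  H.isInnerForm fun _ => one_pos

theorem raiseIndex_basis {b : Module.Basis ι ℝ V} {g h : V →L[ℝ] V →L[ℝ] ℝ} {c : ι → ℝ}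
    (hg : DiagForm b g 1) (hh : DiagForm b h c) (i : ι) : raiseIndex g h (b i) = c i • b i := by
  rw [raiseIndex_eq_iff hg.isInnerForm_one.pos]
  ext v
  rw [hh.apply, hg.apply]
  simp [Finsupp.single_apply]

theorem opTrace_eq_sum (b : Module.Basis ι ℝ V) {T : V →L[ℝ] V} {c : ι → ℝ}
    (h : ∀ i, T (b i) = c i • b i) : opTrace T = ∑ i, c i := by
  rw [opTrace, LinearMap.trace_eq_matrix_trace ℝ b, Matrix.trace]
  refine Finset.sum_congr rfl fun i _ => ?_
  rw [Matrix.diag_apply, LinearMap.toMatrix_apply]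
  simp [h]

theorem opLog_basis {b : Module.Basis ι ℝ V} {g h : V →L[ℝ] V →L[ℝ] ℝ} {c : ι → ℝ}
    (hg : DiagForm b g 1) (hh : DiagForm b h c) (i : ι) :
    opLog (raiseIndex g h) (b i) = Real.log (c i) • b i :=
  opLog_apply_of_eigenvector _ (b.ne_zero i) (raiseIndex_basis hg hh i)

theorem opTrace_raiseIndex {b : Module.Basis ι ℝ V} {g h : V →L[ℝ] V →L[ℝ] ℝ} {c : ι → ℝ}
    (hg : DiagForm b g 1) (hh : DiagForm b h c) : opTrace (raiseIndex g h) = ∑ i, c i :=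
  opTrace_eq_sum b (raiseIndex_basis hg hh)

theorem normSqAt_eq_sum {b : Module.Basis ι ℝ V} {g h : V →L[ℝ] V →L[ℝ] ℝ} {c : ι → ℝ}
    (hg : DiagForm b g 1) (hh : DiagForm b h c) : normSqAt g h = ∑ i, c i ^ 2 :=
  opTrace_eq_sum b fun i => by
    simp only [ContinuousLinearMap.comp_apply, raiseIndex_basis hg hh i, map_smul, smul_smul, sq]

theorem trLogSq_eq_sum {b : Module.Basis ι ℝ V} {g h : V →L[ℝ] V →L[ℝ] ℝ} {c : ι → ℝ}
    (hg : DiagForm b g 1) (hh : DiagForm b h c) : trLogSq g h = ∑ i, Real.log (c i) ^ 2 :=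
  opTrace_eq_sum b fun i => by
    simp only [ContinuousLinearMap.comp_apply, opLog_basis hg hh i, map_smul, smul_smul, sq]

theorem trLogSq_eq_sum_sq {b : Module.Basis ι ℝ V} {g h : V →L[ℝ] V →L[ℝ] ℝ} {c : ι → ℝ}
    (hg : DiagForm b g 1) (hh : DiagForm b h fun i => Real.exp (c i)) :
    trLogSq g h = ∑ i, c i ^ 2 := by
  rw [trLogSq_eq_sum hg hh]
  simp

/-- The symmetric form `g log (g⁻¹ h)`: the initial velocity of the geodesic from `g` to `h`. -/
def logForm (g h : V →L[ℝ] V →L[ℝ] ℝ) : V →L[ℝ] V →L[ℝ] ℝ :=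
  g.comp (opLog (raiseIndex g h))

theorem DiagForm.logForm {b : Module.Basis ι ℝ V} {g h : V →L[ℝ] V →L[ℝ] ℝ} {c : ι → ℝ}
    (hg : DiagForm b g 1) (hh : DiagForm b h fun i => Real.exp (c i)) :
    DiagForm b (logForm g h) c := by
  intro i j
  rw [_root_.logForm, ContinuousLinearMap.comp_apply, opLog_basis hg hh, map_smul]
  simp [hg i j]

/-- Eigenvectors of `T` are eigenvectors of `exp T`, term by term in the exponential series. -/
theorem exp_apply_of_eigenvector {T : V →L[ℝ] V} {c : ℝ} {v : V} (h : T v = c • v) :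
    NormedSpace.exp T v = Real.exp c • v := by
  have h1 := (NormedSpace.exp_series_hasSum_exp' (𝕂 := ℝ) T).mapL
    (ContinuousLinearMap.apply ℝ V v)
  have h2 := (NormedSpace.exp_series_hasSum_exp' (𝕂 := ℝ) c).smul_const v
  have hk : ∀ k : ℕ, (T ^ k) v = c ^ k • v := by
    intro k
    induction k with
    | zero => simp
    | succ k ih => rw [pow_succ', mul_apply_eq_comp, ih, map_smul, h, smul_smul, pow_succ]
  rw [Real.exp_eq_exp_ℝ]
  refine h1.unique ?_
  convert h2 using 2 with k
  simp [hk, smul_smul]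

theorem DiagForm.expPath {b : Module.Basis ι ℝ V} {g A : V →L[ℝ] V →L[ℝ] ℝ} {c : ι → ℝ}
    (hg : DiagForm b g 1) (hA : DiagForm b A c) (t : ℝ) :
    DiagForm b (expPath g A t) fun i => Real.exp (t * c i) := by
  intro i j
  have : (t • raiseIndex g A) (b i) = (t * c i) • b i := by
    rw [smul_apply, raiseIndex_basis hg hA, smul_smul]
  rw [_root_.expPath, ContinuousLinearMap.comp_apply, exp_apply_of_eigenvector this, map_smul]
  simp [hg i j]

end Diagonalization

/-! ### The exponential metric increasing property -/

section MetricIncreasing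

variable {V : Type*} [NormedAddCommGroup V] [NormedSpace ℝ V] [FiniteDimensional ℝ V]
  {ι : Type*} [Fintype ι] [DecidableEq ι]

theorem DiagForm.repr_eq {b : Module.Basis ι ℝ V} {g : V →L[ℝ] V →L[ℝ] ℝ}
    (hg : DiagForm b g 1) (v : V) (i : ι) : b.repr v i = g v (b i) := by
  rw [hg.apply]
  simp [Finsupp.single_apply]

/-- Parseval's identity in a `g`-orthonormal basis. -/
theorem DiagForm.parseval {b : Module.Basis ι ℝ V} {g : V →L[ℝ] V →L[ℝ] ℝ}
    (hg : DiagForm b g 1) (u v : V) : g u v = ∑ i, g u (b i) * g v (b i) := by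
  rw [hg.apply]
  simp [hg.repr_eq]

theorem opTrace_eq_sum_form {b : Module.Basis ι ℝ V} {g : V →L[ℝ] V →L[ℝ] ℝ}
    (hg : DiagForm b g 1) (T : V →L[ℝ] V) : opTrace T = ∑ i, g (T (b i)) (b i) := by
  rw [opTrace, LinearMap.trace_eq_matrix_trace ℝ b, Matrix.trace]
  refine Finset.sum_congr rfl fun i _ => ?_
  rw [Matrix.diag_apply, LinearMap.toMatrix_apply, hg.repr_eq]
  rfl

theorem opTrace_raiseIndex_eq_sum {b : Module.Basis ι ℝ V} {g : V →L[ℝ] V →L[ℝ] ℝ}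
    (hg : DiagForm b g 1) (h : V →L[ℝ] V →L[ℝ] ℝ) :
    opTrace (raiseIndex g h) = ∑ i, h (b i) (b i) := by
  rw [opTrace_eq_sum_form hg]
  simp only [apply_raiseIndex hg.isInnerForm_one.pos]

/-- The norm of a linear form does not depend on the orthonormal basis. -/
theorem DiagForm.sum_sq_eq {ι' : Type*} [Fintype ι'] [DecidableEq ι'] {u : Module.Basis ι ℝ V}
    {v : Module.Basis ι' ℝ V} {g : V →L[ℝ] V →L[ℝ] ℝ} (hu : DiagForm u g 1) (hv : DiagForm v g 1)
    (f : V →L[ℝ] ℝ) : ∑ i, f (u i) ^ 2 = ∑ i, f (v i) ^ 2 := by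
  obtain ⟨w, hw⟩ : ∃ w, g w = f :=
    ⟨g.inverse f, hu.isInnerForm_one.pos.isInvertible.self_apply_inverse f⟩
  simp only [← hw, sq]
  rw [← hu.parseval, ← hv.parseval]

theorem normSqAt_eq_sum_sq {b : Module.Basis ι ℝ V} {g A : V →L[ℝ] V →L[ℝ] ℝ}
    (hg : DiagForm b g 1) (hA : IsSymmForm A) : normSqAt g A = ∑ i, ∑ j, A (b i) (b j) ^ 2 := by
  have hs := hg.isInnerForm_one
  rw [normSqAt, opTrace_eq_sum_form hg]
  refine Finset.sum_congr rfl fun i _ => ?_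
  rw [ContinuousLinearMap.comp_apply, apply_raiseIndex hs.pos, hA, ← apply_raiseIndex hs.pos A (b i),
    hg.parseval]
  exact Finset.sum_congr rfl fun j _ => (sq _).symm

/-- `|A|_g²` may be computed with two different orthonormal bases for the two arguments of `A`. -/
theorem normSqAt_eq_sum_sq_mixed {ι' : Type*} [Fintype ι'] [DecidableEq ι']
    {u : Module.Basis ι ℝ V} {v : Module.Basis ι' ℝ V} {g A : V →L[ℝ] V →L[ℝ] ℝ}
    (hu : DiagForm u g 1) (hv : DiagForm v g 1) (hA : IsSymmForm A) :
    normSqAt g A = ∑ i, ∑ j, A (u i) (v j) ^ 2 := by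
  rw [normSqAt_eq_sum_sq hu hA]
  exact Finset.sum_congr rfl fun i _ => hu.sum_sq_eq hv _

/-- A basis orthogonal for `g` and `h`, rescaled to a `g`-orthonormal one. -/
theorem exists_rescaled_diagForm {b : Module.Basis ι ℝ V} {g h : V →L[ℝ] V →L[ℝ] ℝ} {a c : ι → ℝ}
    (hg : DiagForm b g fun i => Real.exp (a i)) (hh : DiagForm b h c) :
    ∃ b' : Module.Basis ι ℝ V, (∀ i, b' i = Real.exp (-(a i / 2)) • b i) ∧ DiagForm b' g 1 ∧
      DiagForm b' h fun i => Real.exp (-(a i)) * c i := by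
  have hw : ∀ i, IsUnit (Real.exp (-(a i / 2))) := fun i => (Real.exp_pos _).ne'.isUnit
  have h2 : ∀ i, Real.exp (-(a i / 2)) * Real.exp (-(a i / 2)) = Real.exp (-(a i)) := fun i => by
    rw [← Real.exp_add]; ring_nf
  refine ⟨b.isUnitSMul hw, fun i => b.isUnitSMul_apply hw i, fun i j => ?_, fun i j => ?_⟩
  · simp only [Module.Basis.isUnitSMul_apply, map_smul, smul_apply, smul_eq_mul, hg i j]
    split_ifs with hij
    · subst hij
      rw [← mul_assoc, h2, ← Real.exp_add]
      simp
    · simp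
  · simp only [Module.Basis.isUnitSMul_apply, map_smul, smul_apply, smul_eq_mul, hh i j]
    split_ifs with hij
    · subst hij
      rw [← mul_assoc, h2]
    · simp

/-- In a common orthogonal basis, not normalized for `g`, the eigenvalues of `g⁻¹ h` are the quotients
of the diagonal entries. -/
theorem trLogSq_eq_sum_sub_sq {b : Module.Basis ι ℝ V} {g h : V →L[ℝ] V →L[ℝ] ℝ} {a c : ι → ℝ}
    (hg : DiagForm b g fun i => Real.exp (a i)) (hh : DiagForm b h fun i => Real.exp (c i)) :
    trLogSq g h = ∑ i, (c i - a i) ^ 2 := by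
  obtain ⟨b', -, h1, h2⟩ := exists_rescaled_diagForm hg hh
  refine trLogSq_eq_sum_sq h1 (c := fun i => c i - a i) ?_
  simpa only [← Real.exp_add, neg_add_eq_sub] using h2

theorem opTrace_raiseIndex_eq_sum_exp {b : Module.Basis ι ℝ V} {g h : V →L[ℝ] V →L[ℝ] ℝ}
    {a c : ι → ℝ}
    (hg : DiagForm b g fun i => Real.exp (a i)) (hh : DiagForm b h fun i => Real.exp (c i)) :
    opTrace (raiseIndex g h) = ∑ i, Real.exp (c i - a i) := by
  obtain ⟨b', -, h1, h2⟩ := exists_rescaled_diagForm hg hh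
  rw [opTrace_raiseIndex h1 h2]
  simp only [← Real.exp_add, neg_add_eq_sub]

/-- `tr (g⁻¹ h) + tr (h⁻¹ g) - 2 dim V = ∑ 4 sinh² (cᵢ / 2)`, where `exp cᵢ` are the eigenvalues of
`g⁻¹ h`: a rational majorant of `tr ((log (g⁻¹ h))²) = ∑ cᵢ²`. -/
def crossTrace (g h : V →L[ℝ] V →L[ℝ] ℝ) : ℝ :=
  opTrace (raiseIndex g h) + opTrace (raiseIndex h g) - 2 * Module.finrank ℝ V

theorem finrank_eq_sum_one (b : Module.Basis ι ℝ V) :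
    (Module.finrank ℝ V : ℝ) = ∑ _i : ι, (1 : ℝ) := by
  rw [Module.finrank_eq_card_basis b]
  simp

theorem crossTrace_eq_sum {b : Module.Basis ι ℝ V} {g h : V →L[ℝ] V →L[ℝ] ℝ} {a c : ι → ℝ}
    (hg : DiagForm b g fun i => Real.exp (a i)) (hh : DiagForm b h fun i => Real.exp (c i)) :
    crossTrace g h = ∑ i, (Real.exp (c i - a i) + Real.exp (-(c i - a i)) - 2) := by
  rw [crossTrace, opTrace_raiseIndex_eq_sum_exp hg hh, opTrace_raiseIndex_eq_sum_exp hh hg,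
    finrank_eq_sum_one b, Finset.mul_sum, ← Finset.sum_add_distrib, ← Finset.sum_sub_distrib]
  exact Finset.sum_congr rfl fun i _ => by rw [neg_sub, mul_one]

theorem exp_add_exp_neg_sub_two (x : ℝ) :
    Real.exp x + Real.exp (-x) - 2 = (2 * Real.sinh (x / 2)) ^ 2 := by
  have h1 : Real.exp x = Real.exp (x / 2) * Real.exp (x / 2) := by rw [← Real.exp_add]; ring_nf
  have h2 : Real.exp (-x) = Real.exp (-(x / 2)) * Real.exp (-(x / 2)) := by
    rw [← Real.exp_add]; ring_nf
  have h3 : Real.exp (x / 2) * Real.exp (-(x / 2)) = 1 := by rw [← Real.exp_add]; simp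
  rw [Real.sinh_eq, h1, h2]
  linear_combination 2 * h3

theorem sq_le_exp_add_exp_neg_sub_two (x : ℝ) : x ^ 2 ≤ Real.exp x + Real.exp (-x) - 2 := by
  rw [exp_add_exp_neg_sub_two, sq_le_sq, abs_mul, Real.abs_sinh, abs_two]
  have := Real.self_le_sinh_iff.mpr (abs_nonneg (x / 2))
  rw [abs_div, abs_two] at *
  linarith

theorem trLogSq_le_crossTrace {g h : V →L[ℝ] V →L[ℝ] ℝ} (hg : IsInnerForm g)
    (hh : IsInnerForm h) : trLogSq g h ≤ crossTrace g h := by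
  obtain ⟨b, c, h1, h2⟩ := exists_diagForm_exp hg hh
  have h1' : DiagForm b g fun i => Real.exp (0 : ℝ) := by simpa [DiagForm] using h1
  rw [trLogSq_eq_sum_sub_sq h1' h2, crossTrace_eq_sum h1' h2]
  exact Finset.sum_le_sum fun i _ => sq_le_exp_add_exp_neg_sub_two _

theorem IsSymmForm.sub {g h : V →L[ℝ] V →L[ℝ] ℝ} (hg : IsSymmForm g) (hh : IsSymmForm h) :
    IsSymmForm (g - h) := fun u v => by simp [hg u v, hh u v]

theorem IsInnerForm.isSymmForm_logForm {g h : V →L[ℝ] V →L[ℝ] ℝ} (hg : IsInnerForm g)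
    (hh : IsInnerForm h) : IsSymmForm (logForm g h) := by
  obtain ⟨b, c, h1, h2⟩ := exists_diagForm_exp hg hh
  exact (h1.logForm h2).isSymmForm

/-- The coarse form of the exponential metric increasing property. With `p`-orthonormal eigenbases
`u` of `p⁻¹ q` (eigenvalues `exp aᵢ`) and `v` of `p⁻¹ r` (eigenvalues `exp bⱼ`) and the weights
`p (uᵢ, vⱼ)²`, both sides are weighted sums over `i, j`, of `(aᵢ - bⱼ)²` on the left and of
`4 sinh² ((aᵢ - bⱼ) / 2)` on the right. -/
theorem normSqAt_logForm_sub_le_crossTrace {p q r : V →L[ℝ] V →L[ℝ] ℝ} (hp : IsInnerForm p)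
    (hq : IsInnerForm q) (hr : IsInnerForm r) :
    normSqAt p (logForm p q - logForm p r) ≤ crossTrace q r := by
  obtain ⟨u, a, hu, hqa⟩ := exists_diagForm_exp hp hq
  obtain ⟨v, b, hv, hrb⟩ := exists_diagForm_exp hp hr
  have hsymm := (hp.isSymmForm_logForm hq).sub (hp.isSymmForm_logForm hr)
  have hq' : ∀ x y, logForm p q x y = ∑ i, a i * (p x (u i) * p y (u i)) := fun x y => by
    rw [(hu.logForm hqa).apply]; simp only [hu.repr_eq]
  have hr' : ∀ x y, logForm p r x y = ∑ i, b i * (p x (v i) * p y (v i)) := fun x y => by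
    rw [(hv.logForm hrb).apply]; simp only [hv.repr_eq]
  rw [normSqAt_eq_sum_sq_mixed hu hv hsymm]
  have hij : ∀ i j, (logForm p q - logForm p r) (u i) (v j) = (a i - b j) * p (u i) (v j) := by
    intro i j
    rw [sub_apply, sub_apply, hq', hr', sub_mul]
    congr 1
    · simp [hu i, hp.symm (v j)]
    · simp [hv j]
  -- `tr (q₁⁻¹ q₂)` in terms of the eigenvalues of both forms and the angles between their eigenbases.
  have htr : ∀ {b₁ b₂ : Module.Basis (Fin (Module.finrank ℝ V)) ℝ V} {a₁ a₂ : _ → ℝ}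
      {q₁ q₂ : V →L[ℝ] V →L[ℝ] ℝ} (_ : DiagForm b₂ p 1)
      (_ : DiagForm b₁ q₁ fun i => Real.exp (a₁ i)) (_ : DiagForm b₂ q₂ fun i => Real.exp (a₂ i)),
      opTrace (raiseIndex q₁ q₂) = ∑ i, ∑ j, Real.exp (a₂ j - a₁ i) * p (b₁ i) (b₂ j) ^ 2 := by
    intro b₁ b₂ a₁ a₂ q₁ q₂ hb₂ h1 h2
    obtain ⟨b', hb', h3, -⟩ := exists_rescaled_diagForm h1 h1
    rw [opTrace_raiseIndex_eq_sum h3]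
    refine Finset.sum_congr rfl fun i _ => ?_
    rw [h2.apply]
    refine Finset.sum_congr rfl fun j _ => ?_
    rw [hb₂.repr_eq, hb', map_smul, smul_apply, smul_eq_mul,
      show a₂ j - a₁ i = a₂ j + (-(a₁ i / 2) + -(a₁ i / 2)) by ring, Real.exp_add, Real.exp_add]
    ring
  have hn : (Module.finrank ℝ V : ℝ) = ∑ i, ∑ j, p (u i) (v j) ^ 2 := by
    rw [finrank_eq_sum_one u]
    refine Finset.sum_congr rfl fun i _ => ?_
    have := hv.parseval (u i) (u i)
    rw [hu i i] at this
    simpa [sq] using this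
  rw [crossTrace, htr hv hqa hrb, htr hu hrb hqa, hn, Finset.sum_comm (f := fun i j =>
    Real.exp (a j - b i) * p (v i) (u j) ^ 2), Finset.mul_sum]
  simp only [Finset.mul_sum]
  rw [← Finset.sum_add_distrib, ← Finset.sum_sub_distrib]
  refine Finset.sum_le_sum fun i _ => ?_
  rw [← Finset.sum_add_distrib, ← Finset.sum_sub_distrib]
  refine Finset.sum_le_sum fun j _ => ?_
  rw [hij, hp.symm (v j) (u i), mul_pow]
  have := mul_le_mul_of_nonneg_right (sq_le_exp_add_exp_neg_sub_two (a i - b j))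
    (sq_nonneg (p (u i) (v j)))
  rw [neg_sub] at this
  linarith

/-- The components of a bilinear form in a basis, as a vector of a Euclidean space. -/
def formCoords (b : Module.Basis ι ℝ V) (A : V →L[ℝ] V →L[ℝ] ℝ) : EuclideanSpace ℝ (ι × ι) :=
  WithLp.toLp 2 fun k => A (b k.1) (b k.2)

theorem formCoords_sub (b : Module.Basis ι ℝ V) (A B : V →L[ℝ] V →L[ℝ] ℝ) :
    formCoords b (A - B) = formCoords b A - formCoords b B := by
  ext k; simp [formCoords]

theorem formCoords_add (b : Module.Basis ι ℝ V) (A B : V →L[ℝ] V →L[ℝ] ℝ) :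
    formCoords b (A + B) = formCoords b A + formCoords b B := by
  ext k; simp [formCoords]

theorem formCoords_smul (b : Module.Basis ι ℝ V) (c : ℝ) (A : V →L[ℝ] V →L[ℝ] ℝ) :
    formCoords b (c • A) = c • formCoords b A := by
  ext k; simp [formCoords]

theorem norm_formCoords_sq {b : Module.Basis ι ℝ V} {g A : V →L[ℝ] V →L[ℝ] ℝ}
    (hg : DiagForm b g 1) (hA : IsSymmForm A) : ‖formCoords b A‖ ^ 2 = normSqAt g A := by
  rw [normSqAt_eq_sum_sq hg hA, EuclideanSpace.real_norm_sq_eq, Fintype.sum_prod_type]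
  rfl

/-- `4 sinh² (x / 2) ~ x²` at `0`: on `N` equal pieces of a geodesic, `N` times the sum of the coarse
bounds tends to the exact squared length. -/
theorem tendsto_nat_sq_mul_exp (z : ℝ) :
    Filter.Tendsto (fun N : ℕ => (N : ℝ) ^ 2 * (Real.exp ((N : ℝ)⁻¹ * z) +
      Real.exp (-((N : ℝ)⁻¹ * z)) - 2)) Filter.atTop (nhds (z ^ 2)) := by
  have hd : HasDerivAt (fun t : ℝ => 2 * Real.sinh (t * z / 2)) z 0 := by
    have h0 : HasDerivAt (fun t : ℝ => t * z / 2) (z / 2) 0 := by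
      simpa using ((hasDerivAt_id (0 : ℝ)).mul_const z).div_const 2
    have := (h0.sinh).const_mul 2
    convert! this using 1
    simp; ring
  have h1 := hd.tendsto_slope_zero
  have h2 : Filter.Tendsto (fun N : ℕ => (N : ℝ)⁻¹) Filter.atTop (nhdsWithin 0 {0}ᶜ) := by
    refine tendsto_nhdsWithin_iff.mpr ⟨tendsto_inv_atTop_nhds_zero_nat, ?_⟩
    filter_upwards [Filter.eventually_gt_atTop 0] with N hN
    simp [hN.ne']
  refine ((h1.comp h2).pow 2).congr fun N => ?_
  rw [exp_add_exp_neg_sub_two, ← mul_pow]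
  simp

/-- The exponential metric increasing property: `q ↦ log (p⁻¹ q)` does not increase distances. The
coarse inequality is applied along a subdivision of the geodesic from `q` to `r`. -/
theorem normSqAt_logForm_sub_le {p q r : V →L[ℝ] V →L[ℝ] ℝ} (hp : IsInnerForm p)
    (hq : IsInnerForm q) (hr : IsInnerForm r) :
    normSqAt p (logForm p q - logForm p r) ≤ trLogSq q r := by
  obtain ⟨e, -, he, -⟩ := exists_diagForm hp hp.symm
  obtain ⟨b, z, hb, hz⟩ := exists_diagForm_exp hq hr
  set γ : ℝ → (V →L[ℝ] V →L[ℝ] ℝ) := expPath q (logForm q r) with hγ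
  have hdiag : ∀ t, DiagForm b (γ t) fun i => Real.exp (t * z i) :=
    fun t => hb.expPath (hb.logForm hz) t
  have hin : ∀ t, IsInnerForm (γ t) := fun t => (hdiag t).isInnerForm fun i => Real.exp_pos _
  have h0 : γ 0 = q := form_ext_basis b fun i j => by rw [hdiag 0 i j, hb i j]; simp
  have h1 : γ 1 = r := form_ext_basis b fun i j => by rw [hdiag 1 i j, hz i j]; simp
  set Φ : ℝ → EuclideanSpace ℝ _ := fun t => formCoords e (logForm p (γ t)) with hΦ
  have hstep : ∀ s t, ‖Φ s - Φ t‖ ^ 2 ≤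
      ∑ i, (Real.exp ((t - s) * z i) + Real.exp (-((t - s) * z i)) - 2) := by
    intro s t
    rw [hΦ, ← formCoords_sub, norm_formCoords_sq he
      ((hp.isSymmForm_logForm (hin s)).sub (hp.isSymmForm_logForm (hin t)))]
    refine (normSqAt_logForm_sub_le_crossTrace hp (hin s) (hin t)).trans_eq ?_
    rw [crossTrace_eq_sum (hdiag s) (hdiag t)]
    simp only [sub_mul]
  rw [trLogSq_eq_sum_sq hb hz]
  have hlim : Filter.Tendsto (fun N : ℕ => ∑ i, (N : ℝ) ^ 2 * (Real.exp ((N : ℝ)⁻¹ * z i) +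
      Real.exp (-((N : ℝ)⁻¹ * z i)) - 2)) Filter.atTop (nhds (∑ i, z i ^ 2)) :=
    tendsto_finsetSum _ fun i _ => tendsto_nat_sq_mul_exp (z i)
  refine ge_of_tendsto hlim ?_
  filter_upwards [Filter.eventually_gt_atTop 0] with N hN
  have hN' : (0 : ℝ) < N := by exact_mod_cast hN
  rw [← Finset.mul_sum]
  set S := ∑ i, (Real.exp ((N : ℝ)⁻¹ * z i) + Real.exp (-((N : ℝ)⁻¹ * z i)) - 2) with hS
  have hS0 : 0 ≤ S := by
    have := (sq_nonneg _).trans (hstep 0 (N : ℝ)⁻¹)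
    rwa [sub_zero] at this
  -- The `N` steps of length `1 / N` have the same bound, because `γ` has constant speed.
  have hsum : ‖Φ 0 - Φ 1‖ ≤ N * √S := by
    have h := dist_le_range_sum_dist (fun k : ℕ => Φ (k * (N : ℝ)⁻¹)) N
    simp only [Nat.cast_zero, zero_mul, mul_inv_cancel₀ hN'.ne', dist_eq_norm] at h
    refine h.trans ?_
    rw [← nsmul_eq_mul, ← Finset.card_range N, ← Finset.sum_const, Finset.card_range]
    refine Finset.sum_le_sum fun k _ => Real.le_sqrt_of_sq_le ((hstep _ _).trans_eq ?_)
    rw [hS]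
    push_cast
    ring_nf
  have := pow_le_pow_left₀ (norm_nonneg _) hsum 2
  rw [mul_pow, Real.sq_sqrt hS0] at this
  refine le_trans (le_of_eq ?_) this
  rw [hΦ, ← formCoords_sub, norm_formCoords_sq he
    ((hp.isSymmForm_logForm (hin 0)).sub (hp.isSymmForm_logForm (hin 1))), h0, h1]

end MetricIncreasing

/-! ### The geometry of inner products on one tangent space -/

section InnerProducts

variable {V : Type*} [NormedAddCommGroup V] [NormedSpace ℝ V] [FiniteDimensional ℝ V]
  {ι : Type*} [Fintype ι] [DecidableEq ι]

theorem expPath_zero (g A : V →L[ℝ] V →L[ℝ] ℝ) : expPath g A 0 = g := by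
  rw [expPath, zero_smul, NormedSpace.exp_zero]
  rfl

theorem IsInnerForm.expPath {g A : V →L[ℝ] V →L[ℝ] ℝ} (hg : IsInnerForm g) (hA : IsSymmForm A)
    (t : ℝ) : IsInnerForm (expPath g A t) := by
  obtain ⟨b, c, h1, h2⟩ := exists_diagForm hg hA
  exact (h1.expPath h2 t).isInnerForm fun i => Real.exp_pos _

theorem expPath_logForm_one {g h : V →L[ℝ] V →L[ℝ] ℝ} (hg : IsInnerForm g) (hh : IsInnerForm h) :
    expPath g (logForm g h) 1 = h := by
  obtain ⟨b, c, h1, h2⟩ := exists_diagForm_exp hg hh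
  exact form_ext_basis b fun i j => by rw [h1.expPath (h1.logForm h2) 1 i j, h2 i j]; simp

theorem logForm_expPath_one {g A : V →L[ℝ] V →L[ℝ] ℝ} (hg : IsInnerForm g) (hA : IsSymmForm A) :
    logForm g (expPath g A 1) = A := by
  obtain ⟨b, c, h1, h2⟩ := exists_diagForm hg hA
  have h3 : DiagForm b (expPath g A 1) fun i => Real.exp (c i) := by
    simpa only [one_mul] using h1.expPath h2 1
  exact form_ext_basis b fun i j => by rw [h1.logForm h3 i j, h2 i j]

theorem normSqAt_logForm {g h : V →L[ℝ] V →L[ℝ] ℝ} (hg : IsInnerForm g) (hh : IsInnerForm h) :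
    normSqAt g (logForm g h) = trLogSq g h := by
  obtain ⟨b, c, h1, h2⟩ := exists_diagForm_exp hg hh
  rw [normSqAt_eq_sum h1 (h1.logForm h2), trLogSq_eq_sum_sq h1 h2]

theorem normSqAt_nonneg {g A : V →L[ℝ] V →L[ℝ] ℝ} (hg : IsInnerForm g) (hA : IsSymmForm A) :
    0 ≤ normSqAt g A := by
  obtain ⟨b, c, h1, h2⟩ := exists_diagForm hg hA
  rw [normSqAt_eq_sum h1 h2]
  exact Finset.sum_nonneg fun i _ => sq_nonneg _

theorem trLogSq_nonneg {g h : V →L[ℝ] V →L[ℝ] ℝ} (hg : IsInnerForm g) (hh : IsInnerForm h) :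
    0 ≤ trLogSq g h := by
  rw [← normSqAt_logForm hg hh]
  exact normSqAt_nonneg hg (hg.isSymmForm_logForm hh)

theorem trLogSq_comm {g h : V →L[ℝ] V →L[ℝ] ℝ} (hg : IsInnerForm g) (hh : IsInnerForm h) :
    trLogSq g h = trLogSq h g := by
  obtain ⟨b, c, h1, h2⟩ := exists_diagForm_exp hg hh
  have h1' : DiagForm b g fun i => Real.exp (0 : ℝ) := by simpa [DiagForm] using h1
  rw [trLogSq_eq_sum_sub_sq h1' h2, trLogSq_eq_sum_sub_sq h2 h1']
  exact Finset.sum_congr rfl fun i _ => by ring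

theorem trLogSq_self {g : V →L[ℝ] V →L[ℝ] ℝ} (hg : IsInnerForm g) : trLogSq g g = 0 := by
  obtain ⟨b, c, h1, h2⟩ := exists_diagForm_exp hg hg
  rw [trLogSq_eq_sum_sub_sq h2 h2]
  simp

theorem eq_of_trLogSq_eq_zero {g h : V →L[ℝ] V →L[ℝ] ℝ} (hg : IsInnerForm g) (hh : IsInnerForm h)
    (H : trLogSq g h = 0) : g = h := by
  obtain ⟨b, c, h1, h2⟩ := exists_diagForm_exp hg hh
  rw [trLogSq_eq_sum_sq h1 h2, Finset.sum_eq_zero_iff_of_nonneg fun i _ => sq_nonneg _] at H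
  refine form_ext_basis b fun i j => ?_
  simp [h1 i j, h2 i j, pow_eq_zero_iff two_ne_zero |>.mp (H i (Finset.mem_univ i))]

theorem trLogSq_expPath {g A : V →L[ℝ] V →L[ℝ] ℝ} (hg : IsInnerForm g) (hA : IsSymmForm A)
    (s t : ℝ) : trLogSq (expPath g A s) (expPath g A t) = (t - s) ^ 2 * normSqAt g A := by
  obtain ⟨b, c, h1, h2⟩ := exists_diagForm hg hA
  rw [trLogSq_eq_sum_sub_sq (h1.expPath h2 s) (h1.expPath h2 t), normSqAt_eq_sum h1 h2,
    Finset.mul_sum]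
  exact Finset.sum_congr rfl fun i _ => by ring

/-- The triangle inequality: since `q ↦ log (p⁻¹ q)` does not increase distances and preserves the
distance to `p`, it reduces to that of a Euclidean norm. -/
theorem sqrt_trLogSq_triangle {p q r : V →L[ℝ] V →L[ℝ] ℝ} (hp : IsInnerForm p)
    (hq : IsInnerForm q) (hr : IsInnerForm r) :
    √(trLogSq p r) ≤ √(trLogSq p q) + √(trLogSq q r) := by
  obtain ⟨e, -, he, -⟩ := exists_diagForm hp hp.symm
  have h1 : √(trLogSq p r) = ‖formCoords e (logForm p r)‖ := by
    rw [← normSqAt_logForm hp hr, ← norm_formCoords_sq he (hp.isSymmForm_logForm hr),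
      Real.sqrt_sq (norm_nonneg _)]
  have h2 : √(trLogSq p q) = ‖formCoords e (logForm p q)‖ := by
    rw [← normSqAt_logForm hp hq, ← norm_formCoords_sq he (hp.isSymmForm_logForm hq),
      Real.sqrt_sq (norm_nonneg _)]
  have h3 : ‖formCoords e (logForm p q) - formCoords e (logForm p r)‖ ≤ √(trLogSq q r) := by
    refine Real.le_sqrt_of_sq_le ?_
    rw [← formCoords_sub, norm_formCoords_sq he
      ((hp.isSymmForm_logForm hq).sub (hp.isSymmForm_logForm hr))]
    exact normSqAt_logForm_sub_le hp hq hr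
  rw [h1, h2]
  refine le_trans ?_ (add_le_add_right h3 _)
  have := norm_sub_norm_le (formCoords e (logForm p r)) (formCoords e (logForm p q))
  rw [norm_sub_rev] at this
  linarith

/-- The nonpositive curvature inequality on one tangent space. Seen from the point `γ t` of the
geodesic, the logarithm flattens the geodesic to a line and does not increase the distances from `q`
to its endpoints; in a Euclidean space the inequality is an identity. -/
theorem trLogSq_expPath_le {g A q : V →L[ℝ] V →L[ℝ] ℝ} (hg : IsInnerForm g) (hA : IsSymmForm A)
    (hq : IsInnerForm q) {t : ℝ} (ht : t ∈ Icc (0 : ℝ) 1) :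
    trLogSq q (expPath g A t) ≤ (1 - t) * trLogSq q (expPath g A 0) + t * trLogSq q (expPath g A 1)
      - t * (1 - t) * normSqAt g A := by
  obtain ⟨b, c, h1, h2⟩ := exists_diagForm hg hA
  have hin : ∀ s, IsInnerForm (expPath g A s) := fun s => hg.expPath hA s
  set p := expPath g A t with hp
  -- A common `p`-orthonormal eigenbasis, in which `log (p⁻¹ γ s)` is `s - t` times a fixed matrix.
  have hb' : ∃ b' : Module.Basis (Fin (Module.finrank ℝ V)) ℝ V, DiagForm b' p 1 ∧
      ∀ s, DiagForm b' (logForm p (expPath g A s)) fun i => (s - t) * c i := by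
    obtain ⟨b', hb', h3, -⟩ := exists_rescaled_diagForm (h1.expPath h2 t) h1
    refine ⟨b', h3, fun s => h3.logForm ?_⟩
    obtain ⟨b'', hb'', h3', h4⟩ := exists_rescaled_diagForm (h1.expPath h2 t) (h1.expPath h2 s)
    have hbb : b'' = b' := Module.Basis.eq_of_apply_eq fun i => by rw [hb', hb'']
    rw [hbb] at h4
    simpa only [← Real.exp_add, neg_add_eq_sub, ← sub_mul] using h4
  obtain ⟨e, he, hlog⟩ := hb'
  set X := logForm p (expPath g A (t + 1)) with hX
  have hXs : IsSymmForm X := (hlog (t + 1)).isSymmForm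
  have hlin : ∀ s, logForm p (expPath g A s) = (s - t) • X := fun s =>
    form_ext_basis e fun i j => by
      rw [hlog s i j, smul_apply, smul_apply, hlog (t + 1) i j]
      split_ifs <;> simp
  have hXn : ‖formCoords e X‖ ^ 2 = normSqAt g A := by
    rw [norm_formCoords_sq he hXs, normSqAt_eq_sum he (hlog (t + 1)), normSqAt_eq_sum h1 h2]
    simp
  have hY : ‖formCoords e (logForm p q)‖ ^ 2 = trLogSq q p := by
    rw [norm_formCoords_sq he ((hin t).isSymmForm_logForm hq), normSqAt_logForm (hin t) hq,
      trLogSq_comm hq (hin t)]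
  have hle : ∀ s, ‖formCoords e (logForm p q) - (s - t) • formCoords e X‖ ^ 2
      ≤ trLogSq q (expPath g A s) := fun s => by
    rw [← formCoords_smul, ← formCoords_sub, ← hlin s, norm_formCoords_sq he
      (((hin t).isSymmForm_logForm hq).sub ((hin t).isSymmForm_logForm (hin s)))]
    exact normSqAt_logForm_sub_le (hin t) hq (hin s)
  have e0 := mul_le_mul_of_nonneg_left (hle 0) (sub_nonneg.mpr ht.2)
  have e1 := mul_le_mul_of_nonneg_left (hle 1) ht.1
  rw [← hY, ← hXn]
  rw [norm_sub_sq_real, norm_smul, inner_smul_right, mul_pow, Real.norm_eq_abs, sq_abs] at e0 e1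
  linarith

theorem continuous_opTrace : Continuous (opTrace (V := V)) :=
  (LinearMap.trace ℝ V ∘ₗ ContinuousLinearMap.coeLM ℝ).continuous_of_finiteDimensional

theorem continuousAt_raiseIndex {g : V →L[ℝ] V →L[ℝ] ℝ} (hg : IsPosForm g)
    (h : V →L[ℝ] V →L[ℝ] ℝ) :
    ContinuousAt (fun p : (V →L[ℝ] V →L[ℝ] ℝ) × (V →L[ℝ] V →L[ℝ] ℝ) => raiseIndex p.1 p.2)
      (g, h) := by
  obtain ⟨e, he⟩ := hg.isInvertible
  have h1 : ContinuousAt (fun p : (V →L[ℝ] V →L[ℝ] ℝ) × (V →L[ℝ] V →L[ℝ] ℝ) =>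
      p.1.inverse) (g, h) := by
    have : ContinuousAt ContinuousLinearMap.inverse g := by
      rw [← he]
      exact (contDiffAt_map_inverse (n := 0) e).continuousAt
    exact ContinuousAt.comp (f := Prod.fst) (x := (g, h)) this continuousAt_fst
  exact h1.clm_comp continuousAt_snd

theorem continuousAt_expPath {g : V →L[ℝ] V →L[ℝ] ℝ} (hg : IsPosForm g)
    (A : V →L[ℝ] V →L[ℝ] ℝ) (t : ℝ) :
    ContinuousAt (fun p : (V →L[ℝ] V →L[ℝ] ℝ) × (V →L[ℝ] V →L[ℝ] ℝ) => expPath p.1 p.2 t)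
      (g, A) := by
  have h1 := (continuousAt_raiseIndex hg A).const_smul t
  let _ : NormedAlgebra ℚ (V →L[ℝ] V) := NormedAlgebra.restrictScalars ℚ ℝ _
  have h2 : ContinuousAt (fun p : (V →L[ℝ] V →L[ℝ] ℝ) × (V →L[ℝ] V →L[ℝ] ℝ) =>
      NormedSpace.exp (t • raiseIndex p.1 p.2)) (g, A) :=
    ContinuousAt.comp (g := NormedSpace.exp)
      (NormedSpace.exp_continuous (𝔸 := V →L[ℝ] V)).continuousAt h1
  exact continuousAt_fst.clm_comp h2

theorem continuousAt_normSqAt {g : V →L[ℝ] V →L[ℝ] ℝ} (hg : IsPosForm g)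
    (A : V →L[ℝ] V →L[ℝ] ℝ) :
    ContinuousAt (fun p : (V →L[ℝ] V →L[ℝ] ℝ) × (V →L[ℝ] V →L[ℝ] ℝ) => normSqAt p.1 p.2)
      (g, A) := by
  have h1 := continuousAt_raiseIndex hg A
  exact continuous_opTrace.continuousAt.comp (h1.clm_comp h1)

theorem continuousAt_crossTrace {g h : V →L[ℝ] V →L[ℝ] ℝ} (hg : IsPosForm g)
    (hh : IsPosForm h) :
    ContinuousAt (fun p : (V →L[ℝ] V →L[ℝ] ℝ) × (V →L[ℝ] V →L[ℝ] ℝ) => crossTrace p.1 p.2)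
      (g, h) := by
  have h1 := continuous_opTrace.continuousAt.comp (continuousAt_raiseIndex hg h)
  have h2 : ContinuousAt (fun p : (V →L[ℝ] V →L[ℝ] ℝ) × (V →L[ℝ] V →L[ℝ] ℝ) =>
      opTrace (raiseIndex p.2 p.1)) (g, h) :=
    ContinuousAt.comp (f := Prod.swap) (x := (g, h))
      (g := fun p : (V →L[ℝ] V →L[ℝ] ℝ) × (V →L[ℝ] V →L[ℝ] ℝ) => opTrace (raiseIndex p.1 p.2))
      (continuous_opTrace.continuousAt.comp (continuousAt_raiseIndex hh g))
      continuous_swap.continuousAt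
  exact (h1.add h2).sub continuousAt_const

theorem crossTrace_self {g : V →L[ℝ] V →L[ℝ] ℝ} (hg : IsInnerForm g) : crossTrace g g = 0 := by
  obtain ⟨b, c, h1, h2⟩ := exists_diagForm_exp hg hg
  rw [crossTrace_eq_sum h2 h2]
  norm_num

/-- Convergence of forms implies convergence in the distance, through the continuous majorant. -/
theorem tendsto_trLogSq_zero {α : Type*} {l : Filter α} {q : α → V →L[ℝ] V →L[ℝ] ℝ}
    {r : V →L[ℝ] V →L[ℝ] ℝ} (hq : ∀ k, IsInnerForm (q k)) (hr : IsInnerForm r)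
    (h : Filter.Tendsto q l (nhds r)) : Filter.Tendsto (fun k => trLogSq (q k) r) l (nhds 0) := by
  have h1 : Filter.Tendsto (fun k => crossTrace (q k) r) l (nhds 0) := by
    have := (continuousAt_crossTrace hr.pos hr.pos).tendsto.comp
      (h.prodMk_nhds (tendsto_const_nhds (x := r)))
    rwa [crossTrace_self hr] at this
  exact squeeze_zero (fun k => trLogSq_nonneg (hq k) hr)
    (fun k => trLogSq_le_crossTrace (hq k) hr) h1

theorem continuous_form_apply (u v : V) : Continuous fun A : V →L[ℝ] V →L[ℝ] ℝ => A u v := by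
  fun_prop

theorem isClosed_isSymmForm : IsClosed {A : V →L[ℝ] V →L[ℝ] ℝ | IsSymmForm A} := by
  simp only [IsSymmForm, Set.ofPred_forall]
  exact isClosed_iInter fun u => isClosed_iInter fun v =>
    isClosed_eq (continuous_form_apply u v) (continuous_form_apply v u)

/-- Completeness of the space of inner products on one tangent space: the logarithms at `q 0` form a
Cauchy sequence of symmetric forms, and the exponential carries their limit to the limit of `q`. -/
theorem exists_tendsto_of_sqrt_trLogSq_le_geometric {q : ℕ → V →L[ℝ] V →L[ℝ] ℝ}
    (hq : ∀ k, IsInnerForm (q k)) {C r : ℝ} (hr : r < 1)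
    (h : ∀ k, √(trLogSq (q k) (q (k + 1))) ≤ C * r ^ k) :
    ∃ p, IsInnerForm p ∧ Filter.Tendsto q Filter.atTop (nhds p) := by
  obtain ⟨e, -, he, -⟩ := exists_diagForm (hq 0) (hq 0).symm
  let F : (V →L[ℝ] V →L[ℝ] ℝ) →ₗ[ℝ] EuclideanSpace ℝ
      (Fin (Module.finrank ℝ V) × Fin (Module.finrank ℝ V)) :=
    { toFun := formCoords e
      map_add' := formCoords_add e
      map_smul' := formCoords_smul e }
  obtain ⟨K, -, hK⟩ := LinearMap.exists_antilipschitzWith (𝕜 := ℝ)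
    (E := V →L[ℝ] V →L[ℝ] ℝ) F (by
    rw [LinearMap.ker_eq_bot']
    intro A hA
    refine form_ext_basis e fun i j => ?_
    have : formCoords e A (i, j) = 0 := by
      rw [show formCoords e A = 0 from hA]; rfl
    simpa [formCoords] using this)
  have hKd : ∀ B B' : V →L[ℝ] V →L[ℝ] ℝ,
      dist B B' ≤ K * dist (formCoords e B) (formCoords e B') := hK.le_mul_dist
  set A : ℕ → V →L[ℝ] V →L[ℝ] ℝ := fun k => logForm (q 0) (q k) with hA
  have hs : ∀ k, IsSymmForm (A k) := fun k => (hq 0).isSymmForm_logForm (hq k)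
  have hc : CauchySeq A := by
    refine cauchySeq_of_le_geometric (α := V →L[ℝ] V →L[ℝ] ℝ) (f := A) r (K * C) hr fun k => ?_
    refine (hKd _ _).trans ?_
    rw [mul_assoc]
    refine mul_le_mul_of_nonneg_left ?_ K.2
    rw [dist_eq_norm, ← formCoords_sub]
    refine le_trans (Real.le_sqrt_of_sq_le ?_) (h k)
    exact (norm_formCoords_sq he ((hs k).sub (hs (k + 1)))).trans_le
      (normSqAt_logForm_sub_le (hq 0) (hq k) (hq (k + 1)))
  obtain ⟨B, hB⟩ := cauchySeq_tendsto_of_complete hc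
  have hBs : IsSymmForm B :=
    isClosed_isSymmForm.mem_of_tendsto hB (Filter.Eventually.of_forall hs)
  refine ⟨expPath (q 0) B 1, (hq 0).expPath hBs 1, ?_⟩
  refine ((continuousAt_expPath (hq 0).pos B 1).tendsto.comp
    ((tendsto_const_nhds (x := q 0)).prodMk_nhds hB)).congr fun k => ?_
  exact expPath_logForm_one (hq 0) (hq k)

/-! ### Volume forms of inner products -/

/-- Simultaneous diagonalization with a basis indexed by `Fin n` for a given dimension `n`. -/
theorem exists_diagForm_fin {n : ℕ} (hn : Module.finrank ℝ V = n) {g h : V →L[ℝ] V →L[ℝ] ℝ}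
    (hg : IsInnerForm g) (hh : IsSymmForm h) :
    ∃ (b : Module.Basis (Fin n) ℝ V) (c : Fin n → ℝ), DiagForm b g 1 ∧ DiagForm b h c := by
  subst hn
  exact exists_diagForm hg hh

theorem alternatingMap_eq_mul_det {n : ℕ} (b : Module.Basis (Fin n) ℝ V) (μ : V [⋀^Fin n]→ₗ[ℝ] ℝ)
    (v : Fin n → V) : μ v = μ b * (b.toMatrix v).det := by
  conv_lhs => rw [μ.eq_smul_basis_det b]
  rfl

theorem det_gram_eq {n : ℕ} (b : Module.Basis (Fin n) ℝ V) (g : V →L[ℝ] V →L[ℝ] ℝ)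
    (v : Fin n → V) : (Matrix.of fun i j => g (v i) (v j)).det =
      (Matrix.of fun i j => g (b i) (b j)).det * (b.toMatrix v).det ^ 2 := by
  have h : (Matrix.of fun i j => g (v i) (v j)) =
      (b.toMatrix v).transpose * (Matrix.of fun i j => g (b i) (b j)) * b.toMatrix v := by
    ext i j
    rw [Matrix.of_apply, form_apply_eq_sum b, Matrix.mul_apply]
    simp only [Matrix.mul_apply, Matrix.transpose_apply, Module.Basis.toMatrix_apply,
      Matrix.of_apply, Finset.sum_mul]
    rw [Finset.sum_comm]
    exact Finset.sum_congr rfl fun k _ => Finset.sum_congr rfl fun l _ => by ring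
  rw [h, Matrix.det_mul, Matrix.det_mul, Matrix.det_transpose]
  ring

/-- The volume form of `g` may be tested on one basis. -/
theorem hasVolumeForm_iff {n : ℕ} (b : Module.Basis (Fin n) ℝ V) (g : V →L[ℝ] V →L[ℝ] ℝ)
    (μ : V [⋀^Fin n]→ₗ[ℝ] ℝ) :
    HasVolumeForm g μ ↔ |μ b| = √(Matrix.of fun i j => g (b i) (b j)).det := by
  refine ⟨fun h => h b, fun h v => ?_⟩
  rw [alternatingMap_eq_mul_det b, det_gram_eq b, abs_mul, h, Real.sqrt_mul' _ (sq_nonneg _),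
    Real.sqrt_sq_eq_abs]

theorem DiagForm.det_eq {n : ℕ} {b : Module.Basis (Fin n) ℝ V} {g : V →L[ℝ] V →L[ℝ] ℝ}
    {c : Fin n → ℝ} (h : DiagForm b g c) :
    (Matrix.of fun i j => g (b i) (b j)).det = ∏ i, c i := by
  rw [← Matrix.det_diagonal]
  congr 1
  ext i j
  rw [Matrix.of_apply, h i j, Matrix.diagonal_apply]

theorem IsInnerForm.det_gram_pos {n : ℕ} {g : V →L[ℝ] V →L[ℝ] ℝ} (hg : IsInnerForm g)
    (b : Module.Basis (Fin n) ℝ V) : 0 < (Matrix.of fun i j => g (b i) (b j)).det := by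
  have hn : Module.finrank ℝ V = n := by simpa using Module.finrank_eq_card_basis b
  subst hn
  obtain ⟨e, -, he, -⟩ := exists_diagForm hg hg.symm
  rw [det_gram_eq e, he.det_eq]
  simp only [Pi.one_apply, Finset.prod_const_one, one_mul]
  have : IsUnit (e.toMatrix b).det := by
    rw [← Matrix.isUnit_iff_isUnit_det]
    have := e.invertibleToMatrix b
    exact isUnit_of_invertible _
  have := this.ne_zero
  positivity

/-- A trace-free velocity preserves the volume form. -/
theorem HasVolumeForm.expPath {n : ℕ} (hn : Module.finrank ℝ V = n)
    {g A : V →L[ℝ] V →L[ℝ] ℝ} {μ : V [⋀^Fin n]→ₗ[ℝ] ℝ} (hg : IsInnerForm g)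
    (hA : IsSymmForm A) (hμ : HasVolumeForm g μ) (h0 : opTrace (raiseIndex g A) = 0) (t : ℝ) :
    HasVolumeForm (expPath g A t) μ := by
  obtain ⟨b, c, h1, h2⟩ := exists_diagForm_fin hn hg hA
  rw [hasVolumeForm_iff b] at hμ ⊢
  rw [h1.det_eq] at hμ
  rw [hμ, (h1.expPath h2 t).det_eq, ← Real.exp_sum, ← Finset.mul_sum, ← opTrace_raiseIndex h1 h2, h0]
  simp

/-- Two inner products with the same volume form are joined by a trace-free velocity. -/
theorem opTrace_raiseIndex_logForm {n : ℕ} (hn : Module.finrank ℝ V = n)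
    {g h : V →L[ℝ] V →L[ℝ] ℝ} {μ : V [⋀^Fin n]→ₗ[ℝ] ℝ} (hg : IsInnerForm g)
    (hh : IsInnerForm h) (hgμ : HasVolumeForm g μ) (hhμ : HasVolumeForm h μ) :
    opTrace (raiseIndex g (logForm g h)) = 0 := by
  subst hn
  obtain ⟨b, c, h1, h2⟩ := exists_diagForm_exp hg hh
  rw [opTrace_raiseIndex h1 (h1.logForm h2)]
  have e1 := hgμ b
  have e2 := hhμ b
  rw [h1.det_eq] at e1
  rw [h2.det_eq, ← Real.exp_sum, e1] at e2
  simp only [Pi.one_apply, Finset.prod_const_one, Real.sqrt_one] at e2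
  have := (Real.sqrt_eq_one).mp e2.symm
  simpa using this

/-! ### Naturality under linear isomorphisms -/

variable {W : Type*} [NormedAddCommGroup W] [NormedSpace ℝ W] [FiniteDimensional ℝ W]

/-- The pullback of a bilinear form by a linear map. -/
def formPullback (F : W →L[ℝ] V) (g : V →L[ℝ] V →L[ℝ] ℝ) : W →L[ℝ] W →L[ℝ] ℝ :=
  (ContinuousLinearMap.precomp ℝ F).comp (g.comp F)

theorem formPullback_apply (F : W →L[ℝ] V) (g : V →L[ℝ] V →L[ℝ] ℝ) (u v : W) :
    formPullback F g u v = g (F u) (F v) := rfl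

theorem IsSymmForm.formPullback {g : V →L[ℝ] V →L[ℝ] ℝ} (hg : IsSymmForm g) (F : W →L[ℝ] V) :
    IsSymmForm (formPullback F g) := fun u v => hg (F u) (F v)

theorem IsInnerForm.formPullback {g : V →L[ℝ] V →L[ℝ] ℝ} (hg : IsInnerForm g) (F : W ≃L[ℝ] V) :
    IsInnerForm (formPullback (F : W →L[ℝ] V) g) :=
  ⟨hg.symm.formPullback _, fun v hv => hg.pos (F v) (by simpa using hv)⟩

theorem DiagForm.formPullback {b : Module.Basis ι ℝ V} {g : V →L[ℝ] V →L[ℝ] ℝ} {c : ι → ℝ}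
    (h : DiagForm b g c) (F : W ≃L[ℝ] V) :
    DiagForm (b.map F.symm.toLinearEquiv) (formPullback (F : W →L[ℝ] V) g) c := by
  intro i j
  simp [formPullback_apply, h i j]

theorem trLogSq_formPullback {g h : V →L[ℝ] V →L[ℝ] ℝ} (hg : IsInnerForm g)
    (hh : IsInnerForm h) (F : W ≃L[ℝ] V) :
    trLogSq (formPullback (F : W →L[ℝ] V) g) (formPullback (F : W →L[ℝ] V) h) = trLogSq g h := by
  obtain ⟨b, c, h1, h2⟩ := exists_diagForm_exp hg hh
  rw [trLogSq_eq_sum_sq (h1.formPullback F) (h2.formPullback F), trLogSq_eq_sum_sq h1 h2]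

theorem crossTrace_formPullback {g h : V →L[ℝ] V →L[ℝ] ℝ} (hg : IsInnerForm g)
    (hh : IsInnerForm h) (F : W ≃L[ℝ] V) :
    crossTrace (formPullback (F : W →L[ℝ] V) g) (formPullback (F : W →L[ℝ] V) h) =
      crossTrace g h := by
  obtain ⟨b, c, h1, h2⟩ := exists_diagForm_exp hg hh
  have h1' : DiagForm b g fun i => Real.exp (0 : ℝ) := by simpa [DiagForm] using h1
  rw [crossTrace_eq_sum (h1'.formPullback F) (h2.formPullback F), crossTrace_eq_sum h1' h2]

theorem logForm_formPullback {g h : V →L[ℝ] V →L[ℝ] ℝ} (hg : IsInnerForm g)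
    (hh : IsInnerForm h) (F : W ≃L[ℝ] V) :
    logForm (formPullback (F : W →L[ℝ] V) g) (formPullback (F : W →L[ℝ] V) h) =
      formPullback (F : W →L[ℝ] V) (logForm g h) := by
  obtain ⟨b, c, h1, h2⟩ := exists_diagForm_exp hg hh
  exact form_ext_basis _ fun i j => by
    rw [(h1.formPullback F).logForm (h2.formPullback F) i j,
      (h1.logForm h2).formPullback F i j]

theorem expPath_formPullback {g A : V →L[ℝ] V →L[ℝ] ℝ} (hg : IsInnerForm g)
    (hA : IsSymmForm A) (F : W ≃L[ℝ] V) (t : ℝ) :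
    expPath (formPullback (F : W →L[ℝ] V) g) (formPullback (F : W →L[ℝ] V) A) t =
      formPullback (F : W →L[ℝ] V) (expPath g A t) := by
  obtain ⟨b, c, h1, h2⟩ := exists_diagForm hg hA
  exact form_ext_basis _ fun i j => by
    rw [(h1.formPullback F).expPath (h2.formPullback F) t i j,
      (h1.expPath h2 t).formPullback F i j]

end InnerProducts

/-! ### Measurability of operations on fields of inner products -/

section MeasurableForms

variable {V : Type*} [NormedAddCommGroup V] [NormedSpace ℝ V] [FiniteDimensional ℝ V]
  {Ω : Type*} [MeasurableSpace Ω] {ν : Measure Ω}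

/-- Positive forms are bounded below on the unit sphere. With a countable set of bounds this shows that
the set of inner products is Borel. -/
theorem isPosForm_iff_exists_nat {g : V →L[ℝ] V →L[ℝ] ℝ} :
    IsPosForm g ↔ ∃ k : ℕ, ∀ v, ‖v‖ ^ 2 ≤ k * g v v := by
  constructor
  · intro hg
    have hS : IsCompact (Metric.sphere (0 : V) 1) := isCompact_sphere 0 1
    have hc : ContinuousOn (fun v => (g v v)⁻¹) (Metric.sphere (0 : V) 1) := by
      refine ContinuousOn.inv₀ (by fun_prop) fun v hv => (hg v ?_).ne'
      rintro rfl
      simp at hv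
    obtain ⟨C, hC⟩ := hS.exists_bound_of_continuousOn hc
    obtain ⟨k, hk⟩ := exists_nat_ge C
    refine ⟨k, fun v => ?_⟩
    by_cases hv : v = 0
    · simp [hv]
    have hv' : ‖v‖ ≠ 0 := norm_ne_zero_iff.mpr hv
    have h1 := hC (‖v‖⁻¹ • v) (by simp [norm_smul, hv'])
    have h2 : g (‖v‖⁻¹ • v) (‖v‖⁻¹ • v) = g v v / ‖v‖ ^ 2 := by
      simp only [map_smul, smul_apply, smul_eq_mul]
      field_simp
    rw [h2, inv_div, Real.norm_eq_abs] at h1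
    have h3 := (le_abs_self _).trans (h1.trans hk)
    rwa [div_le_iff₀ (hg v hv)] at h3
  · rintro ⟨k, hk⟩ v hv
    have h1 := hk v
    have h2 : 0 < ‖v‖ ^ 2 := by positivity
    by_contra! h3
    have := mul_nonneg (Nat.cast_nonneg (α := ℝ) k) (neg_nonneg.mpr h3)
    linarith

theorem measurableSet_isInnerForm : MeasurableSet {g : V →L[ℝ] V →L[ℝ] ℝ | IsInnerForm g} := by
  have : {g : V →L[ℝ] V →L[ℝ] ℝ | IsInnerForm g} =
      {g | IsSymmForm g} ∩ ⋃ k : ℕ, ⋂ v, {g | ‖v‖ ^ 2 ≤ k * g v v} := by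
    ext g
    simp only [mem_inter_iff, mem_iUnion, mem_iInter]
    exact ⟨fun h => ⟨h.symm, isPosForm_iff_exists_nat.mp h.pos⟩,
      fun h => ⟨h.1, isPosForm_iff_exists_nat.mpr h.2⟩⟩
  rw [this]
  refine isClosed_isSymmForm.measurableSet.inter (MeasurableSet.iUnion fun k => ?_)
  refine (isClosed_iInter fun v => ?_).measurableSet
  exact isClosed_le continuous_const (continuous_const.mul (continuous_form_apply v v))

/-- A function that is continuous on a measurable set may be composed with a measurable function that
takes almost all its values there. -/
theorem AEMeasurable.continuousOn_comp {X Y : Type*} [TopologicalSpace X] [MeasurableSpace X]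
    [OpensMeasurableSpace X] [TopologicalSpace Y] [MeasurableSpace Y] [BorelSpace Y] [Zero Y]
    {f : Ω → X} (hf : AEMeasurable f ν) {S : Set X} (hS : MeasurableSet S) {Φ : X → Y}
    (hΦ : ContinuousOn Φ S) (hfS : ∀ᵐ x ∂ν, f x ∈ S) : AEMeasurable (fun x => Φ (f x)) ν := by
  classical
  have h1 : Measurable (S.piecewise Φ fun _ => 0) := hΦ.measurable_piecewise continuousOn_const hS
  refine (h1.comp_aemeasurable hf).congr ?_
  filter_upwards [hfS] with x hx
  simp [hx]

theorem aemeasurable_expPath {g A : Ω → V →L[ℝ] V →L[ℝ] ℝ} (hg : AEMeasurable g ν)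
    (hA : AEMeasurable A ν) (hin : ∀ᵐ x ∂ν, IsInnerForm (g x)) (t : ℝ) :
    AEMeasurable (fun x => expPath (g x) (A x) t) ν :=
  (hg.prodMk hA).continuousOn_comp (S := {g | IsInnerForm g} ×ˢ univ)
    (Φ := fun p => expPath p.1 p.2 t) (measurableSet_isInnerForm.prod MeasurableSet.univ)
    (fun p hp => (continuousAt_expPath hp.1.pos p.2 t).continuousWithinAt)
    (hin.mono fun _ hx => ⟨hx, trivial⟩)

theorem aemeasurable_normSqAt {g A : Ω → V →L[ℝ] V →L[ℝ] ℝ} (hg : AEMeasurable g ν)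
    (hA : AEMeasurable A ν) (hin : ∀ᵐ x ∂ν, IsInnerForm (g x)) :
    AEMeasurable (fun x => normSqAt (g x) (A x)) ν :=
  (hg.prodMk hA).continuousOn_comp (S := {g | IsInnerForm g} ×ˢ univ)
    (Φ := fun p => normSqAt p.1 p.2) (measurableSet_isInnerForm.prod MeasurableSet.univ)
    (fun p hp => (continuousAt_normSqAt hp.1.pos p.2).continuousWithinAt)
    (hin.mono fun _ hx => ⟨hx, trivial⟩)

/-- `(g, h) ↦ g log (g⁻¹ h)` is measurable, because `(g, A) ↦ (g, g exp (g⁻¹ A))` is a continuous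
injection of Borel sets, so that the Lusin-Souslin theorem applies to it. -/
theorem exists_measurable_logForm :
    ∃ L : (V →L[ℝ] V →L[ℝ] ℝ) × (V →L[ℝ] V →L[ℝ] ℝ) → V →L[ℝ] V →L[ℝ] ℝ, Measurable L ∧
      ∀ g h, IsInnerForm g → IsInnerForm h → L (g, h) = logForm g h := by
  let S : Set ((V →L[ℝ] V →L[ℝ] ℝ) × (V →L[ℝ] V →L[ℝ] ℝ)) :=
    {g | IsInnerForm g} ×ˢ {A | IsSymmForm A}
  have hS : MeasurableSet S := measurableSet_isInnerForm.prod isClosed_isSymmForm.measurableSet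
  let f : (V →L[ℝ] V →L[ℝ] ℝ) × (V →L[ℝ] V →L[ℝ] ℝ) →
    (V →L[ℝ] V →L[ℝ] ℝ) × (V →L[ℝ] V →L[ℝ] ℝ) := fun p => (p.1, expPath p.1 p.2 1)
  have hc : ContinuousOn f S := fun p hp =>
    (continuousAt_fst.prodMk (continuousAt_expPath hp.1.pos p.2 1)).continuousWithinAt
  have hinj : InjOn f S := by
    rintro ⟨g, A⟩ ⟨hg, hA⟩ ⟨g', A'⟩ ⟨-, hA'⟩ h
    obtain ⟨h1, h2⟩ := Prod.mk.inj h
    have h3 : A = A' := by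
      simp only at h1 h2
      subst h1
      exact (logForm_expPath_one hg hA).symm.trans
        ((congrArg (logForm g) h2).trans (logForm_expPath_one hg hA'))
    exact Prod.ext h1 h3
  have : PolishSpace (V →L[ℝ] V →L[ℝ] ℝ) :=
    { toSecondCountableTopology := inferInstance
      toIsCompletelyMetrizableSpace := ⟨⟨inferInstance, rfl, inferInstance⟩⟩ }
  obtain ⟨L, hL, hLf⟩ := (hc.measurableEmbedding hS hinj).exists_measurable_extend
    (g := fun p : S => p.1.2) (measurable_snd.comp measurable_subtype_coe) fun _ => ⟨0⟩
  refine ⟨L, hL, fun g h hg hh => ?_⟩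
  have := congrFun hLf ⟨(g, logForm g h), hg, hg.isSymmForm_logForm hh⟩
  simpa [f, expPath_logForm_one hg hh] using this

theorem aemeasurable_logForm {g h : Ω → V →L[ℝ] V →L[ℝ] ℝ} (hg : AEMeasurable g ν)
    (hh : AEMeasurable h ν) (hgi : ∀ᵐ x ∂ν, IsInnerForm (g x))
    (hhi : ∀ᵐ x ∂ν, IsInnerForm (h x)) : AEMeasurable (fun x => logForm (g x) (h x)) ν := by
  obtain ⟨L, hL, hLf⟩ := exists_measurable_logForm (V := V)
  refine (hL.comp_aemeasurable (hg.prodMk hh)).congr ?_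
  filter_upwards [hgi, hhi] with x h1 h2 using hLf _ _ h1 h2

theorem aemeasurable_trLogSq {g h : Ω → V →L[ℝ] V →L[ℝ] ℝ} (hg : AEMeasurable g ν)
    (hh : AEMeasurable h ν) (hgi : ∀ᵐ x ∂ν, IsInnerForm (g x))
    (hhi : ∀ᵐ x ∂ν, IsInnerForm (h x)) : AEMeasurable (fun x => trLogSq (g x) (h x)) ν := by
  refine (aemeasurable_normSqAt hg (aemeasurable_logForm hg hh hgi hhi) hgi).congr ?_
  filter_upwards [hgi, hhi] with x h1 h2 using normSqAt_logForm h1 h2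

end MeasurableForms

/-! ### Tensor fields and volume forms in charts -/

section Charts

variable {n : ℕ} {M : Type*} [TopologicalSpace M] [ChartedSpace (EuclideanSpace ℝ (Fin n)) M]
  [IsManifold (𝓡 n) ∞ M]

/-- The model space. Tangent spaces are definitionally equal to it, and the derivatives below are
read as its endomorphisms. -/
local notation "𝔼" => EuclideanSpace ℝ (Fin n)

/-- The derivative of the inverse of the chart at `c`. -/
def chartDeriv (c : M) (y : 𝔼) : 𝔼 →L[ℝ] 𝔼 :=
  mfderiv (𝓡 n) (𝓡 n) (chartAt 𝔼 c).symm y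

/-- The derivative of a map between manifolds, read in the model space. -/
def mapDeriv (φ : M → M) (x : M) : 𝔼 →L[ℝ] 𝔼 :=
  mfderiv (𝓡 n) (𝓡 n) φ x

/-- The expression of `φ` in the charts at `c` and `d`. -/
def localRep (φ : M → M) (c d : M) (y : 𝔼) : 𝔼 :=
  chartAt 𝔼 d (φ ((chartAt 𝔼 c).symm y))

variable (n) in
/-- The domain of the expression of `φ` in the charts at `c` and `d`. -/
def localDom (φ : M → M) (c d : M) : Set 𝔼 :=
  (chartAt 𝔼 c).target ∩ (chartAt 𝔼 c).symm ⁻¹' (φ ⁻¹' (chartAt 𝔼 d).source)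

/-- The value of a tensor field at `x`, read as a bilinear form on the model space. -/
def TensorField.at (g : TensorField n M) (x : M) : 𝔼 →L[ℝ] 𝔼 →L[ℝ] ℝ :=
  g x

/-- The expression of a tensor field in the chart at `c`. -/
def chartForm (g : TensorField n M) (c : M) (y : 𝔼) : 𝔼 →L[ℝ] 𝔼 →L[ℝ] ℝ :=
  formPullback (chartDeriv c y) (g.at ((chartAt 𝔼 c).symm y))

theorem chartForm_single (g : TensorField n M) (c : M) (y : 𝔼) (i j : Fin n) :
    chartForm g c y (EuclideanSpace.single i 1) (EuclideanSpace.single j 1) = g.component c i j y :=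
  rfl

theorem exists_chartDeriv_equiv (c : M) {y : 𝔼} (hy : y ∈ (chartAt 𝔼 c).target) :
    ∃ F : 𝔼 ≃L[ℝ] 𝔼, (F : 𝔼 →L[ℝ] 𝔼) = chartDeriv c y ∧
      (F.symm : 𝔼 →L[ℝ] 𝔼) = mfderiv (𝓡 n) (𝓡 n) (chartAt 𝔼 c) ((chartAt 𝔼 c).symm y) :=
  ⟨(mdifferentiable_chart (I := 𝓡 n) c).symm.mfderiv hy, rfl, rfl⟩

theorem isOpen_localDom {φ : M → M} (hφ : Continuous φ) (c d : M) : IsOpen (localDom n φ c d) :=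
  (chartAt 𝔼 c).isOpen_inter_preimage_symm ((chartAt 𝔼 d).open_source.preimage hφ)

theorem contDiffOn_localRep {k : ℕ∞ω} [ENat.LEInfty k] {φ : M → M}
    (hφ : ContMDiff (𝓡 n) (𝓡 n) k φ) (c d : M) :
    ContDiffOn ℝ k (localRep φ c d) (localDom n φ c d) := by
  rw [← contMDiffOn_iff_contDiffOn]
  have h1 : ContMDiffOn (𝓡 n) (𝓡 n) k (chartAt 𝔼 d) (chartAt 𝔼 d).source := contMDiffOn_chart
  have h2 : ContMDiffOn (𝓡 n) (𝓡 n) k (chartAt 𝔼 c).symm (chartAt 𝔼 c).target :=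
    contMDiffOn_chart_symm
  exact h1.comp (hφ.comp_contMDiffOn (h2.mono inter_subset_left)) fun y hy => hy.2

/-- The chain rule for the expression of `φ` in charts. -/
theorem mapDeriv_comp_chartDeriv {φ : M → M} (hφ : ContMDiff (𝓡 n) (𝓡 n) 1 φ) {c d : M}
    {y : 𝔼} (hy : y ∈ localDom n φ c d) :
    (mapDeriv φ ((chartAt 𝔼 c).symm y)).comp (chartDeriv c y) =
      (chartDeriv d (localRep φ c d y)).comp (fderiv ℝ (localRep φ c d) y) := by
  have hopen := isOpen_localDom (n := n) hφ.continuous c d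
  have hd : DifferentiableAt ℝ (localRep φ c d) y :=
    ((contDiffOn_localRep hφ c d).differentiableOn one_ne_zero).differentiableAt
      (hopen.mem_nhds hy)
  have hf : MDifferentiableAt (𝓡 n) (𝓡 n) (localRep φ c d) y := hd.mdifferentiableAt
  have hs : MDifferentiableAt (𝓡 n) (𝓡 n) (chartAt 𝔼 c).symm y :=
    mdifferentiableAt_atlas_symm (ChartedSpace.chart_mem_atlas c) hy.1
  have ht : localRep φ c d y ∈ (chartAt 𝔼 d).target := (chartAt 𝔼 d).map_source hy.2
  have hs' : MDifferentiableAt (𝓡 n) (𝓡 n) (chartAt 𝔼 d).symm (localRep φ c d y) :=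
    mdifferentiableAt_atlas_symm (ChartedSpace.chart_mem_atlas d) ht
  have hφ' : MDifferentiableAt (𝓡 n) (𝓡 n) φ ((chartAt 𝔼 c).symm y) :=
    hφ.mdifferentiable one_ne_zero _
  have e1 := mfderiv_comp (I := 𝓡 n) (I' := 𝓡 n) (I'' := 𝓡 n) y hφ' hs
  have e2 := mfderiv_comp (I := 𝓡 n) (I' := 𝓡 n) (I'' := 𝓡 n) y hs' hf
  have e3 : φ ∘ (chartAt 𝔼 c).symm =ᶠ[nhds y] (chartAt 𝔼 d).symm ∘ localRep φ c d := by
    filter_upwards [hopen.mem_nhds hy] with z hz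
    exact ((chartAt 𝔼 d).left_inv hz.2).symm
  have e4 := e3.mfderiv_eq (I := 𝓡 n) (I' := 𝓡 n)
  have e5 : mfderiv (𝓡 n) (𝓡 n) (localRep φ c d) y = fderiv ℝ (localRep φ c d) y :=
    mfderiv_eq_fderiv
  refine Eq.trans (b := (mfderiv (𝓡 n) (𝓡 n) (φ ∘ (chartAt 𝔼 c).symm) y : 𝔼 →L[ℝ] 𝔼)) e1.symm ?_
  refine Eq.trans (b := (mfderiv (𝓡 n) (𝓡 n) ((chartAt 𝔼 d).symm ∘ localRep φ c d) y :
    𝔼 →L[ℝ] 𝔼)) e4 (e2.trans ?_)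
  rw [e5]
  rfl

theorem chartForm_pullback {φ : M → M} (hφ : ContMDiff (𝓡 n) (𝓡 n) 1 φ) (g : TensorField n M)
    {c d : M} {y : 𝔼} (hy : y ∈ localDom n φ c d) :
    chartForm (g.pullback φ) c y =
      formPullback (fderiv ℝ (localRep φ c d) y) (chartForm g d (localRep φ c d y)) := by
  have e := mapDeriv_comp_chartDeriv hφ hy
  have hx : (chartAt 𝔼 d).symm (localRep φ c d y) = φ ((chartAt 𝔼 c).symm y) :=
    (chartAt 𝔼 d).left_inv hy.2
  ext u v
  have e' : ∀ w, mapDeriv φ ((chartAt 𝔼 c).symm y) (chartDeriv c y w) =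
      chartDeriv d (localRep φ c d y) (fderiv ℝ (localRep φ c d) y w) := fun w =>
    DFunLike.congr_fun e w
  have h1 : ∀ x u v, (g.pullback φ).at x u v = g.at (φ x) (mapDeriv φ x u) (mapDeriv φ x v) :=
    fun _ _ _ => rfl
  rw [formPullback_apply, chartForm, chartForm, formPullback_apply, formPullback_apply, h1, e', e',
    hx]

theorem pullback_id (g : TensorField n M) : g.pullback id = g := by
  funext x
  ext u v
  rw [TensorField.pullback_apply, mfderiv_id]
  rfl

/-- The coefficient of the volume form in the chart at `c`. -/
def VolumeForm.density (μ : VolumeForm n M) (c : M) (y : 𝔼) : ℝ :=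
  μ.form ((chartAt 𝔼 c).symm y) (coordVector c y)

theorem alternatingMap_comp_eq_det_smul (ω' : 𝔼 [⋀^Fin n]→ₗ[ℝ] ℝ) (J : 𝔼 →L[ℝ] 𝔼) :
    ω' (fun i => J (EuclideanSpace.single i 1)) =
      J.det * ω' (fun i => EuclideanSpace.single i (1 : ℝ)) := by
  let b : Module.Basis (Fin n) ℝ 𝔼 := (EuclideanSpace.basisFun (Fin n) ℝ).toBasis
  have hb : ∀ i, b i = EuclideanSpace.single i (1 : ℝ) := fun i => by simp [b]
  have h1 : ∀ v, ω' v = ω' b * b.det v := fun v => by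
    conv_lhs => rw [ω'.eq_smul_basis_det b]
    rfl
  have h2 := b.det_comp J.toLinearMap b
  rw [b.det_self, mul_one] at h2
  simp only [← hb]
  rw [h1, show (fun i => J (b i)) = J.toLinearMap ∘ b from rfl, h2, mul_comm]

/-- The coefficients of `μ` in two charts differ by the Jacobian determinant of a map that preserves
`μ`. -/
theorem density_localRep (μ : VolumeForm n M) {φ : M → M} (hφ : ContMDiff (𝓡 n) (𝓡 n) 1 φ)
    (hμ : ∀ (x : M) (v : Fin n → TangentSpace (𝓡 n) x),
      μ.form (φ x) (fun i => mfderiv (𝓡 n) (𝓡 n) φ x (v i)) = μ.form x v)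
    {c d : M} {y : 𝔼} (hy : y ∈ localDom n φ c d) :
    μ.density c y = (fderiv ℝ (localRep φ c d) y).det * μ.density d (localRep φ c d y) := by
  have hx : (chartAt 𝔼 d).symm (localRep φ c d y) = φ ((chartAt 𝔼 c).symm y) :=
    (chartAt 𝔼 d).left_inv hy.2
  have e : ∀ w, mapDeriv φ ((chartAt 𝔼 c).symm y) (chartDeriv c y w) =
      chartDeriv d (localRep φ c d y) (fderiv ℝ (localRep φ c d) y w) := fun w =>
    DFunLike.congr_fun (mapDeriv_comp_chartDeriv hφ hy) w
  let form : M → 𝔼 [⋀^Fin n]→ₗ[ℝ] ℝ := fun x => μ.form x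
  have h1 : μ.density c y = form (φ ((chartAt 𝔼 c).symm y)) (fun i =>
      mapDeriv φ ((chartAt 𝔼 c).symm y) (chartDeriv c y (EuclideanSpace.single i 1))) :=
    (hμ _ (coordVector c y)).symm
  rw [h1, ← hx]
  simp only [e]
  exact alternatingMap_comp_eq_det_smul ((form _).compLinearMap
    (chartDeriv d (localRep φ c d y)).toLinearMap) _

theorem density_ne_zero (μ : VolumeForm n M) (c : M) {y : 𝔼} (hy : y ∈ (chartAt 𝔼 c).target) :
    μ.density c y ≠ 0 := by
  obtain ⟨F, hF, -⟩ := exists_chartDeriv_equiv c hy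
  intro h0
  let form : M → 𝔼 [⋀^Fin n]→ₗ[ℝ] ℝ := fun x => μ.form x
  let b : Module.Basis (Fin n) ℝ 𝔼 := (EuclideanSpace.basisFun (Fin n) ℝ).toBasis.map
    F.toLinearEquiv
  refine μ.ne_zero ((chartAt 𝔼 c).symm y) ?_
  change form ((chartAt 𝔼 c).symm y) = 0
  have hb : form ((chartAt 𝔼 c).symm y) b = 0 := by
    have : (b : Fin n → 𝔼) = fun i => chartDeriv c y (EuclideanSpace.single i 1) := by
      funext i
      simp [b, ← hF]
    rw [this]
    exact h0
  rw [AlternatingMap.eq_smul_basis_det b (form _), hb, zero_smul]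

theorem continuousOn_density (μ : VolumeForm n M) (c : M) :
    ContinuousOn (μ.density c) (chartAt 𝔼 c).target :=
  (μ.smooth c).continuousOn

end Charts

/-! ### The measure of the volume form -/

section VolumeMeasure

variable {n : ℕ} {M : Type*} [TopologicalSpace M] [ChartedSpace (EuclideanSpace ℝ (Fin n)) M]
  [IsManifold (𝓡 n) ∞ M] [MeasurableSpace M] [BorelSpace M]

local notation "𝔼" => EuclideanSpace ℝ (Fin n)

/-- The measure that `μ` defines on the coordinate space of the chart at `c`. -/
def VolumeForm.coordMeasure (μ : VolumeForm n M) (c : M) : Measure 𝔼 :=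
  ((volume : Measure 𝔼).restrict (chartAt 𝔼 c).target).withDensity fun y =>
    ENNReal.ofReal |μ.density c y|

theorem localMeasure_eq_map (μ : VolumeForm n M) (c : M) :
    μ.localMeasure c = (μ.coordMeasure c).map (chartAt 𝔼 c).symm := rfl

theorem aemeasurable_chart_symm (μ : VolumeForm n M) (c : M) :
    AEMeasurable (chartAt 𝔼 c).symm (μ.coordMeasure c) :=
  ((chartAt 𝔼 c).continuousOn_symm.aemeasurable (chartAt 𝔼 c).open_target.measurableSet).mono_ac
    (withDensity_absolutelyContinuous _ _)

theorem localMeasure_apply (μ : VolumeForm n M) (c : M) {S : Set M} (hS : MeasurableSet S) :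
    μ.localMeasure c S = ∫⁻ y in (chartAt 𝔼 c).symm ⁻¹' S ∩ (chartAt 𝔼 c).target,
      ENNReal.ofReal |μ.density c y| := by
  rw [localMeasure_eq_map, Measure.map_apply_of_aemeasurable (aemeasurable_chart_symm μ c) hS,
    VolumeForm.coordMeasure, withDensity_apply', Measure.restrict_restrict'
      (chartAt 𝔼 c).open_target.measurableSet]

theorem localMeasure_restrict_source (μ : VolumeForm n M) (c : M) :
    (μ.localMeasure c).restrict (chartAt 𝔼 c).source = μ.localMeasure c := by
  refine Measure.restrict_eq_self_of_ae_mem ?_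
  refine (ae_map_iff (p := fun x => x ∈ (chartAt 𝔼 c).source) (aemeasurable_chart_symm μ c)
    (chartAt 𝔼 c).open_source.measurableSet).mpr ?_
  refine (withDensity_absolutelyContinuous _ _).ae_le ?_
  filter_upwards [ae_restrict_mem (chartAt 𝔼 c).open_target.measurableSet] with y hy
  exact (chartAt 𝔼 c).map_target hy

/-- Change of variables: a volume preserving `C¹` homeomorphism preserves the local measures. -/
theorem localMeasure_image (μ : VolumeForm n M) (φ : M ≃ₜ M) (hφ : ContMDiff (𝓡 n) (𝓡 n) 1 φ)
    (hμ : ∀ (x : M) (v : Fin n → TangentSpace (𝓡 n) x),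
      μ.form (φ x) (fun i => mfderiv (𝓡 n) (𝓡 n) φ x (v i)) = μ.form x v)
    {c d : M} {S : Set M} (hS : MeasurableSet S) (hc : S ⊆ (chartAt 𝔼 c).source)
    (hd : S ⊆ φ ⁻¹' (chartAt 𝔼 d).source) :
    μ.localMeasure d (φ '' S) = μ.localMeasure c S := by
  have hφS : MeasurableSet (φ '' S) := φ.measurableEmbedding.measurableSet_image.mpr hS
  rw [localMeasure_apply μ c hS, localMeasure_apply μ d hφS]
  set A : Set 𝔼 := (chartAt 𝔼 c).symm ⁻¹' S ∩ (chartAt 𝔼 c).target with hA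
  have hAd : A ⊆ localDom n φ c d := fun y hy => ⟨hy.2, hd hy.1⟩
  have hAm : MeasurableSet A := by
    have h1 := (chartAt 𝔼 c).continuousOn_symm.domRestrict.measurable hS
    have h2 := (chartAt 𝔼 c).open_target.measurableSet.subtype_image h1
    convert h2 using 1
    ext y
    simp [hA, and_comm]
  have himg : (chartAt 𝔼 d).symm ⁻¹' (φ '' S) ∩ (chartAt 𝔼 d).target = localRep φ c d '' A := by
    ext z
    constructor
    · rintro ⟨⟨x, hx, hxz⟩, hz⟩
      refine ⟨chartAt 𝔼 c x, ⟨?_, (chartAt 𝔼 c).map_source (hc hx)⟩, ?_⟩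
      · rwa [mem_preimage, (chartAt 𝔼 c).left_inv (hc hx)]
      · rw [localRep, (chartAt 𝔼 c).left_inv (hc hx), hxz, (chartAt 𝔼 d).right_inv hz]
    · rintro ⟨y, hy, rfl⟩
      refine ⟨?_, (chartAt 𝔼 d).map_source (hd hy.1)⟩
      rw [mem_preimage, localRep, (chartAt 𝔼 d).left_inv (hd hy.1)]
      exact ⟨_, hy.1, rfl⟩
  have hopen := isOpen_localDom (n := n) φ.continuous c d
  have hderiv : ∀ y ∈ A, HasFDerivWithinAt (localRep φ c d) (fderiv ℝ (localRep φ c d) y) A y :=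
    fun y hy => (((contDiffOn_localRep hφ c d).differentiableOn one_ne_zero).differentiableAt
      (hopen.mem_nhds (hAd hy))).hasFDerivAt.hasFDerivWithinAt
  have hinj : InjOn (localRep φ c d) A := by
    intro y hy z hz h
    have h1 := (chartAt 𝔼 d).injOn (hd hy.1) (hd hz.1) h
    exact (chartAt 𝔼 c).symm.injOn hy.2 hz.2 (φ.injective h1)
  rw [himg, lintegral_image_eq_lintegral_abs_det_fderiv_mul volume hAm hderiv hinj]
  refine setLIntegral_congr_fun hAm fun y hy => ?_
  rw [density_localRep μ hφ hμ (hAd hy), abs_mul, ENNReal.ofReal_mul (abs_nonneg _)]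

theorem localMeasure_eq_of_subset (μ : VolumeForm n M) {c d : M} {S : Set M}
    (hS : MeasurableSet S) (hc : S ⊆ (chartAt 𝔼 c).source) (hd : S ⊆ (chartAt 𝔼 d).source) :
    μ.localMeasure d S = μ.localMeasure c S := by
  have := localMeasure_image μ (Homeomorph.refl M) contMDiff_id (fun x v => by
    have : mfderiv (𝓡 n) (𝓡 n) (Homeomorph.refl M) x = ContinuousLinearMap.id ℝ _ := mfderiv_id
    rw [this]
    rfl) hS hc hd
  simpa using this

variable [CompactSpace M]

theorem exists_measurable_chart_choice : ∃ f : M → M, (range f).Countable ∧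
    (∀ x, x ∈ (chartAt 𝔼 (f x)).source) ∧ ∀ c, MeasurableSet (f ⁻¹' {c}) := by
  obtain ⟨s, hs, hcov⟩ := countable_cover_nhds_of_sigmaCompact
    fun x : M => chart_source_mem_nhds 𝔼 x
  rcases isEmpty_or_nonempty M with hM | ⟨⟨x₀⟩⟩
  · exact ⟨id, (to_countable _), fun x => hM.elim x, fun c => hM.elim c⟩
  have hne : s.Nonempty := by
    have : x₀ ∈ ⋃ x ∈ s, (chartAt 𝔼 x).source := by rw [hcov]; trivial
    obtain ⟨c, hc, -⟩ := mem_iUnion₂.mp this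
    exact ⟨c, hc⟩
  obtain ⟨e, rfl⟩ := hs.exists_eq_range hne
  classical
  have hex : ∀ x, ∃ k, x ∈ (chartAt 𝔼 (e k)).source := fun x => by
    have : x ∈ ⋃ c ∈ range e, (chartAt 𝔼 c).source := by rw [hcov]; trivial
    obtain ⟨c, ⟨k, rfl⟩, hk⟩ := mem_iUnion₂.mp this
    exact ⟨k, hk⟩
  have hN : Measurable fun x => Nat.find (hex x) :=
    measurable_find hex fun k => (chartAt 𝔼 (e k)).open_source.measurableSet
  refine ⟨fun x => e (Nat.find (hex x)), hs.mono (range_subset_iff.mpr fun x => mem_range_self _),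
    fun x => Nat.find_spec (hex x), fun c => ?_⟩
  exact hN (MeasurableSet.of_discrete (s := {k | e k = c}))

variable (n M) in
/-- A measurable choice, with countably many values, of a chart around each point. -/
def chartIndex : M → M :=
  (exists_measurable_chart_choice (n := n) (M := M)).choose

variable (n M) in
theorem countable_range_chartIndex : (range (chartIndex n M)).Countable :=
  (exists_measurable_chart_choice (n := n) (M := M)).choose_spec.1

theorem mem_source_chartIndex (x : M) : x ∈ (chartAt 𝔼 (chartIndex n M x)).source :=
  (exists_measurable_chart_choice (n := n) (M := M)).choose_spec.2.1 x

theorem measurableSet_chartIndex (c : M) : MeasurableSet (chartIndex n M ⁻¹' {c}) :=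
  (exists_measurable_chart_choice (n := n) (M := M)).choose_spec.2.2 c

variable (n) in
theorem measure_eq_tsum_chartIndex (m : Measure M) {S : Set M} (hS : MeasurableSet S) :
    m S = ∑' c : range (chartIndex n M), m (S ∩ chartIndex n M ⁻¹' {c.1}) := by
  have := (countable_range_chartIndex n M).to_subtype
  rw [← measure_iUnion]
  · congr 1
    ext x
    simp only [mem_iUnion, mem_inter_iff, mem_preimage, mem_singleton_iff]
    exact ⟨fun hx => ⟨⟨_, x, rfl⟩, hx, rfl⟩, fun ⟨_, hx, _⟩ => hx⟩
  · intro c d hcd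
    refine Set.disjoint_left.mpr fun x hx hx' => hcd (Subtype.ext ?_)
    exact hx.2.symm.trans hx'.2
  · exact fun c => hS.inter (measurableSet_chartIndex c.1)

/-- The measure of `μ` is glued from the local measures. -/
theorem measure_apply_of_subset_source (μ : VolumeForm n M) {d : M} {S : Set M}
    (hS : MeasurableSet S) (hd : S ⊆ (chartAt 𝔼 d).source) : μ.measure S = μ.localMeasure d S := by
  have := (countable_range_chartIndex n M).to_subtype
  -- The measure glued along the partition of `M` by the values of `chartIndex`; it agrees with every
  -- local measure on the domain of its chart, hence is the supremum of the local measures.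
  let ν : Measure M := Measure.sum fun c : range (chartIndex n M) =>
    (μ.localMeasure c.1).restrict (chartIndex n M ⁻¹' {c.1})
  have hν : ∀ T, MeasurableSet T →
      ν T = ∑' c : range (chartIndex n M), μ.localMeasure c.1 (T ∩ chartIndex n M ⁻¹' {c.1}) := by
    intro T hT
    rw [Measure.sum_apply _ hT]
    exact tsum_congr fun c => Measure.restrict_apply hT
  have hsub : ∀ c : M, chartIndex n M ⁻¹' {c} ⊆ (chartAt 𝔼 c).source := by
    rintro c x rfl
    exact mem_source_chartIndex x
  have hνd : ∀ (d : M) (T : Set M), MeasurableSet T → T ⊆ (chartAt 𝔼 d).source →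
      μ.localMeasure d T = ν T := by
    intro d T hT hTd
    rw [hν T hT, measure_eq_tsum_chartIndex n _ hT]
    exact tsum_congr fun c => localMeasure_eq_of_subset μ
      (hT.inter (measurableSet_chartIndex c.1)) (inter_subset_right.trans (hsub _))
      (inter_subset_left.trans hTd)
  have hle : μ.measure ≤ ν := by
    refine iSup_le fun d => Measure.le_iff.mpr fun T hT => ?_
    rw [← localMeasure_restrict_source, Measure.restrict_apply hT,
      hνd d _ (hT.inter (chartAt 𝔼 d).open_source.measurableSet) inter_subset_right]
    exact measure_mono inter_subset_left
  refine le_antisymm ((Measure.le_iff.mp hle S hS).trans_eq (hνd d S hS hd).symm) ?_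
  exact Measure.le_iff.mp (le_iSup (fun d => μ.localMeasure d) d) S hS

theorem measure_restrict_source (μ : VolumeForm n M) (d : M) :
    μ.measure.restrict (chartAt 𝔼 d).source = μ.localMeasure d := by
  ext S hS
  rw [Measure.restrict_apply hS, measure_apply_of_subset_source μ
    (hS.inter (chartAt 𝔼 d).open_source.measurableSet) inter_subset_right,
    ← Measure.restrict_apply hS, localMeasure_restrict_source]

theorem measurePreserving_of_preserves (μ : VolumeForm n M) (φ : M ≃ₜ M)
    (hφ : ContMDiff (𝓡 n) (𝓡 n) 1 φ)
    (hμ : ∀ (x : M) (v : Fin n → TangentSpace (𝓡 n) x),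
      μ.form (φ x) (fun i => mfderiv (𝓡 n) (𝓡 n) φ x (v i)) = μ.form x v) :
    MeasurePreserving φ μ.measure μ.measure := by
  have := (countable_range_chartIndex n M).to_subtype
  have key : μ.measure.map φ.symm = μ.measure := by
    refine Measure.ext_of_iUnion_eq_univ (s := fun p : range (chartIndex n M) ×
      range (chartIndex n M) => (chartAt 𝔼 p.1.1).source ∩ φ ⁻¹' (chartAt 𝔼 p.2.1).source) ?_ ?_
    · refine eq_univ_of_forall fun x => mem_iUnion.mpr ⟨(⟨_, x, rfl⟩, ⟨_, φ x, rfl⟩), ?_⟩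
      exact ⟨mem_source_chartIndex x, mem_source_chartIndex (φ x)⟩
    · rintro ⟨c, d⟩
      ext S hS
      have hU : MeasurableSet ((chartAt 𝔼 c.1).source ∩ φ ⁻¹' (chartAt 𝔼 d.1).source) :=
        ((chartAt 𝔼 c.1).open_source.inter
          ((chartAt 𝔼 d.1).open_source.preimage φ.continuous)).measurableSet
      have hT := hS.inter hU
      have hφT := φ.measurableEmbedding.measurableSet_image.mpr hT
      rw [Measure.restrict_apply hS, Measure.restrict_apply hS,
        Measure.map_apply φ.symm.continuous.measurable hT, ← φ.image_eq_preimage_symm,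
        measure_apply_of_subset_source μ hT (inter_subset_right.trans inter_subset_left),
        measure_apply_of_subset_source μ hφT
          (image_subset_iff.mpr (inter_subset_right.trans inter_subset_right)),
        localMeasure_image μ φ hφ hμ hT (inter_subset_right.trans inter_subset_left)
          (inter_subset_right.trans inter_subset_right)]
  refine ⟨φ.continuous.measurable, ?_⟩
  conv_lhs => rw [← key]
  rw [Measure.map_map φ.continuous.measurable φ.symm.continuous.measurable]
  simp

/-- The measure is finite, because `M` is compact and near each point the coefficient of `μ` in a
chart is bounded. -/
theorem isFiniteMeasure_measure (μ : VolumeForm n M) : IsFiniteMeasure μ.measure := by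
  have : IsLocallyFiniteMeasure μ.measure := by
    refine ⟨fun x => ?_⟩
    have hx := mem_chart_source 𝔼 x
    have hy := mem_chart_target 𝔼 x
    have hc : ContinuousAt (μ.density x) (chartAt 𝔼 x x) :=
      (continuousOn_density μ x).continuousAt ((chartAt 𝔼 x).open_target.mem_nhds hy)
    have h1 : ∀ᶠ y in nhds (chartAt 𝔼 x x), |μ.density x y| ≤ |μ.density x (chartAt 𝔼 x x)| + 1 :=
      (hc.abs.eventually_lt_const (lt_add_one _)).mono fun y hy => hy.le
    obtain ⟨r, hr, hball⟩ := Metric.eventually_nhds_iff_ball.mp h1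
    set U := (chartAt 𝔼 x).source ∩ chartAt 𝔼 x ⁻¹' Metric.ball (chartAt 𝔼 x x) r with hU
    have hUo : IsOpen U := (chartAt 𝔼 x).isOpen_inter_preimage Metric.isOpen_ball
    refine ⟨U, hUo.mem_nhds ⟨hx, Metric.mem_ball_self hr⟩, ?_⟩
    rw [measure_apply_of_subset_source μ hUo.measurableSet inter_subset_left,
      localMeasure_apply μ x hUo.measurableSet]
    have hsub : (chartAt 𝔼 x).symm ⁻¹' U ∩ (chartAt 𝔼 x).target ⊆
        Metric.ball (chartAt 𝔼 x x) r := by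
      rintro y ⟨hyU, hyt⟩
      have := hyU.2
      rwa [mem_preimage, (chartAt 𝔼 x).right_inv hyt] at this
    calc _ ≤ ∫⁻ y in Metric.ball (chartAt 𝔼 x x) r, ENNReal.ofReal |μ.density x y| :=
          lintegral_mono_set hsub
      _ ≤ ∫⁻ y in Metric.ball (chartAt 𝔼 x x) r,
          ENNReal.ofReal (|μ.density x (chartAt 𝔼 x x)| + 1) :=
        setLIntegral_mono' Metric.isOpen_ball.measurableSet fun y hy =>
          ENNReal.ofReal_le_ofReal (hball y hy)
      _ < ⊤ := by
        rw [setLIntegral_const]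
        exact ENNReal.mul_lt_top ENNReal.ofReal_lt_top Metric.isBounded_ball.measure_lt_top
  exact ⟨isCompact_univ.measure_lt_top⟩

end VolumeMeasure

/-! ### Measurability of tensor fields and of their pullbacks -/

section MeasurableFields

theorem continuous_formPullback {V W : Type*} [NormedAddCommGroup V] [NormedSpace ℝ V]
    [NormedAddCommGroup W] [NormedSpace ℝ W] :
    Continuous fun p : (W →L[ℝ] V) × (V →L[ℝ] V →L[ℝ] ℝ) => formPullback p.1 p.2 := by
  have h1 : ∀ F : W →L[ℝ] V, ContinuousLinearMap.precomp ℝ F =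
      (ContinuousLinearMap.compL ℝ W V ℝ).flip F := fun F => by ext; rfl
  simp only [formPullback, h1]
  fun_prop

theorem exists_continuous_leftInverse_formCoords {V ι : Type*} [NormedAddCommGroup V]
    [NormedSpace ℝ V] [FiniteDimensional ℝ V] [Fintype ι] [DecidableEq ι]
    (b : Module.Basis ι ℝ V) : ∃ G : EuclideanSpace ℝ (ι × ι) → V →L[ℝ] V →L[ℝ] ℝ, Continuous G ∧
      ∀ A, G (formCoords b A) = A := by
  let F : (V →L[ℝ] V →L[ℝ] ℝ) →ₗ[ℝ] EuclideanSpace ℝ (ι × ι) :=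
    { toFun := formCoords b
      map_add' := formCoords_add b
      map_smul' := formCoords_smul b }
  have hF : LinearMap.ker F = ⊥ := by
    rw [LinearMap.ker_eq_bot']
    intro A hA
    refine form_ext_basis b fun i j => ?_
    have : formCoords b A (i, j) = 0 := by
      rw [show formCoords b A = 0 from hA]; rfl
    simpa [formCoords] using this
  obtain ⟨G, hG⟩ := LinearMap.exists_leftInverse_of_injective (K := ℝ) (V := V →L[ℝ] V →L[ℝ] ℝ)
    (V' := EuclideanSpace ℝ (ι × ι)) F hF
  exact ⟨G, LinearMap.continuous_of_finiteDimensional (𝕜 := ℝ) (E := EuclideanSpace ℝ (ι × ι))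
    (F' := V →L[ℝ] V →L[ℝ] ℝ) G, fun A => LinearMap.congr_fun hG A⟩

theorem aemeasurable_form_iff {V ι Ω : Type*} [NormedAddCommGroup V] [NormedSpace ℝ V]
    [FiniteDimensional ℝ V] [Fintype ι] [DecidableEq ι] [MeasurableSpace Ω] {ν : Measure Ω}
    (b : Module.Basis ι ℝ V) (f : Ω → V →L[ℝ] V →L[ℝ] ℝ) :
    AEMeasurable f ν ↔ ∀ i j, AEMeasurable (fun x => f x (b i) (b j)) ν := by
  refine ⟨fun h i j => (continuous_form_apply (b i) (b j)).measurable.comp_aemeasurable h,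
    fun h => ?_⟩
  obtain ⟨G, hG', hG⟩ := exists_continuous_leftInverse_formCoords b
  have hGf : f = fun x => G (formCoords b (f x)) := funext fun x => (hG (f x)).symm
  rw [hGf]
  have h1 : AEMeasurable (fun x => formCoords b (f x)) ν :=
    (WithLp.measurable_toLp 2 _).comp_aemeasurable (aemeasurable_pi_iff.mpr fun k => h k.1 k.2)
  exact hG'.measurable.comp_aemeasurable h1

variable {n : ℕ} {M : Type*} [TopologicalSpace M] [ChartedSpace (EuclideanSpace ℝ (Fin n)) M]
  [IsManifold (𝓡 n) ∞ M] [MeasurableSpace M] [BorelSpace M]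

local notation "𝔼" => EuclideanSpace ℝ (Fin n)

theorem isMeasurable_iff_chartForm (g : TensorField n M) :
    g.IsMeasurable ↔ ∀ c : M, AEMeasurable (chartForm g c)
      (volume.restrict (chartAt 𝔼 c).target) := by
  let b : Module.Basis (Fin n) ℝ 𝔼 := (EuclideanSpace.basisFun (Fin n) ℝ).toBasis
  have hb : ∀ i, b i = EuclideanSpace.single i (1 : ℝ) := fun i => by simp [b]
  refine forall_congr' fun c => ?_
  rw [aemeasurable_form_iff b]
  simp only [hb, chartForm_single]

/-- Lebesgue measurability in the coordinates of a chart agrees with measurability for the local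
measure, because the density of `μ` vanishes nowhere. -/
theorem aemeasurable_localMeasure_iff (μ : VolumeForm n M) (c : M) {Y : Type*} [MeasurableSpace Y]
    (F : 𝔼 → Y) : AEMeasurable (fun x => F (chartAt 𝔼 c x)) (μ.localMeasure c) ↔
      AEMeasurable F (volume.restrict (chartAt 𝔼 c).target) := by
  have hm := (chartAt 𝔼 c).open_target.measurableSet
  have hac1 : μ.coordMeasure c ≪ volume.restrict (chartAt 𝔼 c).target :=
    withDensity_absolutelyContinuous _ _
  have hac2 : volume.restrict (chartAt 𝔼 c).target ≪ μ.coordMeasure c := by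
    refine withDensity_absolutelyContinuous' ?_ ?_
    · exact (((continuousOn_density μ c).abs.aemeasurable hm)).ennreal_ofReal
    · filter_upwards [ae_restrict_mem hm] with y hy
      simpa using density_ne_zero μ c hy
  have hmem : ∀ᵐ y ∂μ.coordMeasure c, y ∈ (chartAt 𝔼 c).target :=
    hac1.ae_le (ae_restrict_mem hm)
  have hsymm := aemeasurable_chart_symm μ c
  have hchart : AEMeasurable (chartAt 𝔼 c) (μ.localMeasure c) := by
    rw [← localMeasure_restrict_source]
    exact (chartAt 𝔼 c).continuousOn.aemeasurable (chartAt 𝔼 c).open_source.measurableSet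
  constructor
  · intro h
    refine AEMeasurable.mono_ac ?_ hac2
    refine (h.comp_aemeasurable hsymm).congr ?_
    filter_upwards [hmem] with y hy
    simp [(chartAt 𝔼 c).right_inv hy]
  · intro h
    have hmap : (μ.localMeasure c).map (chartAt 𝔼 c) = μ.coordMeasure c := by
      rw [localMeasure_eq_map, AEMeasurable.map_map_of_aemeasurable
        (by rwa [← localMeasure_eq_map]) hsymm]
      conv_rhs => rw [← Measure.map_id (μ := μ.coordMeasure c)]
      refine Measure.map_congr ?_
      filter_upwards [hmem] with y hy
      simp [(chartAt 𝔼 c).right_inv hy]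
    have h2 : AEMeasurable F ((μ.localMeasure c).map (chartAt 𝔼 c)) := by
      rw [hmap]
      exact h.mono_ac hac1
    exact h2.comp_aemeasurable hchart

variable [CompactSpace M]

/-- The tensor field `g` in the frame of the chart `chartIndex n M x` at `x`, as a function with
values in a fixed vector space. -/
def TensorField.inFrame (g : TensorField n M) (x : M) : 𝔼 →L[ℝ] 𝔼 →L[ℝ] ℝ :=
  chartForm g (chartIndex n M x) (chartAt 𝔼 (chartIndex n M x) x)

variable (n M) in
/-- Passage to the frame is the pullback by a linear automorphism that depends on the point only. It
commutes with all pointwise operations on inner products. -/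
theorem exists_frame : ∃ F : M → 𝔼 ≃L[ℝ] 𝔼, ∀ (g : TensorField n M) (x : M),
    g.inFrame x = formPullback (F x : 𝔼 →L[ℝ] 𝔼) (g.at x) := by
  have h : ∀ x : M, ∃ F : 𝔼 ≃L[ℝ] 𝔼, ∀ g : TensorField n M,
      g.inFrame x = formPullback (F : 𝔼 →L[ℝ] 𝔼) (g.at x) := by
    intro x
    have hx := mem_source_chartIndex (n := n) x
    obtain ⟨F, hF, -⟩ := exists_chartDeriv_equiv (n := n) (chartIndex n M x)
      ((chartAt 𝔼 (chartIndex n M x)).map_source hx)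
    refine ⟨F, fun g => ?_⟩
    rw [hF, TensorField.inFrame, chartForm, (chartAt 𝔼 (chartIndex n M x)).left_inv hx]
  choose F hF using h
  exact ⟨F, fun g x => hF x g⟩

/-- Measurability may be tested on the countably many sets where the chart chosen at `ψ x` is
constant. -/
theorem aemeasurable_of_chartIndex (μ : VolumeForm n M) {Y : Type*} [MeasurableSpace Y]
    {S : Set M} {ψ : M → M} {f : M → Y}
    (h : ∀ d, AEMeasurable f (μ.measure.restrict (S ∩ ψ ⁻¹' (chartIndex n M ⁻¹' {d})))) :
    AEMeasurable f (μ.measure.restrict S) := by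
  have := (countable_range_chartIndex n M).to_subtype
  have hS : S = ⋃ d : range (chartIndex n M), S ∩ ψ ⁻¹' (chartIndex n M ⁻¹' {d.1}) := by
    ext x
    simp only [mem_iUnion, mem_inter_iff, mem_preimage, mem_singleton_iff]
    exact ⟨fun hx => ⟨⟨_, ψ x, rfl⟩, hx, rfl⟩, fun ⟨_, hx, _⟩ => hx⟩
  rw [hS, aemeasurable_iUnion_iff]
  exact fun d => h d.1

theorem TensorField.IsMeasurable.aemeasurable_inFrame {g : TensorField n M} (hg : g.IsMeasurable)
    (μ : VolumeForm n M) : AEMeasurable g.inFrame μ.measure := by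
  rw [← Measure.restrict_univ (μ := μ.measure)]
  refine aemeasurable_of_chartIndex (ψ := id) μ fun d => ?_
  rw [univ_inter, preimage_id]
  have hsub : chartIndex n M ⁻¹' {d} ⊆ (chartAt 𝔼 d).source := by
    rintro x rfl
    exact mem_source_chartIndex x
  have h1 : AEMeasurable (fun x => chartForm g d (chartAt 𝔼 d x))
      (μ.measure.restrict (chartAt 𝔼 d).source) := by
    rw [measure_restrict_source]
    exact (aemeasurable_localMeasure_iff μ d _).mpr ((isMeasurable_iff_chartForm g).mp hg d)
  refine (h1.mono_measure (Measure.restrict_mono_set _ hsub)).congr ?_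
  filter_upwards [ae_restrict_mem (measurableSet_chartIndex d)] with x hx
  have hx' : chartIndex n M x = d := hx
  rw [TensorField.inFrame, hx']

/-- The pullback of a measurable tensor field is measurable: on the sets where both charts are
constant, it is the pullback by the derivative of a `C¹` map between open sets of `ℝⁿ`. -/
theorem isMeasurable_pullback_of_aemeasurable (μ : VolumeForm n M) {φ : M → M}
    (hφ : ContMDiff (𝓡 n) (𝓡 n) 1 φ) {g : TensorField n M}
    (hg : AEMeasurable (fun x => g.inFrame (φ x)) μ.measure) : (g.pullback φ).IsMeasurable := by
  rw [isMeasurable_iff_chartForm]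
  intro c
  rw [← aemeasurable_localMeasure_iff μ, ← measure_restrict_source]
  refine aemeasurable_of_chartIndex (ψ := φ) μ fun d => ?_
  set T := (chartAt 𝔼 c).source ∩ φ ⁻¹' (chartIndex n M ⁻¹' {d}) with hT
  have hTm : MeasurableSet T := (chartAt 𝔼 c).open_source.measurableSet.inter
    (hφ.continuous.measurable (measurableSet_chartIndex d))
  have hdom : ∀ x ∈ T, chartAt 𝔼 c x ∈ localDom n φ c d := by
    rintro x ⟨hx, hd⟩
    refine ⟨(chartAt 𝔼 c).map_source hx, ?_⟩
    rw [mem_preimage, mem_preimage, (chartAt 𝔼 c).left_inv hx, ← (show _ = d from hd)]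
    exact mem_source_chartIndex _
  have hJ : ContinuousOn (fun x => fderiv ℝ (localRep φ c d) (chartAt 𝔼 c x)) T :=
    ContinuousOn.comp ((contDiffOn_localRep hφ c d).continuousOn_fderiv_of_isOpen
      (isOpen_localDom hφ.continuous c d) le_rfl)
      ((chartAt 𝔼 c).continuousOn.mono inter_subset_left) hdom
  have h1 := continuous_formPullback.measurable.comp_aemeasurable
    ((hJ.aemeasurable (μ := μ.measure) hTm).prodMk hg.restrict)
  refine h1.congr ?_
  filter_upwards [ae_restrict_mem hTm] with x hx
  have hx' : chartIndex n M (φ x) = d := hx.2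
  rw [chartForm_pullback hφ g (hdom x hx), Function.comp_apply, TensorField.inFrame, hx', localRep,
    (chartAt 𝔼 c).left_inv hx.1]

/-- Measurability of a tensor field, expressed by one function on `M`. -/
theorem isMeasurable_iff_aemeasurable_inFrame (μ : VolumeForm n M) (g : TensorField n M) :
    g.IsMeasurable ↔ AEMeasurable g.inFrame μ.measure := by
  refine ⟨fun h => h.aemeasurable_inFrame μ, fun h => ?_⟩
  have := isMeasurable_pullback_of_aemeasurable μ contMDiff_id (g := g) h
  rwa [pullback_id] at this

end MeasurableFields

/-! ### Existence of smooth metrics with given volume form -/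

section SmoothMetric

/-- Smooth functions are locally in every Sobolev space, because their products with cut-off
functions are Schwartz functions. -/
theorem memHsLoc_of_contDiffOn {n : ℕ} (r : ℝ) {U : Set (EuclideanSpace ℝ (Fin n))} (hU : IsOpen U)
    {f : EuclideanSpace ℝ (Fin n) → ℝ} (hf : ContDiffOn ℝ ∞ f U) : MemHsLoc r U f := by
  intro χ hχ hc hs
  have h1 : ContDiff ℝ ∞ fun y => χ y * f y := by
    refine contDiff_iff_contDiffAt.mpr fun y => ?_
    by_cases hy : y ∈ tsupport χ
    · exact hχ.contDiffAt.mul (hf.contDiffAt (hU.mem_nhds (hs hy)))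
    · have : (fun y => χ y * f y) =ᶠ[nhds y] fun _ => 0 := by
        filter_upwards [(isClosed_tsupport χ).isOpen_compl.mem_nhds hy] with z hz
        simp [image_eq_zero_of_notMem_tsupport hz]
      exact contDiffAt_const.congr_of_eventuallyEq this
  have h2 : ContDiff ℝ ∞ fun y => ((χ y * f y : ℝ) : ℂ) :=
    Complex.ofRealCLM.contDiff.comp h1
  have h3 : HasCompactSupport fun y => ((χ y * f y : ℝ) : ℂ) :=
    (hc.mul_right (f' := f)).comp_left (g := Complex.ofReal) Complex.ofReal_zero
  let S := h3.toSchwartzMap h2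
  refine ⟨S.toLp 2, S.coeFn_toLp 2 volume, ?_⟩
  rw [Lp.toTemperedDistribution_toLp_eq]
  exact S.memSobolev

variable {n : ℕ} {M : Type*} [TopologicalSpace M] [ChartedSpace (EuclideanSpace ℝ (Fin n)) M]
  [IsManifold (𝓡 n) ∞ M]

local notation "𝔼" => EuclideanSpace ℝ (Fin n)

/-- The derivative of the chart at `c`. -/
def chartMapDeriv (c : M) (x : M) : 𝔼 →L[ℝ] 𝔼 :=
  mfderiv (𝓡 n) (𝓡 n) (chartAt 𝔼 c) x

theorem chartMapDeriv_chartDeriv {c d : M} {y : 𝔼} (hy : y ∈ localDom n id d c) (v : 𝔼) :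
    chartMapDeriv c ((chartAt 𝔼 d).symm y) (chartDeriv d y v) = fderiv ℝ (localRep id d c) y v := by
  have h1 := mapDeriv_comp_chartDeriv contMDiff_id hy
  have h2 : ∀ v, chartDeriv d y v = chartDeriv c (localRep id d c y)
      (fderiv ℝ (localRep id d c) y v) := by
    intro v
    have h3 : mapDeriv (n := n) (id : M → M) ((chartAt 𝔼 d).symm y) =
      ContinuousLinearMap.id ℝ 𝔼 := mfderiv_id
    rw [h3] at h1
    exact DFunLike.congr_fun h1 v
  have ht : localRep id d c y ∈ (chartAt 𝔼 c).target := (chartAt 𝔼 c).map_source hy.2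
  obtain ⟨F, hF, hF'⟩ := exists_chartDeriv_equiv c ht
  have hx : (chartAt 𝔼 c).symm (localRep id d c y) = (chartAt 𝔼 d).symm y :=
    (chartAt 𝔼 c).left_inv hy.2
  have h4 : chartMapDeriv c ((chartAt 𝔼 d).symm y) = (F.symm : 𝔼 →L[ℝ] 𝔼) := by
    rw [hF', ← hx]
    rfl
  rw [h2, h4, ← hF]
  simp

/-- A compact manifold has a smooth Riemannian metric: the sum of the Euclidean metrics of finitely many
charts, weighted by bump functions. -/
theorem exists_smooth_innerForm [CompactSpace M] [T2Space M] : ∃ K : TensorField n M,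
    (∀ x, IsInnerForm (K.at x)) ∧
      ∀ (d : M) (i j : Fin n), ContDiffOn ℝ ∞ (K.component d i j) (chartAt 𝔼 d).target := by
  let f : ∀ c : M, SmoothBumpFunction (𝓡 n) c := fun c => Classical.choice inferInstance
  obtain ⟨t, ht⟩ := isCompact_univ.elim_finite_subcover (fun c : M => Function.support (f c))
    (fun c => (f c).isOpen_support) fun x _ => mem_iUnion.mpr ⟨x, (f x).c_mem_support⟩
  let G : 𝔼 →L[ℝ] 𝔼 →L[ℝ] ℝ := innerSL ℝ
  have hG : ∀ u v, G u v = inner ℝ u v := fun u v => rfl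
  let K : M → 𝔼 →L[ℝ] 𝔼 →L[ℝ] ℝ :=
    fun x => ∑ c ∈ t, f c x • formPullback (chartMapDeriv c x) G
  have hK : ∀ x u v, K x u v =
      ∑ c ∈ t, f c x * inner ℝ (chartMapDeriv c x u) (chartMapDeriv c x v) := fun x u v => by
    simp [K, formPullback_apply, hG, sum_apply]
  refine ⟨K, fun x => ⟨fun u v => ?_, fun v hv => ?_⟩, fun d i j y hy => ?_⟩
  · change K x u v = K x v u
    rw [hK, hK]
    exact Finset.sum_congr rfl fun c _ => by rw [real_inner_comm]
  · change 0 < K x v v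
    rw [hK]
    obtain ⟨c, hc, hx⟩ := mem_iUnion₂.mp (ht (mem_univ x))
    refine Finset.sum_pos' (fun c _ => mul_nonneg (f c).nonneg real_inner_self_nonneg)
      ⟨c, hc, mul_pos ((f c).nonneg.lt_of_ne (Ne.symm hx)) (real_inner_self_pos.mpr fun h0 => hv ?_)⟩
    exact (mdifferentiable_chart (I := 𝓡 n) c).mfderiv_injective ((f c).support_subset_source hx)
      (h0.trans (map_zero (chartMapDeriv c x)).symm)
  · have hcomp : (TensorField.component (K : TensorField n M) d i j) = fun y => ∑ c ∈ t,
        f c ((chartAt 𝔼 d).symm y) * inner ℝ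
          (chartMapDeriv c ((chartAt 𝔼 d).symm y) (chartDeriv d y (EuclideanSpace.single i 1)))
          (chartMapDeriv c ((chartAt 𝔼 d).symm y) (chartDeriv d y (EuclideanSpace.single j 1))) :=
      funext fun y => hK _ _ _
    rw [hcomp]
    refine ContDiffAt.contDiffWithinAt (ContDiffAt.sum fun c _ => ?_)
    have hbump : ContDiffOn ℝ ∞ (fun y => f c ((chartAt 𝔼 d).symm y)) (chartAt 𝔼 d).target := by
      rw [← contMDiffOn_iff_contDiffOn]
      exact (f c).contMDiff.comp_contMDiffOn contMDiffOn_chart_symm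
    have htar := (chartAt 𝔼 d).open_target.mem_nhds hy
    by_cases hyc : (chartAt 𝔼 d).symm y ∈ (chartAt 𝔼 c).source
    · have hyd : y ∈ localDom n id d c := ⟨hy, hyc⟩
      have hopen := isOpen_localDom (n := n) continuous_id d c
      have hJ : ContDiffAt ℝ ∞ (fderiv ℝ (localRep id d c)) y :=
        ((contDiffOn_localRep (k := ∞) contMDiff_id d c).fderiv_of_isOpen hopen
          (by simp)).contDiffAt (hopen.mem_nhds hyd)
      have h1 : ContDiffAt ℝ ∞ (fun y => f c ((chartAt 𝔼 d).symm y) * inner ℝ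
          (fderiv ℝ (localRep id d c) y (EuclideanSpace.single i 1))
          (fderiv ℝ (localRep id d c) y (EuclideanSpace.single j 1))) y :=
        (hbump.contDiffAt htar).mul ((hJ.clm_apply contDiffAt_const).inner ℝ
          (hJ.clm_apply contDiffAt_const))
      refine h1.congr_of_eventuallyEq ?_
      filter_upwards [hopen.mem_nhds hyd] with z hz
      rw [chartMapDeriv_chartDeriv hz, chartMapDeriv_chartDeriv hz]
    · have h0 : (fun y => f c ((chartAt 𝔼 d).symm y) * inner ℝ
          (chartMapDeriv c ((chartAt 𝔼 d).symm y) (chartDeriv d y (EuclideanSpace.single i 1)))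
          (chartMapDeriv c ((chartAt 𝔼 d).symm y) (chartDeriv d y (EuclideanSpace.single j 1))))
          =ᶠ[nhds y] fun _ => 0 := by
        have hns : (chartAt 𝔼 d).symm y ∉ tsupport (f c) := fun h =>
          hyc ((f c).tsupport_subset_chartAt_source h)
        have hcont := ((chartAt 𝔼 d).continuousAt_symm hy)
        filter_upwards [hcont ((isClosed_tsupport (f c)).isOpen_compl.mem_nhds hns)] with z hz
        rw [image_eq_zero_of_notMem_tsupport hz, zero_mul]
      exact contDiffAt_const.congr_of_eventuallyEq h0

/-- There is a metric in `𝓜_μ^s`: the conformal rescaling of a smooth metric that has the prescribed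
volume form. In dimension `0` nothing can be rescaled, and there is no such metric unless `μ = ±1`. -/
theorem exists_isSobolevMetric [CompactSpace M] [T2Space M] (hn : n ≠ 0) (μ : VolumeForm n M)
    (s : ℝ) : ∃ h : TensorField n M, IsSobolevMetric μ s h := by
  obtain ⟨K, hin, hsm⟩ := exists_smooth_innerForm (n := n) (M := M)
  let b : Module.Basis (Fin n) ℝ 𝔼 := (EuclideanSpace.basisFun (Fin n) ℝ).toBasis
  have hb : ∀ i, b i = EuclideanSpace.single i (1 : ℝ) := fun i => by simp [b]
  let form : M → 𝔼 [⋀^Fin n]→ₗ[ℝ] ℝ := fun x => μ.form x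
  have hform : ∀ x, form x b ≠ 0 := fun x h0 => μ.ne_zero x (by
    change form x = 0
    rw [AlternatingMap.eq_smul_basis_det b (form x), h0, zero_smul])
  -- The conformal factor is `a = q ^ (1 / n)`, where `q` is the squared quotient of `μ` and the volume
  -- form of `K`; it is independent of the basis.
  let q : M → ℝ := fun x => form x b ^ 2 / (Matrix.of fun i j => K.at x (b i) (b j)).det
  have hdet : ∀ x, 0 < (Matrix.of fun i j => K.at x (b i) (b j)).det := fun x =>
    (hin x).det_gram_pos b
  have hq : ∀ x, 0 < q x := fun x => div_pos (sq_pos_of_ne_zero (hform x)) (hdet x)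
  let a : M → ℝ := fun x => q x ^ (1 / n : ℝ)
  have ha : ∀ x, 0 < a x := fun x => Real.rpow_pos_of_pos (hq x) _
  have han : ∀ x, a x ^ n = q x := fun x => by
    rw [← Real.rpow_natCast, ← Real.rpow_mul (hq x).le, one_div_mul_cancel (by exact_mod_cast hn),
      Real.rpow_one]
  let h : TensorField n M := fun x => a x • K.at x
  have hat : ∀ x, h.at x = a x • K.at x := fun x => rfl
  have hsmooth : ∀ (d : M) (i j : Fin n),
      ContDiffOn ℝ ∞ (h.component d i j) (chartAt 𝔼 d).target := by
    intro d i j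
    have hρ : ContDiffOn ℝ ∞ (μ.density d) (chartAt 𝔼 d).target := μ.smooth d
    have hdetd : ContDiffOn ℝ ∞ (fun y => (Matrix.of fun i j => K.component d i j y).det)
        (chartAt 𝔼 d).target := by
      simp only [Matrix.det_apply']
      refine ContDiffOn.sum fun σ _ => contDiffOn_const.mul (contDiffOn_prod fun k _ => ?_)
      exact hsm d _ _
    have hcoord : ∀ y ∈ (chartAt 𝔼 d).target, μ.density d y ≠ 0 ∧
        0 < (Matrix.of fun i j => K.component d i j y).det ∧ q ((chartAt 𝔼 d).symm y) =
          μ.density d y ^ 2 / (Matrix.of fun i j => K.component d i j y).det := by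
      intro y hy
      obtain ⟨F, hF, -⟩ := exists_chartDeriv_equiv d hy
      let b' : Module.Basis (Fin n) ℝ 𝔼 := b.map F.toLinearEquiv
      have hb' : ∀ i, b' i = chartDeriv d y (EuclideanSpace.single i 1) := fun i => by
        simp [b', ← hF, hb]
      have e1 : μ.density d y = form ((chartAt 𝔼 d).symm y) b' := by
        rw [funext hb']
        rfl
      have e2 : (Matrix.of fun i j => K.component d i j y) =
          Matrix.of fun i j => K.at ((chartAt 𝔼 d).symm y) (b' i) (b' j) := by
        simp only [hb']
        rfl
      refine ⟨density_ne_zero μ d hy, e2 ▸ (hin _).det_gram_pos b', ?_⟩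
      have e3 : (b.toMatrix b').det ≠ 0 := by
        intro h0
        apply density_ne_zero μ d hy
        rw [e1, alternatingMap_eq_mul_det b, h0, mul_zero]
      rw [e1, e2, alternatingMap_eq_mul_det b, det_gram_eq b, mul_pow,
        mul_div_mul_right _ _ (pow_ne_zero 2 e3)]
    have hq' : ContDiffOn ℝ ∞ (fun y => (μ.density d y ^ 2 /
        (Matrix.of fun i j => K.component d i j y).det) ^ (1 / n : ℝ) * K.component d i j y)
        (chartAt 𝔼 d).target := by
      refine ContDiffOn.mul (ContDiffOn.rpow_const_of_ne ((hρ.pow 2).div hdetd fun y hy =>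
        (hcoord y hy).2.1.ne') fun y hy => ?_) (hsm d i j)
      have := (hcoord y hy).1
      exact (div_pos (by positivity) (hcoord y hy).2.1).ne'
    refine hq'.congr fun y hy => ?_
    rw [← (hcoord y hy).2.2]
    rfl
  refine ⟨h, ?_, ?_, ?_, fun d i j => (hsmooth d i j).continuousOn,
    fun d i j => memHsLoc_of_contDiffOn s (chartAt 𝔼 d).open_target (hsmooth d i j)⟩
  · intro x u v
    change a x * K.at x u v = a x * K.at x v u
    rw [(hin x).symm u v]
  · intro x v hv
    exact mul_pos (ha x) ((hin x).pos v hv)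
  · intro x
    refine (hasVolumeForm_iff b (h.at x) (form x)).mpr ?_
    have : (Matrix.of fun i j => h.at x (b i) (b j)) =
        a x • Matrix.of fun i j => K.at x (b i) (b j) := by
      ext i j; rfl
    rw [this, Matrix.det_smul, Fintype.card_fin, han, div_mul_cancel₀ _ (hdet x).ne',
      Real.sqrt_sq_eq_abs]

theorem isSobolevVolumorphism_refl (μ : VolumeForm n M) (r : ℝ) :
    IsSobolevVolumorphism μ r (Diffeomorph.refl (𝓡 n) M 1) := by
  refine ⟨fun c d i => ?_, fun x v => ?_⟩
  · refine memHsLoc_of_contDiffOn r (isOpen_localDom continuous_id c d) ?_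
    have h1 := contDiffOn_localRep (k := ∞) (n := n) (φ := (id : M → M)) contMDiff_id c d
    exact (EuclideanSpace.proj i : 𝔼 →L[ℝ] ℝ).contDiff.comp_contDiffOn h1
  · have : mfderiv (𝓡 n) (𝓡 n) (Diffeomorph.refl (𝓡 n) M 1) x = ContinuousLinearMap.id ℝ _ :=
      mfderiv_id
    rw [this]
    rfl

end SmoothMetric

/-! ### Geodesics in metric spaces -/

section Geodesics

variable {N : Type*} [MetricSpace N]

theorem isGeodesic_of_dist_eq {γ : ℝ → N} {D : ℝ} (hD : 0 ≤ D)
    (h : ∀ s ∈ Icc (0 : ℝ) 1, ∀ t ∈ Icc (0 : ℝ) 1, dist (γ s) (γ t) = |t - s| * D) :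
    IsGeodesic γ := by
  have hL : LipschitzOnWith D.toNNReal γ (Icc 0 1) := by
    refine LipschitzOnWith.of_dist_le_mul fun s hs t ht => ?_
    rw [h s hs t ht, Real.coe_toNNReal _ hD, Real.dist_eq, abs_sub_comm, mul_comm]
  refine ⟨hL.continuousOn, fun t ht => le_antisymm ?_ ?_⟩
  · have h0 : dist (γ 0) (γ 1) = D := by
      rw [h 0 (by simp) 1 (by simp)]; simp
    have h1 := (hL.mono (Icc_subset_Icc_right ht.2)).comp_eVariationOn_le (g := id)
      (s := Icc 0 t) (mapsTo_id _)
    have h2 := ((monotone_id.monotoneOn (Icc (0 : ℝ) t)).eVariationOn_eq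
      (left_mem_Icc.mpr ht.1) (right_mem_Icc.mpr ht.1)).le
    rw [inter_self] at h2
    refine h1.trans ((mul_le_mul_right h2 _).trans_eq ?_)
    rw [h0, mul_comm, ENNReal.ofReal_mul ht.1, ← ENNReal.ofReal.eq_1]
    simp
  · have h1 := eVariationOn.edist_le γ (left_mem_Icc.mpr ht.1) (right_mem_Icc.mpr ht.1)
    refine le_trans (le_of_eq ?_) h1
    rw [edist_dist, h 0 (by simp) t ht, h 0 (by simp) 1 (by simp)]
    simp [abs_of_nonneg ht.1]

/-- A distance on a geodesic is at most the length of the arc, by additivity of the variation. -/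
theorem IsGeodesic.dist_le {γ : ℝ → N} (hγ : IsGeodesic γ) {s t : ℝ} (hs : 0 ≤ s) (hst : s ≤ t)
    (ht : t ≤ 1) : dist (γ s) (γ t) ≤ (t - s) * dist (γ 0) (γ 1) := by
  have h1 := eVariationOn.Icc_add_Icc γ (s := univ) hs hst (mem_univ s)
  simp only [univ_inter] at h1
  rw [hγ.2 s ⟨hs, hst.trans ht⟩, hγ.2 t ⟨hs.trans hst, ht⟩] at h1
  have h2 := eVariationOn.edist_le γ (left_mem_Icc.mpr hst) (right_mem_Icc.mpr hst)
  have h3 : ENNReal.ofReal (s * dist (γ 0) (γ 1)) + edist (γ s) (γ t) ≤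
      ENNReal.ofReal (t * dist (γ 0) (γ 1)) := by
    rw [← h1]
    gcongr
  rw [edist_dist, ← ENNReal.ofReal_add (by positivity) dist_nonneg,
    ENNReal.ofReal_le_ofReal_iff (mul_nonneg (hs.trans hst) dist_nonneg)] at h3
  linarith

theorem IsGeodesic.curveLength_eq {γ : ℝ → N} (hγ : IsGeodesic γ) :
    curveLength γ = dist (γ 0) (γ 1) := by
  rw [curveLength, hγ.2 1 (by simp), one_mul, ENNReal.toReal_ofReal dist_nonneg]

/-- The nonpositive curvature inequality along a curve `σ` makes `σ` the only geodesic between its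
endpoints. -/
theorem IsGeodesic.eq_of_npc {γ σ : ℝ → N} (hγ : IsGeodesic γ) (h0 : γ 0 = σ 0) (h1 : γ 1 = σ 1)
    (hσ : ∀ q : N, ∀ t ∈ Icc (0 : ℝ) 1, dist q (σ t) ^ 2 ≤ (1 - t) * dist q (σ 0) ^ 2 +
      t * dist q (σ 1) ^ 2 - t * (1 - t) * dist (σ 0) (σ 1) ^ 2) {t : ℝ} (ht : t ∈ Icc (0 : ℝ) 1) :
    γ t = σ t := by
  have e := hσ (γ t) t ht
  rw [← h0, ← h1] at e
  set D := dist (γ 0) (γ 1)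
  have hD : 0 ≤ D := dist_nonneg
  have e0 : dist (γ t) (γ 0) ^ 2 ≤ (t * D) ^ 2 := by
    rw [dist_comm]
    exact pow_le_pow_left₀ dist_nonneg (by simpa using hγ.dist_le le_rfl ht.1 ht.2) 2
  have e1 : dist (γ t) (γ 1) ^ 2 ≤ ((1 - t) * D) ^ 2 :=
    pow_le_pow_left₀ dist_nonneg (hγ.dist_le ht.1 ht.2 le_rfl) 2
  have e2 := mul_le_mul_of_nonneg_left e0 (sub_nonneg.mpr ht.2)
  have e3 := mul_le_mul_of_nonneg_left e1 ht.1
  -- The upper bounds `t D` and `(1 - t) D` of the distances to the endpoints make the right-hand side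
  -- of the inequality for `q = γ t` vanish.
  have e4 : dist (γ t) (σ t) ^ 2 ≤ 0 := by nlinarith
  exact dist_eq_zero.mp (pow_eq_zero_iff two_ne_zero |>.mp (le_antisymm e4 (sq_nonneg _)))

end Geodesics

/-! ### Minkowski's inequality -/

section SquareIntegrable

variable {Ω : Type*} [MeasurableSpace Ω] {ν : Measure Ω}

theorem sqrt_integral_sq_eq_norm {f : Ω → ℝ} (hf : MemLp f 2 ν) :
    √(∫ x, f x ^ 2 ∂ν) = ‖hf.toLp f‖ := by
  rw [norm_eq_sqrt_real_inner, L2.inner_def]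
  congr 1
  refine integral_congr_ae ?_
  filter_upwards [hf.coeFn_toLp] with x hx
  rw [hx]
  simp [sq]

/-- Minkowski's inequality for a function dominated by a sum. -/
theorem sqrt_integral_sq_le_add {f g h : Ω → ℝ} (hf : AEStronglyMeasurable f ν) (hg : MemLp g 2 ν)
    (hh : MemLp h 2 ν) (hle : ∀ᵐ x ∂ν, |f x| ≤ g x + h x) :
    MemLp f 2 ν ∧ √(∫ x, f x ^ 2 ∂ν) ≤ √(∫ x, g x ^ 2 ∂ν) + √(∫ x, h x ^ 2 ∂ν) := by
  have hf2 : MemLp f 2 ν := by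
    refine (hg.add hh).mono hf ?_
    filter_upwards [hle] with x hx
    exact hx.trans (le_abs_self _)
  refine ⟨hf2, ?_⟩
  rw [sqrt_integral_sq_eq_norm hf2, sqrt_integral_sq_eq_norm hg, sqrt_integral_sq_eq_norm hh]
  refine le_trans ?_ (norm_add_le _ _)
  rw [← MemLp.toLp_add]
  refine Lp.norm_le_norm_of_ae_le ?_
  filter_upwards [hle, hf2.coeFn_toLp, (hg.add hh).coeFn_toLp] with x hx h1 h2
  rw [h1, h2]
  exact hx.trans (le_abs_self _)

end SquareIntegrable

/-! ### Distances of measurable metrics -/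

section Fields

variable {n : ℕ} {M : Type*} [TopologicalSpace M] [ChartedSpace (EuclideanSpace ℝ (Fin n)) M]
  [IsManifold (𝓡 n) ∞ M] [MeasurableSpace M] [BorelSpace M] [CompactSpace M]

local notation "𝔼" => EuclideanSpace ℝ (Fin n)

/-- A measurable Riemannian metric, defined almost everywhere. -/
structure IsInnerField (μ : VolumeForm n M) (g : TensorField n M) : Prop where
  measurable : g.IsMeasurable
  inner : ∀ᵐ x ∂μ.measure, IsInnerForm (g.at x)

theorem IsXField.isInnerField {μ : VolumeForm n M} {s : ℝ} {g : TensorField n M}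
    (hg : IsXField μ s g) : IsInnerField μ g :=
  ⟨hg.measurable, by filter_upwards [hg.symm, hg.pos] with x h1 h2 using ⟨h1, h2⟩⟩

theorem IsSobolevMetric.isInnerForm {μ : VolumeForm n M} {s : ℝ} {g : TensorField n M}
    (hg : IsSobolevMetric μ s g) (x : M) : IsInnerForm (g.at x) :=
  ⟨hg.symm x, hg.pos x⟩

theorem IsSobolevMetric.isInnerField {μ : VolumeForm n M} {s : ℝ} {g : TensorField n M}
    (hg : IsSobolevMetric μ s g) : IsInnerField μ g :=
  ⟨fun c i j => (hg.continuous c i j).aemeasurable (chartAt 𝔼 c).open_target.measurableSet,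
    Filter.Eventually.of_forall hg.isInnerForm⟩

/-- The velocity `g log (g⁻¹ h)` of the geodesic from `g` to `h`. -/
def logField (g h : TensorField n M) : TensorField n M :=
  fun x => logForm (V := 𝔼) (g x) (h x)

variable {μ : VolumeForm n M}

theorem IsInnerField.inner_inFrame {g : TensorField n M} (hg : IsInnerField μ g) :
    ∀ᵐ x ∂μ.measure, IsInnerForm (g.inFrame x) := by
  obtain ⟨F, hF⟩ := exists_frame n M
  filter_upwards [hg.inner] with x hx
  rw [hF]
  exact hx.formPullback (F x)

theorem IsInnerField.aemeasurable_trLogSq {g h : TensorField n M} (hg : IsInnerField μ g)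
    (hh : IsInnerField μ h) : AEMeasurable (fun x => trLogSq (g.at x) (h.at x)) μ.measure := by
  obtain ⟨F, hF⟩ := exists_frame n M
  refine (_root_.aemeasurable_trLogSq (hg.measurable.aemeasurable_inFrame μ)
    (hh.measurable.aemeasurable_inFrame μ) hg.inner_inFrame hh.inner_inFrame).congr ?_
  filter_upwards [hg.inner, hh.inner] with x hx hx'
  rw [hF, hF, trLogSq_formPullback hx hx']

theorem IsInnerField.logField_isMeasurable {g h : TensorField n M} (hg : IsInnerField μ g)
    (hh : IsInnerField μ h) : (logField g h).IsMeasurable := by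
  obtain ⟨F, hF⟩ := exists_frame n M
  rw [isMeasurable_iff_aemeasurable_inFrame μ]
  refine (aemeasurable_logForm (hg.measurable.aemeasurable_inFrame μ)
    (hh.measurable.aemeasurable_inFrame μ) hg.inner_inFrame hh.inner_inFrame).congr ?_
  filter_upwards [hg.inner, hh.inner] with x hx hx'
  rw [hF, hF, hF, logForm_formPullback hx hx']
  rfl

theorem IsInnerField.geodesicField {g A : TensorField n M} (hg : IsInnerField μ g)
    (hA : A.IsMeasurable) (hs : ∀ᵐ x ∂μ.measure, IsSymmForm (A.at x)) (t : ℝ) :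
    IsInnerField μ (geodesicField g A t) := by
  obtain ⟨F, hF⟩ := exists_frame n M
  constructor
  · rw [isMeasurable_iff_aemeasurable_inFrame μ]
    refine (aemeasurable_expPath (hg.measurable.aemeasurable_inFrame μ)
      (hA.aemeasurable_inFrame μ) hg.inner_inFrame t).congr ?_
    filter_upwards [hg.inner, hs] with x hx hx'
    rw [hF, hF, hF, expPath_formPullback hx hx']
    rfl
  · filter_upwards [hg.inner, hs] with x hx hx' using hx.expPath hx' t

theorem fieldDelta_eq (μ : VolumeForm n M) (g h : TensorField n M) :
    fieldDelta μ g h = √(∫ x, trLogSq (g.at x) (h.at x) ∂μ.measure) := rfl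

theorem fieldDelta_nonneg (μ : VolumeForm n M) (g h : TensorField n M) : 0 ≤ fieldDelta μ g h :=
  Real.sqrt_nonneg _

theorem IsInnerField.trLogSq_comm_ae {g h : TensorField n M} (hg : IsInnerField μ g)
    (hh : IsInnerField μ h) :
    (fun x => trLogSq (g.at x) (h.at x)) =ᵐ[μ.measure] fun x => trLogSq (h.at x) (g.at x) := by
  filter_upwards [hg.inner, hh.inner] with x h1 h2 using trLogSq_comm h1 h2

theorem IsInnerField.fieldDelta_comm {g h : TensorField n M} (hg : IsInnerField μ g)
    (hh : IsInnerField μ h) : fieldDelta μ g h = fieldDelta μ h g := by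
  rw [fieldDelta_eq, fieldDelta_eq, integral_congr_ae (hg.trLogSq_comm_ae hh)]

theorem IsInnerField.integral_trLogSq_nonneg {g h : TensorField n M} (hg : IsInnerField μ g)
    (hh : IsInnerField μ h) : 0 ≤ ∫ x, trLogSq (g.at x) (h.at x) ∂μ.measure := by
  refine integral_nonneg_of_ae ?_
  filter_upwards [hg.inner, hh.inner] with x h1 h2 using trLogSq_nonneg h1 h2

theorem IsInnerField.fieldDelta_sq {g h : TensorField n M} (hg : IsInnerField μ g)
    (hh : IsInnerField μ h) :
    fieldDelta μ g h ^ 2 = ∫ x, trLogSq (g.at x) (h.at x) ∂μ.measure :=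
  Real.sq_sqrt (hg.integral_trLogSq_nonneg hh)

theorem fieldDelta_self {g : TensorField n M} (hg : IsInnerField μ g) : fieldDelta μ g g = 0 := by
  have h1 : (fun x => trLogSq (g.at x) (g.at x)) =ᵐ[μ.measure] 0 := by
    filter_upwards [hg.inner] with x h1 using trLogSq_self h1
  rw [fieldDelta_eq, integral_congr_ae h1]
  simp

theorem eq_of_fieldDelta_eq_zero {g h : TensorField n M} (hg : IsInnerField μ g)
    (hh : IsInnerField μ h) (hi : Integrable (fun x => trLogSq (g.at x) (h.at x)) μ.measure)
    (h0 : fieldDelta μ g h = 0) : ∀ᵐ x ∂μ.measure, g.at x = h.at x := by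
  have h1 := hg.fieldDelta_sq hh
  rw [h0, zero_pow two_ne_zero, eq_comm, integral_eq_zero_iff_of_nonneg_ae _ hi] at h1
  · filter_upwards [hg.inner, hh.inner, h1] with x hx hx' h
    exact eq_of_trLogSq_eq_zero hx hx' h
  · filter_upwards [hg.inner, hh.inner] with x h1 h2 using trLogSq_nonneg h1 h2

/-- The triangle inequality, which also gives finiteness: it is Minkowski's inequality for the
distance functions on the fibres. -/
theorem IsInnerField.triangle {g h k : TensorField n M} (hg : IsInnerField μ g)
    (hh : IsInnerField μ h) (hk : IsInnerField μ k)
    (h1 : Integrable (fun x => trLogSq (g.at x) (h.at x)) μ.measure)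
    (h2 : Integrable (fun x => trLogSq (h.at x) (k.at x)) μ.measure) :
    Integrable (fun x => trLogSq (g.at x) (k.at x)) μ.measure ∧
      fieldDelta μ g k ≤ fieldDelta μ g h + fieldDelta μ h k := by
  have hsq : ∀ {p q : TensorField n M}, IsInnerField μ p → IsInnerField μ q →
      (fun x => trLogSq (p.at x) (q.at x)) =ᵐ[μ.measure]
        fun x => √(trLogSq (p.at x) (q.at x)) ^ 2 := by
    intro p q hp hq
    filter_upwards [hp.inner, hq.inner] with x h1 h2
    rw [Real.sq_sqrt (trLogSq_nonneg h1 h2)]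
  have hm : ∀ {p q : TensorField n M}, IsInnerField μ p → IsInnerField μ q →
      AEStronglyMeasurable (fun x => √(trLogSq (p.at x) (q.at x))) μ.measure :=
    fun hp hq => (hp.aemeasurable_trLogSq hq).sqrt.aestronglyMeasurable
  have hL : ∀ {p q : TensorField n M}, IsInnerField μ p → IsInnerField μ q →
      (MemLp (fun x => √(trLogSq (p.at x) (q.at x))) 2 μ.measure ↔
        Integrable (fun x => trLogSq (p.at x) (q.at x)) μ.measure) := fun hp hq => by
    rw [memLp_two_iff_integrable_sq (hm hp hq), integrable_congr (hsq hp hq)]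
  have hle : ∀ᵐ x ∂μ.measure, |√(trLogSq (g.at x) (k.at x))| ≤
      √(trLogSq (g.at x) (h.at x)) + √(trLogSq (h.at x) (k.at x)) := by
    filter_upwards [hg.inner, hh.inner, hk.inner] with x e1 e2 e3
    rw [abs_of_nonneg (Real.sqrt_nonneg _)]
    exact sqrt_trLogSq_triangle e1 e2 e3
  obtain ⟨e1, e2⟩ := sqrt_integral_sq_le_add (hm hg hk) ((hL hg hh).mpr h1) ((hL hh hk).mpr h2) hle
  refine ⟨(hL hg hk).mp e1, ?_⟩
  rw [fieldDelta_eq, fieldDelta_eq, fieldDelta_eq, integral_congr_ae (hsq hg hh),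
    integral_congr_ae (hsq hh hk), integral_congr_ae (hsq hg hk)]
  exact e2

theorem trLogSq_of_subsingleton {V : Type*} [NormedAddCommGroup V] [NormedSpace ℝ V]
    [Subsingleton V] (g h : V →L[ℝ] V →L[ℝ] ℝ) : trLogSq g h = 0 := by
  rw [trLogSq, Subsingleton.elim ((opLog (raiseIndex g h)).comp (opLog (raiseIndex g h))) 0]
  simp [opTrace]

/-- Two elements of `X` have finite distance, because both have finite distance to one Sobolev
metric. In dimension `0` there may be no Sobolev metric, but the integrand vanishes. -/
theorem IsXField.integrable_trLogSq [T2Space M] {s : ℝ} {g h : TensorField n M}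
    (hg : IsXField μ s g) (hh : IsXField μ s h) :
    Integrable (fun x => trLogSq (g.at x) (h.at x)) μ.measure := by
  rcases eq_or_ne n 0 with rfl | hn
  · simp only [trLogSq_of_subsingleton]
    exact integrable_zero _ _ _
  obtain ⟨k, hk⟩ := exists_isSobolevMetric (M := M) hn μ s
  have h1 := hg.isInnerField
  have h2 := hh.isInnerField
  have h3 := hk.isInnerField
  refine (h1.triangle h3 h2 (hg.integrable k hk) ?_).1
  exact (hh.integrable k hk).congr (h2.trLogSq_comm_ae h3)

/-- A measurable metric with the volume form `μ` at finite distance from one element of `X` is in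
`X`. -/
theorem IsXField.of_integrable {s : ℝ} {g k : TensorField n M} (hg : IsXField μ s g)
    (hk : IsInnerField μ k) (hv : ∀ᵐ x ∂μ.measure, HasVolumeForm (k x) (μ.form x))
    (hi : Integrable (fun x => trLogSq (k.at x) (g.at x)) μ.measure) : IsXField μ s k where
  measurable := hk.measurable
  symm := hk.inner.mono fun _ h => h.symm
  pos := hk.inner.mono fun _ h => h.pos
  volumeForm := hv
  integrable h hh := (hk.triangle hg.isInnerField hh.isInnerField hi (hg.integrable h hh)).1

/-! ### Geodesic fields -/

theorem trLogSq_geodesicField_ae {g A : TensorField n M} (hg : IsInnerField μ g)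
    (hA : ∀ᵐ x ∂μ.measure, IsSymmForm (A.at x)) (a b : ℝ) :
    (fun x => trLogSq ((geodesicField g A a).at x) ((geodesicField g A b).at x)) =ᵐ[μ.measure]
      fun x => (b - a) ^ 2 * normSqAt (g.at x) (A.at x) := by
  filter_upwards [hg.inner, hA] with x h1 h2 using trLogSq_expPath h1 h2 a b

theorem geodesicField_zero (g A : TensorField n M) : geodesicField g A 0 = g :=
  funext fun _ => expPath_zero _ _

theorem IsXField.geodesicField {s : ℝ} {g A : TensorField n M} (hg : IsXField μ s g)
    (hA : IsL2Traceless μ g A) (t : ℝ) : IsXField μ s (geodesicField g A t) := by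
  have h1 := hg.isInnerField
  refine hg.of_integrable (h1.geodesicField hA.measurable hA.symm t) ?_ ?_
  · filter_upwards [h1.inner, hA.symm, hg.volumeForm, hA.traceless] with x e1 e2 e3 e4
    exact HasVolumeForm.expPath (finrank_euclideanSpace_fin) e1 e2 e3 e4 t
  · have h2 := trLogSq_geodesicField_ae h1 hA.symm t 0
    rw [geodesicField_zero] at h2
    exact (hA.integrable.const_mul _).congr h2.symm

theorem fieldDelta_geodesicField {g A : TensorField n M} (hg : IsInnerField μ g)
    (hA : ∀ᵐ x ∂μ.measure, IsSymmForm (A.at x)) (a b : ℝ) :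
    fieldDelta μ (geodesicField g A a) (geodesicField g A b) =
      |b - a| * √(∫ x, normSqAt (g.at x) (A.at x) ∂μ.measure) := by
  rw [fieldDelta_eq, integral_congr_ae (trLogSq_geodesicField_ae hg hA a b), integral_const_mul,
    Real.sqrt_mul (sq_nonneg _), Real.sqrt_sq_eq_abs]

theorem IsXField.isL2Traceless_logField [T2Space M] {s : ℝ} {g h : TensorField n M}
    (hg : IsXField μ s g) (hh : IsXField μ s h) : IsL2Traceless μ g (logField g h) := by
  have h1 := hg.isInnerField
  have h2 := hh.isInnerField
  refine ⟨h1.logField_isMeasurable h2, ?_, ?_, ?_⟩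
  · filter_upwards [h1.inner, h2.inner] with x e1 e2 using e1.isSymmForm_logForm e2
  · refine (hg.integrable_trLogSq hh).congr ?_
    filter_upwards [h1.inner, h2.inner] with x e1 e2 using (normSqAt_logForm e1 e2).symm
  · filter_upwards [h1.inner, h2.inner, hg.volumeForm, hh.volumeForm] with x e1 e2 e3 e4
    exact opTrace_raiseIndex_logForm (V := 𝔼) (finrank_euclideanSpace_fin) e1 e2 e3 e4

theorem geodesicField_logField_one {g h : TensorField n M} (hg : IsInnerField μ g)
    (hh : IsInnerField μ h) : ∀ᵐ x ∂μ.measure, geodesicField g (logField g h) 1 x = h x := by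
  filter_upwards [hg.inner, hh.inner] with x e1 e2 using expPath_logForm_one e1 e2

/-- The nonpositive curvature inequality of the fibres, integrated. -/
theorem fieldDelta_geodesicField_le [T2Space M] {s : ℝ} {g A q : TensorField n M}
    (hg : IsXField μ s g) (hA : IsL2Traceless μ g A) (hq : IsXField μ s q) {t : ℝ}
    (ht : t ∈ Icc (0 : ℝ) 1) :
    fieldDelta μ q (geodesicField g A t) ^ 2 ≤ (1 - t) * fieldDelta μ q (geodesicField g A 0) ^ 2 +
      t * fieldDelta μ q (geodesicField g A 1) ^ 2 -
        t * (1 - t) * ∫ x, normSqAt (g.at x) (A.at x) ∂μ.measure := by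
  have hX := fun t => hg.geodesicField hA t
  have h1 := hg.isInnerField
  have h2 := hq.isInnerField
  have hi := fun t => hq.integrable_trLogSq (hX t)
  simp only [fun t => h2.fieldDelta_sq (hX t).isInnerField]
  have hN : Integrable (fun x => normSqAt (g.at x) (A.at x)) μ.measure := hA.integrable
  rw [← integral_const_mul, ← integral_const_mul, ← integral_const_mul, ← integral_add,
    ← integral_sub]
  · refine integral_mono_ae (hi t) ((((hi 0).const_mul _).add ((hi 1).const_mul _)).sub
      (hN.const_mul _)) ?_
    filter_upwards [h1.inner, h2.inner, hA.symm] with x e1 e2 e3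
    exact trLogSq_expPath_le e1 e3 e2 ht
  · exact ((hi 0).const_mul _).add ((hi 1).const_mul _)
  · exact hN.const_mul _
  · exact (hi 0).const_mul _
  · exact (hi 1).const_mul _

end Fields

/-! ### Completeness -/

section PointwiseLimits

variable {V : Type*} [NormedAddCommGroup V] [NormedSpace ℝ V] [FiniteDimensional ℝ V]

theorem tendsto_trLogSq {p r : V →L[ℝ] V →L[ℝ] ℝ} {q : ℕ → V →L[ℝ] V →L[ℝ] ℝ}
    (hp : IsInnerForm p) (hq : ∀ k, IsInnerForm (q k)) (hr : IsInnerForm r)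
    (h : Filter.Tendsto q Filter.atTop (nhds r)) :
    Filter.Tendsto (fun k => trLogSq p (q k)) Filter.atTop (nhds (trLogSq p r)) := by
  have h1 : Filter.Tendsto (fun k => √(trLogSq (q k) r)) Filter.atTop (nhds 0) := by
    simpa using (tendsto_trLogSq_zero hq hr h).sqrt
  have h2 : Filter.Tendsto (fun k => √(trLogSq p (q k))) Filter.atTop (nhds √(trLogSq p r)) := by
    rw [tendsto_iff_dist_tendsto_zero]
    refine squeeze_zero (fun _ => dist_nonneg) (fun k => ?_) h1
    have e1 := sqrt_trLogSq_triangle hp (hq k) hr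
    have e2 := sqrt_trLogSq_triangle hp hr (hq k)
    rw [trLogSq_comm hr (hq k)] at e2
    rw [Real.dist_eq, abs_le]
    constructor <;> linarith
  have h3 := h2.pow 2
  rw [Real.sq_sqrt (trLogSq_nonneg hp hr)] at h3
  exact h3.congr fun k => Real.sq_sqrt (trLogSq_nonneg hp (hq k))

theorem isClosed_hasVolumeForm {m : ℕ} (μ : V [⋀^Fin m]→ₗ[ℝ] ℝ) :
    IsClosed {g : V →L[ℝ] V →L[ℝ] ℝ | HasVolumeForm g μ} := by
  simp only [HasVolumeForm, Set.ofPred_forall]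
  refine isClosed_iInter fun v => isClosed_eq continuous_const ?_
  refine Real.continuous_sqrt.comp (Continuous.matrix_det ?_)
  exact continuous_matrix fun i j => continuous_form_apply (v i) (v j)

end PointwiseLimits

theorem tendsto_formPullback {V W : Type*} [NormedAddCommGroup V] [NormedSpace ℝ V]
    [NormedAddCommGroup W] [NormedSpace ℝ W] (F : W →L[ℝ] V) {q : ℕ → V →L[ℝ] V →L[ℝ] ℝ}
    {p : V →L[ℝ] V →L[ℝ] ℝ} (h : Filter.Tendsto q Filter.atTop (nhds p)) :
    Filter.Tendsto (fun k => formPullback F (q k)) Filter.atTop (nhds (formPullback F p)) := by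
  have h1 : Continuous fun g : V →L[ℝ] V →L[ℝ] ℝ => formPullback F g := by
    unfold formPullback
    fun_prop
  exact (h1.tendsto p).comp h

section Completeness

variable {n : ℕ} {M : Type*} [TopologicalSpace M] [ChartedSpace (EuclideanSpace ℝ (Fin n)) M]
  [IsManifold (𝓡 n) ∞ M] [MeasurableSpace M] [BorelSpace M] [CompactSpace M] {μ : VolumeForm n M}

local notation "𝔼" => EuclideanSpace ℝ (Fin n)

theorem IsInnerField.lintegral_trLogSq {g h : TensorField n M} (hg : IsInnerField μ g)
    (hh : IsInnerField μ h) (hi : Integrable (fun x => trLogSq (g.at x) (h.at x)) μ.measure) :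
    ∫⁻ x, ENNReal.ofReal (trLogSq (g.at x) (h.at x)) ∂μ.measure =
      ENNReal.ofReal (fieldDelta μ g h ^ 2) := by
  rw [hg.fieldDelta_sq hh, ofReal_integral_eq_lintegral_ofReal hi]
  filter_upwards [hg.inner, hh.inner] with x h1 h2 using trLogSq_nonneg h1 h2

/-- A sequence of metrics with `δ(g k, g (k + 1)) ≤ 4⁻ᵏ` converges almost everywhere: the weighted
sum `∑ 4ᵏ tr (log (g k⁻¹ g (k + 1)))²` has finite integral, so that the fibre distances are
`O(2⁻ᵏ)` almost everywhere. -/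
theorem ae_exists_tendsto {g : ℕ → TensorField n M} (hg : ∀ k, IsInnerField μ (g k))
    (hi : ∀ k, Integrable (fun x => trLogSq ((g k).at x) ((g (k + 1)).at x)) μ.measure)
    (hd : ∀ k, fieldDelta μ (g k) (g (k + 1)) ≤ (1 / 4) ^ k) :
    ∀ᵐ x ∂μ.measure, ∃ p, IsInnerForm p ∧
      Filter.Tendsto (fun k => (g k).at x) Filter.atTop (nhds p) := by
  let f : ℕ → M → ℝ≥0∞ := fun k x =>
    ENNReal.ofReal (4 ^ k * trLogSq ((g k).at x) ((g (k + 1)).at x))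
  have hf : ∀ k, AEMeasurable (f k) μ.measure := fun k =>
    (((hg k).aemeasurable_trLogSq (hg (k + 1))).const_mul _).ennreal_ofReal
  have hfi : ∀ k, ∫⁻ x, f k x ∂μ.measure ≤ ENNReal.ofReal ((1 / 4) ^ k) := by
    intro k
    have h1 : ∀ x, f k x = ENNReal.ofReal (4 ^ k) *
        ENNReal.ofReal (trLogSq ((g k).at x) ((g (k + 1)).at x)) := fun x =>
      ENNReal.ofReal_mul (by positivity)
    simp only [h1]
    rw [lintegral_const_mul' _ _ ENNReal.ofReal_ne_top, (hg k).lintegral_trLogSq (hg (k + 1)) (hi k),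
      ← ENNReal.ofReal_mul (by positivity)]
    refine ENNReal.ofReal_le_ofReal ?_
    have h2 := pow_le_pow_left₀ (fieldDelta_nonneg _ _ _) (hd k) 2
    calc (4 : ℝ) ^ k * fieldDelta μ (g k) (g (k + 1)) ^ 2 ≤ 4 ^ k * ((1 / 4) ^ k) ^ 2 := by gcongr
      _ = (4 * (1 / 4) * (1 / 4)) ^ k := by rw [mul_pow, mul_pow]; ring
      _ = (1 / 4) ^ k := by norm_num
  have hsum : ∀ᵐ x ∂μ.measure, ∑' k, f k x < ⊤ := by
    refine ae_lt_top' (AEMeasurable.tsum hf) ?_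
    rw [lintegral_tsum hf]
    refine ((ENNReal.tsum_le_tsum hfi).trans_lt ?_).ne
    rw [← ENNReal.ofReal_tsum_of_nonneg (fun k => by positivity)
      (summable_geometric_of_lt_one (by norm_num) (by norm_num))]
    exact ENNReal.ofReal_lt_top
  filter_upwards [hsum, ae_all_iff.mpr fun k => (hg k).inner] with x hx hin
  refine exists_tendsto_of_sqrt_trLogSq_le_geometric hin (C := √(∑' k, f k x).toReal)
    (r := 1 / 2) (by norm_num) fun k => ?_
  have h1 : 4 ^ k * trLogSq ((g k).at x) ((g (k + 1)).at x) ≤ (∑' k, f k x).toReal :=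
    (ENNReal.ofReal_le_iff_le_toReal hx.ne).mp (ENNReal.le_tsum (f := fun k => f k x) k)
  have h2 : trLogSq ((g k).at x) ((g (k + 1)).at x) ≤
      (∑' k, f k x).toReal * ((1 / 2) ^ k) ^ 2 := by
    have h3 : ((1 / 2 : ℝ) ^ k) ^ 2 = (4 ^ k)⁻¹ := by
      rw [← pow_mul, mul_comm, pow_mul, ← inv_pow]; norm_num
    rw [h3, ← div_eq_mul_inv, le_div_iff₀ (by positivity)]
    linarith
  refine (Real.sqrt_le_sqrt h2).trans_eq ?_
  rw [Real.sqrt_mul ENNReal.toReal_nonneg, Real.sqrt_sq (by positivity)]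

/-- Pointwise limits of measurable metrics, where they exist almost everywhere and are inner products,
form a measurable metric. -/
theorem exists_ae_tendsto {g : ℕ → TensorField n M} (hg : ∀ k, IsInnerField μ (g k))
    (hex : ∀ᵐ x ∂μ.measure, ∃ p, IsInnerForm p ∧
      Filter.Tendsto (fun k => (g k).at x) Filter.atTop (nhds p)) :
    ∃ p : TensorField n M, IsInnerField μ p ∧
      ∀ᵐ x ∂μ.measure, Filter.Tendsto (fun k => (g k).at x) Filter.atTop (nhds (p.at x)) := by
  obtain ⟨q, hq⟩ : ∃ q : M → 𝔼 →L[ℝ] 𝔼 →L[ℝ] ℝ, ∀ᵐ x ∂μ.measure, IsInnerForm (q x) ∧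
      Filter.Tendsto (fun k => (g k).at x) Filter.atTop (nhds (q x)) := by
    classical
    refine ⟨fun x => Classical.epsilon fun p => IsInnerForm p ∧
      Filter.Tendsto (fun k => (g k).at x) Filter.atTop (nhds p), ?_⟩
    filter_upwards [hex] with x hx using Classical.epsilon_spec hx
  let p : TensorField n M := q
  have hp : ∀ᵐ x ∂μ.measure, IsInnerForm (p.at x) ∧
      Filter.Tendsto (fun k => (g k).at x) Filter.atTop (nhds (p.at x)) := hq
  refine ⟨p, ⟨?_, hp.mono fun _ h => h.1⟩, hp.mono fun _ h => h.2⟩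
  obtain ⟨F, hF⟩ := exists_frame n M
  rw [isMeasurable_iff_aemeasurable_inFrame μ]
  refine aemeasurable_of_tendsto_metrizable_ae Filter.atTop
    (fun k => (hg k).measurable.aemeasurable_inFrame μ) ?_
  filter_upwards [hp] with x hx
  have h1 := tendsto_formPullback (F x : 𝔼 →L[ℝ] 𝔼) hx.2
  rw [← hF] at h1
  exact h1.congr fun k => (hF (g k) x).symm

/-- Fatou's lemma: `δ` is lower semicontinuous under convergence almost everywhere. -/
theorem fieldDelta_le_of_ae_tendsto {h p : TensorField n M} {g : ℕ → TensorField n M} {C : ℝ}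
    (hh : IsInnerField μ h) (hp : IsInnerField μ p) (hg : ∀ k, IsInnerField μ (g k))
    (hlim : ∀ᵐ x ∂μ.measure, Filter.Tendsto (fun k => (g k).at x) Filter.atTop (nhds (p.at x)))
    (hi : ∀ k, Integrable (fun x => trLogSq (h.at x) ((g k).at x)) μ.measure)
    {N : ℕ} (hC : ∀ k, N ≤ k → fieldDelta μ h (g k) ≤ C) :
    Integrable (fun x => trLogSq (h.at x) (p.at x)) μ.measure ∧ fieldDelta μ h p ≤ C := by
  have hC0 : 0 ≤ C := (fieldDelta_nonneg _ _ _).trans (hC N le_rfl)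
  have h0 : 0 ≤ᵐ[μ.measure] fun x => trLogSq (h.at x) (p.at x) := by
    filter_upwards [hh.inner, hp.inner] with x h1 h2 using trLogSq_nonneg h1 h2
  have hm := hh.aemeasurable_trLogSq hp
  have hF : ∫⁻ x, ENNReal.ofReal (trLogSq (h.at x) (p.at x)) ∂μ.measure ≤
      ENNReal.ofReal (C ^ 2) := by
    have h1 : ∫⁻ x, ENNReal.ofReal (trLogSq (h.at x) (p.at x)) ∂μ.measure =
        ∫⁻ x, Filter.liminf (fun k => ENNReal.ofReal (trLogSq (h.at x) ((g k).at x)))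
          Filter.atTop ∂μ.measure := by
      refine lintegral_congr_ae ?_
      filter_upwards [hlim, hh.inner, hp.inner, ae_all_iff.mpr fun k => (hg k).inner]
        with x e1 e2 e3 e4
      exact ((ENNReal.continuous_ofReal.tendsto _).comp
        (tendsto_trLogSq e2 e4 e3 e1)).liminf_eq.symm
    rw [h1]
    refine (lintegral_liminf_le' fun k =>
      (hh.aemeasurable_trLogSq (hg k)).ennreal_ofReal).trans ?_
    refine Filter.liminf_le_of_frequently_le' (Filter.Eventually.frequently ?_)
    filter_upwards [Filter.eventually_ge_atTop N] with k hk
    rw [hh.lintegral_trLogSq (hg k) (hi k)]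
    exact ENNReal.ofReal_le_ofReal (pow_le_pow_left₀ (fieldDelta_nonneg _ _ _) (hC k hk) 2)
  have hint : Integrable (fun x => trLogSq (h.at x) (p.at x)) μ.measure :=
    ⟨hm.aestronglyMeasurable,
      (hasFiniteIntegral_iff_ofReal h0).mpr (hF.trans_lt ENNReal.ofReal_lt_top)⟩
  refine ⟨hint, ?_⟩
  rw [hh.lintegral_trLogSq hp hint, ENNReal.ofReal_le_ofReal_iff (sq_nonneg C)] at hF
  exact le_of_sq_le_sq hF hC0

/-- Completeness of `X`, on representatives: a sequence with rapidly decreasing distances has a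
limit. -/
theorem exists_limit_field [T2Space M] {s : ℝ} {g : ℕ → TensorField n M}
    (hg : ∀ k, IsXField μ s (g k))
    (hd : ∀ N k l, N ≤ k → N ≤ l → fieldDelta μ (g k) (g l) < (1 / 4) ^ N) :
    ∃ p : TensorField n M, IsXField μ s p ∧ ∀ k, fieldDelta μ (g k) p ≤ (1 / 4) ^ k := by
  have hin := fun k => (hg k).isInnerField
  obtain ⟨p, hp, hlim⟩ := exists_ae_tendsto hin (ae_exists_tendsto hin
    (fun k => (hg k).integrable_trLogSq (hg (k + 1)))
    fun k => (hd k k (k + 1) le_rfl (by simp)).le)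
  have key := fun k => fieldDelta_le_of_ae_tendsto (hin k) hp hin hlim
    (fun l => (hg k).integrable_trLogSq (hg l)) (N := k) fun l hl => (hd k k l le_rfl hl).le
  refine ⟨p, (hg 0).of_integrable hp ?_ ?_, fun k => (key k).2⟩
  · filter_upwards [hlim, ae_all_iff.mpr fun k => (hg k).volumeForm] with x e1 e2
    exact (isClosed_hasVolumeForm (V := 𝔼) (μ.form x)).mem_of_tendsto e1
      (Filter.Eventually.of_forall e2)
  · exact (key 0).1.congr ((hin 0).trLogSq_comm_ae hp)

end Completeness

/-! ### Continuous metrics -/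

section ContinuousFields

variable {n : ℕ} {M : Type*} [TopologicalSpace M] [ChartedSpace (EuclideanSpace ℝ (Fin n)) M]
  [IsManifold (𝓡 n) ∞ M]

local notation "𝔼" => EuclideanSpace ℝ (Fin n)

theorem ContinuousAt.crossTrace {V X : Type*} [NormedAddCommGroup V] [NormedSpace ℝ V]
    [FiniteDimensional ℝ V] [TopologicalSpace X] {f g : X → V →L[ℝ] V →L[ℝ] ℝ} {x : X}
    (hf : ContinuousAt f x) (hg : ContinuousAt g x) (hfx : IsPosForm (f x)) (hgx : IsPosForm (g x)) :
    ContinuousAt (fun z => crossTrace (f z) (g z)) x :=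
  (continuousAt_crossTrace hfx hgx).comp (f := fun z => (f z, g z)) (hf.prodMk hg)

theorem continuousOn_form_of_basis {V ι X : Type*} [NormedAddCommGroup V] [NormedSpace ℝ V]
    [FiniteDimensional ℝ V] [Fintype ι] [DecidableEq ι] [TopologicalSpace X] {S : Set X}
    (b : Module.Basis ι ℝ V) {f : X → V →L[ℝ] V →L[ℝ] ℝ}
    (h : ∀ i j, ContinuousOn (fun x => f x (b i) (b j)) S) : ContinuousOn f S := by
  obtain ⟨G, hG, hGf⟩ := exists_continuous_leftInverse_formCoords b
  have h1 : f = fun x => G (formCoords b (f x)) := funext fun x => (hGf _).symm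
  rw [h1]
  refine hG.comp_continuousOn ?_
  exact (PiLp.continuous_toLp 2 _).comp_continuousOn (continuousOn_pi.mpr fun k => h k.1 k.2)

theorem IsSobolevMetric.continuousOn_chartForm {μ : VolumeForm n M} {s : ℝ} {h : TensorField n M}
    (hh : IsSobolevMetric μ s h) (c : M) : ContinuousOn (chartForm h c) (chartAt 𝔼 c).target := by
  refine continuousOn_form_of_basis (EuclideanSpace.basisFun (Fin n) ℝ).toBasis fun i j => ?_
  have := hh.continuous c i j
  simp only [OrthonormalBasis.coe_toBasis, EuclideanSpace.basisFun_apply, chartForm_single]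
  exact this

theorem continuousOn_chartForm_pullback {φ : M → M} (hφ : ContMDiff (𝓡 n) (𝓡 n) 1 φ)
    {h : TensorField n M} (hh : ∀ d, ContinuousOn (chartForm h d) (chartAt 𝔼 d).target) (c : M) :
    ContinuousOn (chartForm (h.pullback φ) c) (chartAt 𝔼 c).target := by
  intro y hy
  let d : M := φ ((chartAt 𝔼 c).symm y)
  have hopen := isOpen_localDom (n := n) hφ.continuous c d
  have hyd : y ∈ localDom n φ c d := ⟨hy, mem_chart_source 𝔼 _⟩
  have h1 : ContinuousOn (fun z => (fderiv ℝ (localRep φ c d) z, chartForm h d (localRep φ c d z)))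
      (localDom n φ c d) := by
    have h2 := contDiffOn_localRep hφ c d
    refine (h2.continuousOn_fderiv_of_isOpen hopen le_rfl).prodMk ?_
    exact (hh d).comp h2.continuousOn fun z hz => (chartAt 𝔼 d).map_source hz.2
  have h2 : ContinuousOn (chartForm (h.pullback φ) c) (localDom n φ c d) :=
    (continuous_formPullback.comp_continuousOn h1).congr fun z hz => chartForm_pullback hφ h hz
  exact (h2.continuousAt (hopen.mem_nhds hyd)).continuousWithinAt

/-- Two continuous metrics on a compact manifold have bounded fibrewise distance, because its majorant
`crossTrace` is a continuous function. -/
theorem exists_trLogSq_le_of_continuousOn [CompactSpace M] {h k : TensorField n M}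
    (hh : ∀ d, ContinuousOn (chartForm h d) (chartAt 𝔼 d).target)
    (hk : ∀ d, ContinuousOn (chartForm k d) (chartAt 𝔼 d).target)
    (hhi : ∀ x, IsInnerForm (h.at x)) (hki : ∀ x, IsInnerForm (k.at x)) :
    ∃ C, ∀ x, trLogSq (h.at x) (k.at x) ≤ C := by
  have hc : Continuous fun x => crossTrace (h.at x) (k.at x) := by
    refine continuous_iff_continuousAt.mpr fun x => ?_
    have hx := mem_chart_source 𝔼 x
    have hfr : ∀ z ∈ (chartAt 𝔼 x).source, ∃ F : 𝔼 ≃L[ℝ] 𝔼, ∀ g : TensorField n M,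
        chartForm g x (chartAt 𝔼 x z) = formPullback (F : 𝔼 →L[ℝ] 𝔼) (g.at z) := by
      intro z hz
      obtain ⟨F, hF, -⟩ := exists_chartDeriv_equiv (n := n) x ((chartAt 𝔼 x).map_source hz)
      exact ⟨F, fun g => by rw [hF, chartForm, (chartAt 𝔼 x).left_inv hz]⟩
    have h1 : ∀ {g : TensorField n M}, (∀ d, ContinuousOn (chartForm g d) (chartAt 𝔼 d).target) →
        ContinuousAt (fun z => chartForm g x (chartAt 𝔼 x z)) x := by
      intro g hg
      have := (hg x).continuousAt
        ((chartAt 𝔼 x).open_target.mem_nhds ((chartAt 𝔼 x).map_source hx))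
      exact this.comp ((chartAt 𝔼 x).continuousAt hx)
    have hin : ∀ {g : TensorField n M}, (∀ x, IsInnerForm (g.at x)) →
        IsInnerForm (chartForm g x (chartAt 𝔼 x x)) := by
      intro g hg
      obtain ⟨F, hF⟩ := hfr x hx
      rw [hF]
      exact (hg x).formPullback F
    have h2 : ContinuousAt (fun z => crossTrace (chartForm h x (chartAt 𝔼 x z))
        (chartForm k x (chartAt 𝔼 x z))) x :=
      ContinuousAt.crossTrace (h1 hh) (h1 hk) (hin hhi).pos (hin hki).pos
    refine h2.congr ?_
    filter_upwards [(chartAt 𝔼 x).open_source.mem_nhds hx] with z hz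
    obtain ⟨F, hF⟩ := hfr z hz
    rw [hF, hF, crossTrace_formPullback (hhi z) (hki z)]
  obtain ⟨C, hC⟩ := isCompact_univ.exists_bound_of_continuousOn hc.continuousOn
  exact ⟨C, fun x => (trLogSq_le_crossTrace (hhi x) (hki x)).trans
    ((le_abs_self _).trans (hC x (mem_univ x)))⟩

end ContinuousFields

/-! ### Pullback by volume preserving diffeomorphisms -/

section Pullback

variable {n : ℕ} {M : Type*} [TopologicalSpace M] [ChartedSpace (EuclideanSpace ℝ (Fin n)) M]
  [IsManifold (𝓡 n) ∞ M]

local notation "𝔼" => EuclideanSpace ℝ (Fin n)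

/-- The derivative of a diffeomorphism, as an automorphism of the model space. -/
def diffeoDeriv (φ : M ≃ₘ^1⟮𝓡 n, 𝓡 n⟯ M) (x : M) : 𝔼 ≃L[ℝ] 𝔼 :=
  φ.mfderivToContinuousLinearEquiv one_ne_zero x

theorem pullback_at (φ : M ≃ₘ^1⟮𝓡 n, 𝓡 n⟯ M) (g : TensorField n M) (x : M) :
    (g.pullback φ).at x = formPullback (diffeoDeriv φ x : 𝔼 →L[ℝ] 𝔼) (g.at (φ x)) := rfl

theorem pullback_pullback {φ ψ : M → M} (hφ : ContMDiff (𝓡 n) (𝓡 n) 1 φ)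
    (hψ : ContMDiff (𝓡 n) (𝓡 n) 1 ψ) (g : TensorField n M) :
    (g.pullback φ).pullback ψ = g.pullback (φ ∘ ψ) := by
  funext x
  have h1 := mfderiv_comp (I := 𝓡 n) (I' := 𝓡 n) (I'' := 𝓡 n) x
    (hφ.mdifferentiable one_ne_zero (ψ x)) (hψ.mdifferentiable one_ne_zero x)
  ext u v
  simp only [TensorField.pullback_apply, h1]
  rfl

/-- The diffeomorphism `φ` preserves the volume form. -/
def PreservesForm (μ : VolumeForm n M) (φ : M ≃ₘ^1⟮𝓡 n, 𝓡 n⟯ M) : Prop :=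
  ∀ (x : M) (v : Fin n → TangentSpace (𝓡 n) x),
    μ.form (φ x) (fun i => mfderiv (𝓡 n) (𝓡 n) φ x (v i)) = μ.form x v

theorem PreservesForm.symm {μ : VolumeForm n M} {φ : M ≃ₘ^1⟮𝓡 n, 𝓡 n⟯ M}
    (hφ : PreservesForm μ φ) : PreservesForm μ φ.symm := by
  intro x v
  have h1 := mfderiv_comp (I := 𝓡 n) (I' := 𝓡 n) (I'' := 𝓡 n) x
    (φ.contMDiff.mdifferentiable one_ne_zero (φ.symm x))
    (φ.symm.contMDiff.mdifferentiable one_ne_zero x)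
  have h2 : φ ∘ φ.symm = id := funext fun y => φ.apply_symm_apply y
  rw [h2, mfderiv_id] at h1
  have h3 := hφ (φ.symm x) fun i => mfderiv (𝓡 n) (𝓡 n) φ.symm x (v i)
  rw [← h3]
  let form : M → 𝔼 [⋀^Fin n]→ₗ[ℝ] ℝ := fun x => μ.form x
  have h4 : ∀ w : 𝔼, mapDeriv φ (φ.symm x) (mapDeriv φ.symm x w) = w := fun w =>
    (DFunLike.congr_fun h1 w).symm
  change form (φ (φ.symm x)) (fun i => mapDeriv φ (φ.symm x) (mapDeriv φ.symm x (v i))) =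
    form x v
  rw [φ.apply_symm_apply]
  congr 1
  exact funext fun i => h4 _

theorem HasVolumeForm.pullback {μ : VolumeForm n M} {φ : M ≃ₘ^1⟮𝓡 n, 𝓡 n⟯ M}
    (hφ : PreservesForm μ φ) {g : TensorField n M} {x : M}
    (h : HasVolumeForm (g (φ x)) (μ.form (φ x))) :
    HasVolumeForm (g.pullback φ x) (μ.form x) := by
  intro v
  rw [← hφ x v, h]
  rfl

variable [MeasurableSpace M] [BorelSpace M] [CompactSpace M] {μ : VolumeForm n M}

theorem PreservesForm.measurePreserving {φ : M ≃ₘ^1⟮𝓡 n, 𝓡 n⟯ M} (hφ : PreservesForm μ φ) :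
    MeasurePreserving φ μ.measure μ.measure :=
  measurePreserving_of_preserves μ φ.toHomeomorph φ.contMDiff hφ

theorem IsInnerField.pullback {φ : M ≃ₘ^1⟮𝓡 n, 𝓡 n⟯ M} (hφ : PreservesForm μ φ)
    {g : TensorField n M} (hg : IsInnerField μ g) : IsInnerField μ (g.pullback φ) := by
  have hp := hφ.measurePreserving.quasiMeasurePreserving
  refine ⟨isMeasurable_pullback_of_aemeasurable μ φ.contMDiff
    ((hg.measurable.aemeasurable_inFrame μ).comp_quasiMeasurePreserving hp), ?_⟩
  filter_upwards [hp.ae hg.inner] with x hx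
  rw [pullback_at]
  exact hx.formPullback _

theorem trLogSq_pullback_ae {φ : M ≃ₘ^1⟮𝓡 n, 𝓡 n⟯ M} (hφ : PreservesForm μ φ)
    {g h : TensorField n M} (hg : IsInnerField μ g) (hh : IsInnerField μ h) :
    (fun x => trLogSq ((g.pullback φ).at x) ((h.pullback φ).at x)) =ᵐ[μ.measure]
      fun x => trLogSq (g.at (φ x)) (h.at (φ x)) := by
  have hp := hφ.measurePreserving.quasiMeasurePreserving
  filter_upwards [hp.ae hg.inner, hp.ae hh.inner] with x h1 h2
  rw [pullback_at, pullback_at, trLogSq_formPullback h1 h2]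

theorem fieldDelta_pullback {φ : M ≃ₘ^1⟮𝓡 n, 𝓡 n⟯ M} (hφ : PreservesForm μ φ)
    {g h : TensorField n M} (hg : IsInnerField μ g) (hh : IsInnerField μ h) :
    fieldDelta μ (g.pullback φ) (h.pullback φ) = fieldDelta μ g h := by
  rw [fieldDelta_eq, fieldDelta_eq, integral_congr_ae (trLogSq_pullback_ae hφ hg hh)]
  congr 1
  exact hφ.measurePreserving.integral_comp φ.toHomeomorph.measurableEmbedding
    fun x => trLogSq (g.at x) (h.at x)

/-- `X` is invariant under pullback. Finiteness of the distance of `φ^* g` to a Sobolev metric `h`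
holds because `φ^* g` has finite distance to `φ^* h`, and `φ^* h` and `h` are continuous metrics on
a compact manifold. -/
theorem IsXField.pullback {s : ℝ} {φ : M ≃ₘ^1⟮𝓡 n, 𝓡 n⟯ M}
    (hφ : PreservesForm μ φ) {g : TensorField n M} (hg : IsXField μ s g) :
    IsXField μ s (g.pullback φ) := by
  have hp := hφ.measurePreserving.quasiMeasurePreserving
  have h1 := hg.isInnerField
  have h2 := h1.pullback hφ
  refine ⟨h2.measurable, h2.inner.mono fun _ h => h.symm, h2.inner.mono fun _ h => h.pos,
    (hp.ae hg.volumeForm).mono fun _ h => HasVolumeForm.pullback hφ h, fun h hh => ?_⟩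
  have h3 := hh.isInnerField
  have h4 := h3.pullback hφ
  have i1 : Integrable (fun x => trLogSq ((g.pullback φ).at x) ((h.pullback φ).at x)) μ.measure :=
    (hφ.measurePreserving.integrable_comp_of_integrable (hg.integrable h hh)).congr
      (trLogSq_pullback_ae hφ h1 h3).symm
  have hin : ∀ x, IsInnerForm ((h.pullback φ).at x) := fun x => by
    rw [pullback_at]
    exact (hh.isInnerForm _).formPullback _
  obtain ⟨C, hC⟩ := exists_trLogSq_le_of_continuousOn
    (continuousOn_chartForm_pullback φ.contMDiff hh.continuousOn_chartForm)
    hh.continuousOn_chartForm hin hh.isInnerForm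
  have := isFiniteMeasure_measure μ
  have i2 : Integrable (fun x => trLogSq ((h.pullback φ).at x) (h.at x)) μ.measure := by
    refine Integrable.of_bound (h4.aemeasurable_trLogSq h3).aestronglyMeasurable C
      (Filter.Eventually.of_forall fun x => ?_)
    rw [Real.norm_of_nonneg (trLogSq_nonneg (hin x) (hh.isInnerForm x))]
    exact hC x
  exact (h2.triangle h4 h3 i1 i2).1

theorem pullback_congr_ae {φ : M ≃ₘ^1⟮𝓡 n, 𝓡 n⟯ M} (hφ : PreservesForm μ φ)
    {g h : TensorField n M} (H : ∀ᵐ x ∂μ.measure, g x = h x) :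
    ∀ᵐ x ∂μ.measure, g.pullback φ x = h.pullback φ x := by
  filter_upwards [hφ.measurePreserving.quasiMeasurePreserving.ae H] with x hx
  rw [TensorField.pullback, TensorField.pullback, hx]

end Pullback

/-! ### The space `X` -/

section Space

variable {n : ℕ} {M : Type*} [TopologicalSpace M] [ChartedSpace (EuclideanSpace ℝ (Fin n)) M]
  [IsManifold (𝓡 n) ∞ M] [MeasurableSpace M] [BorelSpace M] [CompactSpace M] [T2Space M]
  {μ : VolumeForm n M} {s : ℝ}

theorem XSpace.ind {P : XSpace μ s → Prop}
    (h : ∀ (g : TensorField n M) (hg : IsXField μ s g), P (XSpace.mk g hg)) (p : XSpace μ s) : P p :=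
  Quotient.inductionOn p fun g => h g.1 g.2

theorem XSpace.mk_eq_mk {g h : TensorField n M} {hg : IsXField μ s g} {hh : IsXField μ s h}
    (H : ∀ᵐ x ∂μ.measure, g x = h x) : XSpace.mk g hg = XSpace.mk h hh :=
  Quotient.sound H

variable (μ s) in
/-- The metric `δ` on `X`. -/
@[reducible]
def XSpace.metricSpace : MetricSpace (XSpace μ s) where
  dist := XSpace.delta
  dist_self := XSpace.ind fun g hg => fieldDelta_self hg.isInnerField
  dist_comm p q := by
    induction p using XSpace.ind with | h g hg => ?_
    induction q using XSpace.ind with | h h hh => ?_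
    exact hg.isInnerField.fieldDelta_comm hh.isInnerField
  dist_triangle p q r := by
    induction p using XSpace.ind with | h g hg => ?_
    induction q using XSpace.ind with | h h hh => ?_
    induction r using XSpace.ind with | h k hk => ?_
    exact (hg.isInnerField.triangle hh.isInnerField hk.isInnerField
      (hg.integrable_trLogSq hh) (hh.integrable_trLogSq hk)).2
  eq_of_dist_eq_zero {p q} h := by
    induction p using XSpace.ind with | h g hg => ?_
    induction q using XSpace.ind with | h h' hh => ?_
    exact XSpace.mk_eq_mk (eq_of_fieldDelta_eq_zero hg.isInnerField hh.isInnerField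
      (hg.integrable_trLogSq hh) h)

attribute [local instance] XSpace.metricSpace

theorem XSpace.exists_rep (p : XSpace μ s) :
    ∃ (g : TensorField n M) (hg : IsXField μ s g), XSpace.mk g hg = p := by
  induction p using XSpace.ind with | h g hg => ?_
  exact ⟨g, hg, rfl⟩

theorem XSpace.completeSpace : CompleteSpace (XSpace μ s) := by
  refine Metric.complete_of_convergent_controlled_sequences (fun N => (1 / 4) ^ N)
    (fun N => by positivity) fun u hu => ?_
  choose g hg hgu using fun k => XSpace.exists_rep (u k)
  obtain ⟨p, hp, hlim⟩ := exists_limit_field hg fun N k l hk hl => by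
    have := hu N k l hk hl
    rwa [← hgu, ← hgu] at this
  refine ⟨XSpace.mk p hp, tendsto_iff_dist_tendsto_zero.mpr ?_⟩
  refine squeeze_zero (fun _ => dist_nonneg) (fun k => ?_)
    (tendsto_pow_atTop_nhds_zero_of_lt_one (r := (1 / 4 : ℝ)) (by norm_num) (by norm_num))
  rw [← hgu k]
  exact hlim k

/-- The geodesic `g exp (t g⁻¹ A)` as a curve in `X`. -/
def geodesicCurve {g A : TensorField n M} (hg : IsXField μ s g) (hA : IsL2Traceless μ g A) (t : ℝ) :
    XSpace μ s :=
  XSpace.mk (geodesicField g A t) (hg.geodesicField hA t)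

theorem dist_geodesicCurve {g A : TensorField n M} (hg : IsXField μ s g)
    (hA : IsL2Traceless μ g A) (a b : ℝ) :
    dist (geodesicCurve hg hA a) (geodesicCurve hg hA b) =
      |b - a| * √(∫ x, normSqAt (g.at x) (A.at x) ∂μ.measure) :=
  fieldDelta_geodesicField hg.isInnerField hA.symm a b

theorem isGeodesic_geodesicCurve {g A : TensorField n M} (hg : IsXField μ s g)
    (hA : IsL2Traceless μ g A) {a b : ℝ} (hab : a ≤ b) :
    IsGeodesic fun t => geodesicCurve hg hA (a + t * (b - a)) := by
  have hab' := sub_nonneg.mpr hab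
  refine isGeodesic_of_dist_eq
    (D := (b - a) * √(∫ x, normSqAt (g.at x) (A.at x) ∂μ.measure))
    (mul_nonneg hab' (Real.sqrt_nonneg _)) fun t _ u _ => ?_
  rw [dist_geodesicCurve, show a + u * (b - a) - (a + t * (b - a)) = (u - t) * (b - a) by ring,
    abs_mul, abs_of_nonneg hab', mul_assoc]

theorem geodesicCurve_zero {g A : TensorField n M} (hg : IsXField μ s g)
    (hA : IsL2Traceless μ g A) : geodesicCurve hg hA 0 = XSpace.mk g hg := by
  simp only [geodesicCurve, geodesicField_zero]

theorem geodesicCurve_logField_one {g h : TensorField n M} (hg : IsXField μ s g)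
    (hh : IsXField μ s h) : geodesicCurve hg (hg.isL2Traceless_logField hh) 1 = XSpace.mk h hh :=
  XSpace.mk_eq_mk (geodesicField_logField_one hg.isInnerField hh.isInnerField)

/-- The nonpositive curvature inequality in `X`, along the explicit geodesics. -/
theorem geodesicCurve_npc {g A : TensorField n M} (hg : IsXField μ s g)
    (hA : IsL2Traceless μ g A) (q : XSpace μ s) {t : ℝ} (ht : t ∈ Icc (0 : ℝ) 1) :
    dist q (geodesicCurve hg hA t) ^ 2 ≤ (1 - t) * dist q (geodesicCurve hg hA 0) ^ 2 +
      t * dist q (geodesicCurve hg hA 1) ^ 2 -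
        t * (1 - t) * dist (geodesicCurve hg hA 0) (geodesicCurve hg hA 1) ^ 2 := by
  induction q using XSpace.ind with | h q hq => ?_
  rw [dist_geodesicCurve, mul_pow, Real.sq_sqrt, sub_zero, abs_one, one_pow, one_mul]
  · exact fieldDelta_geodesicField_le hg hA hq ht
  · refine integral_nonneg_of_ae ?_
    filter_upwards [hg.isInnerField.inner, hA.symm] with x h1 h2 using normSqAt_nonneg h1 h2

theorem isGeodesic_geodesicCurve_one {g A : TensorField n M} (hg : IsXField μ s g)
    (hA : IsL2Traceless μ g A) : IsGeodesic (geodesicCurve hg hA) := by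
  simpa using isGeodesic_geodesicCurve hg hA zero_le_one

/-- Every geodesic of `X` is one of the explicit geodesics: the one with velocity `g log (g⁻¹ h)`
between its endpoints, by uniqueness. -/
theorem IsGeodesic.exists_eq_geodesicCurve {γ : ℝ → XSpace μ s} (hγ : IsGeodesic γ) :
    ∃ (g A : TensorField n M) (hg : IsXField μ s g) (hA : IsL2Traceless μ g A),
      ∀ t ∈ Icc (0 : ℝ) 1, γ t = geodesicCurve hg hA t := by
  obtain ⟨g, hg, h0⟩ := XSpace.exists_rep (γ 0)
  obtain ⟨h, hh, h1⟩ := XSpace.exists_rep (γ 1)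
  have hA := hg.isL2Traceless_logField hh
  refine ⟨g, logField g h, hg, hA, fun t ht => ?_⟩
  refine hγ.eq_of_npc ?_ ?_ (fun q t ht => geodesicCurve_npc hg hA q ht) ht
  · rw [geodesicCurve_zero, h0]
  · rw [geodesicCurve_logField_one hg hh, h1]

theorem XSpace.isGlobalNPC : IsGlobalNPC (XSpace μ s) := by
  refine ⟨fun p q => ?_, fun γ hγ q t ht => ?_⟩
  · obtain ⟨g, hg, rfl⟩ := XSpace.exists_rep p
    obtain ⟨h, hh, rfl⟩ := XSpace.exists_rep q
    exact ⟨geodesicCurve hg (hg.isL2Traceless_logField hh), isGeodesic_geodesicCurve_one hg _,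
      geodesicCurve_zero hg _, geodesicCurve_logField_one hg hh⟩
  · obtain ⟨g, A, hg, hA, h⟩ := hγ.exists_eq_geodesicCurve
    rw [hγ.curveLength_eq, h t ht, h 0 (by simp), h 1 (by simp)]
    exact geodesicCurve_npc hg hA q ht

/-- Pullback on `X` by a volume preserving diffeomorphism. -/
def XSpace.pullback {φ : M ≃ₘ^1⟮𝓡 n, 𝓡 n⟯ M} (hφ : PreservesForm μ φ) (p : XSpace μ s) :
    XSpace μ s :=
  Quotient.liftOn p (fun g => XSpace.mk (g.1.pullback φ) (g.2.pullback hφ)) fun _ _ h =>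
    XSpace.mk_eq_mk (pullback_congr_ae hφ h)

theorem XSpace.pullback_pullback_of_comp_eq_id {φ ψ : M ≃ₘ^1⟮𝓡 n, 𝓡 n⟯ M}
    (hφ : PreservesForm μ φ) (hψ : PreservesForm μ ψ) (h : ∀ x, φ (ψ x) = x) (p : XSpace μ s) :
    XSpace.pullback hψ (XSpace.pullback hφ p) = p := by
  induction p using XSpace.ind with | h g hg => ?_
  refine XSpace.mk_eq_mk (Filter.Eventually.of_forall fun x => ?_)
  rw [pullback_pullback φ.contMDiff ψ.contMDiff, show φ ∘ ψ = id from funext h, pullback_id]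

/-- Pullback as an isometry of `X` onto itself. -/
def XSpace.pullbackIsometry {φ : M ≃ₘ^1⟮𝓡 n, 𝓡 n⟯ M} (hφ : PreservesForm μ φ) :
    XSpace μ s ≃ᵢ XSpace μ s where
  toFun := XSpace.pullback hφ
  invFun := XSpace.pullback hφ.symm
  left_inv := XSpace.pullback_pullback_of_comp_eq_id hφ hφ.symm φ.apply_symm_apply
  right_inv := XSpace.pullback_pullback_of_comp_eq_id hφ.symm hφ φ.symm_apply_apply
  isometry_toFun := by
    refine Isometry.of_dist_eq fun p q => ?_
    induction p using XSpace.ind with | h g hg => ?_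
    induction q using XSpace.ind with | h h hh => ?_
    exact fieldDelta_pullback hφ hg.isInnerField hh.isInnerField

theorem XSpace.pullbackIsometry_refl (h : PreservesForm μ (Diffeomorph.refl (𝓡 n) M 1)) :
    XSpace.pullbackIsometry (s := s) h = IsometryEquiv.refl (XSpace μ s) := by
  refine IsometryEquiv.ext fun p => ?_
  induction p using XSpace.ind with | h g hg => ?_
  refine XSpace.mk_eq_mk (Filter.Eventually.of_forall fun x => ?_)
  exact congrFun (pullback_id g) x

end Space

end

theorem theorem3p2 {n : ℕ} {M : Type*} [TopologicalSpace M]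
    [ChartedSpace (EuclideanSpace ℝ (Fin n)) M] [IsManifold (𝓡 n) ∞ M] [CompactSpace M] [T2Space M]
    [MeasurableSpace M] [BorelSpace M] (μ : VolumeForm n M) (s : ℝ) (hs : (n : ℝ) / 2 < s) :
    -- the integral defining `δ` is finite on `X`
    (∀ g h : TensorField n M, IsXField μ s g → IsXField μ s h →
      Integrable (fun x => trLogSq (g x) (h x)) μ.measure) ∧
    -- `δ` is a metric on `X`, and `(X, δ)` is a complete global NPC space
    ∃ _ : MetricSpace (XSpace μ s),
      (∀ p q : XSpace μ s, dist p q = XSpace.delta p q) ∧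
      CompleteSpace (XSpace μ s) ∧
      IsGlobalNPC (XSpace μ s) ∧
      -- the curves `g exp (t g⁻¹ A)`, `t ∈ ℝ`, lie in `X` and are geodesics
      (∀ (g A : TensorField n M) (_ : IsXField μ s g) (_ : IsL2Traceless μ g A),
        ∃ hX : ∀ t : ℝ, IsXField μ s (geodesicField g A t),
          ∀ a b : ℝ, a ≤ b →
            IsGeodesic fun t : ℝ => XSpace.mk (geodesicField g A (a + t * (b - a))) (hX _)) ∧
      -- every geodesic is of this form
      (∀ γ : ℝ → XSpace μ s, IsGeodesic γ →
        ∃ g A : TensorField n M, IsXField μ s g ∧ IsL2Traceless μ g A ∧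
          ∀ t ∈ Icc (0 : ℝ) 1, ∃ hX : IsXField μ s (geodesicField g A t),
            γ t = XSpace.mk (geodesicField g A t) hX) ∧
      -- the `H^{s+1}` volumorphisms act by pullback, by isometries of `(X, δ)`
      ∃ T : {φ : M ≃ₘ^1⟮𝓡 n, 𝓡 n⟯ M // IsSobolevVolumorphism μ (s + 1) φ} →
          (XSpace μ s ≃ᵢ XSpace μ s),
        (∀ φ, ∀ (g : TensorField n M) (hg : IsXField μ s g),
          ∃ hX : IsXField μ s (g.pullback φ.1),
            T φ (XSpace.mk g hg) = XSpace.mk (g.pullback φ.1) hX) ∧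
        (∃ hid : IsSobolevVolumorphism μ (s + 1) (Diffeomorph.refl (𝓡 n) M 1),
          T ⟨Diffeomorph.refl (𝓡 n) M 1, hid⟩ = IsometryEquiv.refl (XSpace μ s)) ∧
        (∀ φ ψ, ∀ (g : TensorField n M) (hg : IsXField μ s g),
          ∃ hX : IsXField μ s (g.pullback (φ.1 ∘ ψ.1)),
            T ψ (T φ (XSpace.mk g hg)) = XSpace.mk (g.pullback (φ.1 ∘ ψ.1)) hX) := by
  have hform : ∀ φ : {φ : M ≃ₘ^1⟮𝓡 n, 𝓡 n⟯ M // IsSobolevVolumorphism μ (s + 1) φ},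
      PreservesForm μ φ.1 := fun φ => φ.2.preserves
  refine ⟨fun g h hg hh => hg.integrable_trLogSq hh, XSpace.metricSpace μ s, fun _ _ => rfl,
    XSpace.completeSpace, XSpace.isGlobalNPC, fun g A hg hA => ⟨hg.geodesicField hA, fun a b hab =>
      isGeodesic_geodesicCurve hg hA hab⟩, fun γ hγ => ?_,
    fun φ => XSpace.pullbackIsometry (hform φ), fun φ g hg => ⟨hg.pullback (hform φ), rfl⟩,
    ⟨isSobolevVolumorphism_refl μ _, XSpace.pullbackIsometry_refl _⟩,
    fun φ ψ g hg => ?_⟩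
  · obtain ⟨g, A, hg, hA, h⟩ := hγ.exists_eq_geodesicCurve
    exact ⟨g, A, hg, hA, fun t ht => ⟨hg.geodesicField hA t, h t ht⟩⟩
  · have h1 := pullback_pullback φ.1.contMDiff ψ.1.contMDiff g
    refine ⟨h1 ▸ (hg.pullback (hform φ)).pullback (hform ψ), ?_⟩
    exact XSpace.mk_eq_mk (Filter.Eventually.of_forall fun x => congrFun h1 x)
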